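/- **Setting.** Let $N\ge 1$ and $K\in\mathbb N\cup\{\infty\}$. Let $\mathcal B$ be the set of symmetric real $N\times N$ matrices $B$ with strictly positive entries and all eigenvalues in $(0,1)$. Write $b_{\max}$, $b_{\min}$ for the largest and smallest entry of $B$, and $d=\prod_{j=1}^N\sqrt{1-\lambda_j^2}$, where $\lambda_1,\dots,\lambda_N$ are the eigenvalues of $B$. For $I\in\mathbb N^N$ put $|I|=\sum_j i_j$, $I!=\prod_j i_j!$, and let $B_I$ be the matrix obtained from $B$ by repeating its $j$-th row and column $i_j$ times. $\mathrm{Haf}(M)=\frac1{m!2^m}\sum_{\sigma\in S_{2m}}\prod_{j=1}^m M_{\sigma(2j-1),\sigma(2j)}$ is the hafnian of a $2m\times 2m$ matrix ($\mathrm{Haf}$ of the empty matrix is $1$). Let $\mathcal A=\prod_{k=0}^K\mathbb R_{\ge0}^{\{I:\,|I|=2k\}}$ with the product topology, and for $a=(a_I)\in\mathcal A$ put $$\mu=\sum_{k=0}^K\sum_{|I|=2k}a_I\mathrm{Haf}(B_I)^2,\quad Q^{\mathrm{GBS\text{-}I}}=\frac1d\sum_{k=0}^K\sum_{|I|=2k}a_I^2\,I!\,\mathrm{Haf}(B_I)^2,\quad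 Q^{\mathrm{MC}}=\sum_{k_1,k_2=0}^K\ \sum_{|I|=2k_1,\,|J|=2k_2}a_Ia_J\mathrm{Haf}(B_{I+J})^2 .$$ The problem space $\mathcal P\subseteq\mathcal A\times\mathcal B$ is the set of pairs $(a,B)$ for which these three sums are finite and $\mu\ne0$. For $0<\epsilon,\delta<1$ and $(a,B)\in\mathcal P$, the guaranteed sample sizes of the GBS importance estimator and of plain Monte Carlo are $$n^{\mathrm{GBS\text{-}I}}=\frac{Q^{\mathrm{GBS\text{-}I}}-\mu^2}{\delta\epsilon^2\mu^2},\qquad n^{\mathrm{MC}}=\frac{Q^{\mathrm{MC}}-\mu^2}{\delta\epsilon^2\mu^2}.$$ Let $\mathrm{Li}_{s,K}(z)=\sum_{k=1}^K z^k/k^s$. For $k\ge1$ write $2k=Ns_k+r_k$ with integers $s_k\ge 0$, $1\le r_k\le N$; put $s_\infty=\infty$ and $m_k=(s_k!)^N(s_k+1)^{r_k}$. Let $h_{q,n}(z)=\sum_{k=1}^n\frac{k^q}{(2k)!}z^{2k}$, $q^-=\min(q,0)$, $$G_{q,K,N}(z)=h_{q,\lfloor N/2\rfloor}(z)+2^{-q^-}(2\pi)^{\frac{N-1}2}N^{q-\frac12}e^{\frac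 N{12}}\,\mathrm{Li}_{0,N}\!\left(\tfrac{2z}N\right)\mathrm{Li}_{\frac12-\frac N2-q,\,s_K}\!\left(\tfrac{z^N}{N^N}\right)$$ (defined for $|z|<N$ only, if $K=\infty$), and let $R_{q,K}(z)=\frac{2^{-q}}{2\sqrt\pi}\mathrm{Li}_{\frac12-q,K}(z)$ if $q\ge0$, $R_{q,K}(z)=\frac1{2\sqrt\pi}\mathrm{Li}_{\frac12-2q,K}(z)$ if $q<0$. Let $\zeta,p,\gamma_\alpha,\gamma_\beta,C_G,C_D>0$, $C_R>1$, $q_\alpha,q_\beta\in\mathbb R$. Let $\mathcal B''_{\alpha,\beta}$ be the set of $B\in\mathcal B$ (with $\gamma_\beta b_{\max}<N$ if $K=\infty$) such that $$G_{2q_\beta,K,N}(\gamma_\beta b_{\max})<C_GN^3,\qquad R_{q_\alpha,K}(4\gamma_\alpha b_{\min}^2)>\tfrac1{2\sqrt\pi}(\zeta N^2)^{2q_\alpha-\frac12}C_R^{\zeta N^2},\qquad \tfrac1d<C_DN^p .$$ Call $(a,B)\in\mathcal P$ *admissible* (for these data) if $B\in\mathcal B''_{\alpha,\beta}$, $a_0\ne0$,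 and for all $1\le k\le K$ $$\frac{k^{q_\alpha}\gamma_\alpha^k}{(2k)!}\le\sum_{|I|=2k}a_I\le\frac{k^{q_\beta}\gamma_\beta^k}{(2k)!},\qquad \sum_{|I|=2k}a_I^2I!\le\frac{k^{2q_\beta}\gamma_\beta^{2k}}{(2k)!^2}m_k .$$ For a sequence $q_\alpha=q_\alpha(N)$, say that $C_R^{\zeta N^2}$ *dominates* if $\log\big(\tfrac1{2\sqrt\pi}(\zeta N^2)^{2q_\alpha(N)-1/2}C_R^{\zeta N^2}\big)\big/\log C_R^{\zeta N^2}\to1$ as $N\to\infty$. **Theorem.** 1. For all $N\ge1$, all $K\ge\zeta N^2$ ($K=\infty$ allowed), all $0<\epsilon,\delta<1$ and all admissible $(a,B)$, $$n^{\mathrm{GBS\text{-}I}}<\frac1{\epsilon^2\delta}\left(C_DN^p+\frac{C_GC_DN^{3+p}}{a_0^2\sqrt\pi}-1\right).$$ 2. Let $\zeta>0$, $C_R>1$ and let $q_\alpha=q_\alpha(N)$ be a sequence such that $C_R^{\zeta N^2}$ dominates. Then there is $N_1$, depending only on these data, such that for all $N\ge N_1$, all $K\ge\zeta N^2$ ($K=\infty$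 allowed), all $0<\epsilon,\delta<1$, all values of the remaining parameters and all admissible $(a,B)$, $$n^{\mathrm{MC}}>\frac1{\epsilon^2\delta}\,\frac{\frac{e^{\frac1{25}-\frac16}}{2\sqrt\pi}(\zeta N^2)^{2q_\alpha-\frac12}C_R^{\zeta N^2}}{C_DN^p\left(a_0^2+\frac1{\sqrt\pi}C_GN^3\right)} .$$ 3. Consequently, if in addition $p$, $C_G$, $C_D$ and the value $a_0>0$ are fixed independently of $N$, and $1<C<C_R$, then there are $c_1,c_2>0$ and $N_1$ such that for all $N\ge N_1$, $K\ge\zeta N^2$, $\gamma_\alpha,\gamma_\beta>0$, $q_\beta\in\mathbb R$, $0<\epsilon,\delta<1$ and all admissible $(a,B)$ with this $a_0$: $n^{\mathrm{GBS\text{-}I}}\le\frac1{\epsilon^2\delta}c_1N^{3+p}$ and $n^{\mathrm{MC}}\ge\frac1{\epsilon^2\delta}c_2C^{\zeta N^2}$. 4. For all $\zeta,p>0$ there are constants $C_G,C_D>0$, $C_R>1$ and sequences $\gamma_\alpha(N),\gamma_\beta(N)>0$, $q_\alpha(N),q_\beta(N)\in\mathbb R$ such that $C_R^{\zeta N^2}$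 dominates and, for all sufficiently large $N$ and all finite $K\ge\zeta N^2$, there is a non-empty open subset $U$ of $\mathcal P$ all of whose elements are admissible; moreover every $a_0>0$ occurs as the zeroth coefficient of some element of $U$. -/

import Mathlib

open Filter Topology
open scoped NNReal ENNReal

noncomputable section

namespace GBS

/-! ### Hafnians and repeated matrices -/

/-- The hafnian of a square matrix: `1 / (m! 2^m) * ∑ σ, ∏ j < m, M (σ (2j)) (σ (2j+1))` in even
size `2m` (with zero-based indices; the empty matrix has hafnian `1`), and `0` in odd size. -/
def hafnian {n : ℕ} (M : Matrix (Fin n) (Fin n) ℝ) : ℝ :=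
  if Even n then
    1 / (((n / 2).factorial : ℝ) * 2 ^ (n / 2)) *
      ∑ σ : Equiv.Perm (Fin n), ∏ j : Fin (n / 2),
        M (σ ⟨2 * j.1, by have := j.2; omega⟩) (σ ⟨2 * j.1 + 1, by have := j.2; omega⟩)
  else 0

/-- The matrix `B_I`: the `i`-th row and column of `B` are repeated `I i` times. -/
def repMatrix {N : ℕ} (B : Matrix (Fin N) (Fin N) ℝ) (I : Fin N → ℕ) :
    Matrix (Fin (∑ i, I i)) (Fin (∑ i, I i)) ℝ :=
  B.submatrix (fun s => (finSigmaFinEquiv.symm s).1) (fun s => (finSigmaFinEquiv.symm s).1)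

/-- `Haf(B_I)`. -/
def haf {N : ℕ} (B : Matrix (Fin N) (Fin N) ℝ) (I : Fin N → ℕ) : ℝ := hafnian (repMatrix B I)

/-- `I! = i_1! ⋯ i_N!`. -/
def multiFactorial {N : ℕ} (I : Fin N → ℕ) : ℝ := ∏ i, ((I i).factorial : ℝ)

/-! ### The problem space -/

/-- The degrees `0 ≤ k ≤ K`, where `K` is finite or infinite. -/
abbrev Deg (K : ℕ∞) : Type := {k : ℕ // (k : ℕ∞) ≤ K}

/-- The finite set of all `I ∈ ℕ^N` with `|I| = 2k`. -/
abbrev MIdx (N k : ℕ) : Type :=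
  {I : Fin N → ℕ // I ∈ Finset.piAntidiag (Finset.univ : Finset (Fin N)) (2 * k)}

theorem mem_MIdx_iff (N k : ℕ) (I : Fin N → ℕ) :
    I ∈ Finset.piAntidiag (Finset.univ : Finset (Fin N)) (2 * k) ↔ ∑ i, I i = 2 * k := by
  simp [Finset.mem_piAntidiag]

/-- The space `∏_{k ≤ K} ℝ_{≥0}^{{I : |I| = 2k}}` of coefficient families, with the product
topology. -/
abbrev Coeff (N : ℕ) (K : ℕ∞) : Type := (k : Deg K) → MIdx N k.1 → ℝ≥0

/-- The coefficient `a_0` of the zero multi-index. -/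
def coeffZero {N : ℕ} {K : ℕ∞} (a : Coeff N K) : ℝ :=
  (a ⟨0, by simp⟩ ⟨0, by simp⟩ : ℝ)

/-- Symmetric matrices with strictly positive entries and `0 < spec(B) < 1`. -/
def matrixSpace (N : ℕ) : Set (Matrix (Fin N) (Fin N) ℝ) :=
  {B | (∀ i j, 0 < B i j) ∧ B.transpose = B ∧ ∀ l ∈ spectrum ℝ B, 0 < l ∧ l < 1}

/-- The coefficient families for which, for the matrix `B`, the Gaussian expectation is finite and
non-zero and both second moments are finite. -/
def coeffSpace {N : ℕ} (K : ℕ∞) (B : Matrix (Fin N) (Fin N) ℝ) : Set (Coeff N K) :=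
  {a | (Summable fun k : Deg K => ∑ I : MIdx N k.1, (a k I : ℝ) * haf B I.1 ^ 2) ∧
    (∑' k : Deg K, ∑ I : MIdx N k.1, (a k I : ℝ) * haf B I.1 ^ 2) ≠ 0 ∧
    (Summable fun k : Deg K =>
      ∑ I : MIdx N k.1, (a k I : ℝ) ^ 2 * multiFactorial I.1 * haf B I.1 ^ 2) ∧
    (Summable fun k : Deg K × Deg K =>
      ∑ I : MIdx N k.1.1, ∑ J : MIdx N k.2.1,
        (a k.1 I : ℝ) * (a k.2 J : ℝ) * haf B (I.1 + J.1) ^ 2)}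

/-- The problem space `𝓟`: all pairs `(a, B)` for which both sample sizes are well-defined. -/
def problemSpace (N : ℕ) (K : ℕ∞) : Set (Coeff N K × Matrix (Fin N) (Fin N) ℝ) :=
  {x | x.2 ∈ matrixSpace N ∧ x.1 ∈ coeffSpace K x.2}

/-! ### The guaranteed sample sizes -/

/-- `μ = ∑_{k ≤ K} ∑_{|I| = 2k} a_I Haf(B_I)^2`. -/
def mu {N : ℕ} {K : ℕ∞} (B : Matrix (Fin N) (Fin N) ℝ) (a : Coeff N K) : ℝ :=
  ∑' k : Deg K, ∑ I : MIdx N k.1, (a k I : ℝ) * haf B I.1 ^ 2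

open Classical in
/-- The normalisation constant `d = ∏_j √(1 - λ_j²)` of the sampling distribution, the `λ_j` being
the eigenvalues of `B` with multiplicity (a real matrix is Hermitian iff it is symmetric). -/
def normConst {N : ℕ} (B : Matrix (Fin N) (Fin N) ℝ) : ℝ :=
  if hB : B.IsHermitian then ∏ j, √(1 - hB.eigenvalues j ^ 2) else 0

/-- `Q^{GBS-I} = (1/d) ∑_{k ≤ K} ∑_{|I| = 2k} a_I² I! Haf(B_I)²`. -/
def QGBS {N : ℕ} {K : ℕ∞} (B : Matrix (Fin N) (Fin N) ℝ) (a : Coeff N K) : ℝ :=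
  1 / normConst B * ∑' k : Deg K,
    ∑ I : MIdx N k.1, (a k I : ℝ) ^ 2 * multiFactorial I.1 * haf B I.1 ^ 2

/-- `Q^{MC} = ∑_{k₁, k₂ ≤ K} ∑_{|I| = 2k₁, |J| = 2k₂} a_I a_J Haf(B_{I+J})²`. -/
def QMC {N : ℕ} {K : ℕ∞} (B : Matrix (Fin N) (Fin N) ℝ) (a : Coeff N K) : ℝ :=
  ∑' k : Deg K × Deg K, ∑ I : MIdx N k.1.1, ∑ J : MIdx N k.2.1,
    (a k.1 I : ℝ) * (a k.2 J : ℝ) * haf B (I.1 + J.1) ^ 2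

/-- Guaranteed sample size of the importance estimator. -/
def nGBS {N : ℕ} {K : ℕ∞} (B : Matrix (Fin N) (Fin N) ℝ) (a : Coeff N K) (ε δ : ℝ) : ℝ :=
  (QGBS B a - mu B a ^ 2) / (δ * ε ^ 2 * mu B a ^ 2)

/-- Guaranteed sample size of the plain Monte Carlo estimator. -/
def nMC {N : ℕ} {K : ℕ∞} (B : Matrix (Fin N) (Fin N) ℝ) (a : Coeff N K) (ε δ : ℝ) : ℝ :=
  (QMC B a - mu B a ^ 2) / (δ * ε ^ 2 * mu B a ^ 2)

/-! ### The functions entering the conditions -/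

/-- The largest absolute value of an entry. -/
def bmax {N : ℕ} (B : Matrix (Fin N) (Fin N) ℝ) : ℝ := ⨆ ij : Fin N × Fin N, |B ij.1 ij.2|

/-- The smallest entry. -/
def bmin {N : ℕ} (B : Matrix (Fin N) (Fin N) ℝ) : ℝ := ⨅ ij : Fin N × Fin N, B ij.1 ij.2

/-- The (truncated, if `K < ∞`) polylogarithm `∑_{k=1}^K z^k / k^s`. -/
def polyLog (s : ℝ) (K : ℕ∞) (z : ℝ) : ℝ :=
  ∑' k : ℕ, if 1 ≤ k ∧ (k : ℕ∞) ≤ K then z ^ k / (k : ℝ) ^ s else 0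

/-- The quotient `s_k` in `2k = N s_k + r_k`, `1 ≤ r_k ≤ N`. -/
def sQuot (N k : ℕ) : ℕ := (2 * k - 1) / N

/-- The remainder `r_k` in `2k = N s_k + r_k`, `1 ≤ r_k ≤ N`. -/
def rRem (N k : ℕ) : ℕ := 2 * k - N * sQuot N k

theorem sQuot_rRem_spec (N k : ℕ) (hN : 1 ≤ N) (hk : 1 ≤ k) :
    2 * k = N * sQuot N k + rRem N k ∧ 1 ≤ rRem N k ∧ rRem N k ≤ N := by
  have h1 : N * ((2 * k - 1) / N) + (2 * k - 1) % N = 2 * k - 1 := Nat.div_add_mod _ _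
  have h2 : (2 * k - 1) % N < N := Nat.mod_lt _ hN
  unfold rRem sQuot
  omega

/-- `m_k = (s_k!)^N (s_k + 1)^{r_k}`. -/
def mCoef (N k : ℕ) : ℝ :=
  ((sQuot N k).factorial : ℝ) ^ N * ((sQuot N k : ℝ) + 1) ^ rRem N k

/-- `∑_{k=1}^n k^q / (2k)! z^{2k}`. -/
def hFun (q : ℝ) (n : ℕ) (z : ℝ) : ℝ :=
  ∑ k ∈ Finset.Icc 1 n, (k : ℝ) ^ q / ((2 * k).factorial : ℝ) * z ^ (2 * k)

/-- The function `G_{q,K,N}`; here `ENat.map (sQuot N) K` is `s_K`, with `s_∞ = ∞`. -/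
def GFun (q : ℝ) (K : ℕ∞) (N : ℕ) (z : ℝ) : ℝ :=
  hFun q (N / 2) z +
    (2 : ℝ) ^ (-min q 0) * (2 * Real.pi) ^ (((N : ℝ) - 1) / 2) * (N : ℝ) ^ (q - 1 / 2) *
      Real.exp ((N : ℝ) / 12) * polyLog 0 (N : ℕ∞) (2 * z / N) *
      polyLog (1 / 2 - (N : ℝ) / 2 - q) (ENat.map (sQuot N) K) (z ^ N / (N : ℝ) ^ N)

/-- The function `R_{q,K}`. -/
def RFun (q : ℝ) (K : ℕ∞) (z : ℝ) : ℝ :=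
  if 0 ≤ q then (2 : ℝ) ^ (-q) * (1 / (2 * √Real.pi)) * polyLog (1 / 2 - q) K z
  else 1 / (2 * √Real.pi) * polyLog (1 / 2 - 2 * q) K z

/-! ### The conditions -/

/-- The set `𝓑''`. For `K = ∞` the function `G_{q,K,N}` is only defined for arguments of absolute
value less than `N`; this is the first condition. -/
def matrixSet (N : ℕ) (K : ℕ∞) (ζ p γα γβ qα qβ CG CD CR : ℝ) :
    Set (Matrix (Fin N) (Fin N) ℝ) :=
  {B | B ∈ matrixSpace N ∧
    (K = ⊤ → γβ * bmax B < N) ∧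
    GFun (2 * qβ) K N (γβ * bmax B) < CG * (N : ℝ) ^ 3 ∧
    RFun qα K (4 * γα * bmin B ^ 2) >
      1 / (2 * √Real.pi) * (ζ * (N : ℝ) ^ 2) ^ (2 * qα - 1 / 2) * CR ^ (ζ * (N : ℝ) ^ 2) ∧
    1 / normConst B < CD * (N : ℝ) ^ p}

/-- The bounds on the coefficients, for all `1 ≤ k ≤ K`. -/
def CoeffBounds {N : ℕ} {K : ℕ∞} (γα γβ qα qβ : ℝ) (a : Coeff N K) : Prop :=
  ∀ k : Deg K, 1 ≤ k.1 →
    (k.1 : ℝ) ^ qα * γα ^ k.1 / ((2 * k.1).factorial : ℝ) ≤ ∑ I : MIdx N k.1, (a k I : ℝ) ∧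
    ∑ I : MIdx N k.1, (a k I : ℝ) ≤ (k.1 : ℝ) ^ qβ * γβ ^ k.1 / ((2 * k.1).factorial : ℝ) ∧
    ∑ I : MIdx N k.1, (a k I : ℝ) ^ 2 * multiFactorial I.1 ≤
      (k.1 : ℝ) ^ (2 * qβ) * γβ ^ (2 * k.1) / ((2 * k.1).factorial : ℝ) ^ 2 * mCoef N k.1

/-- The problem `(a, B)` lies in `𝓟` and satisfies all conditions for one given `N` and `K`. -/
def Admissible {N : ℕ} {K : ℕ∞} (ζ p γα γβ qα qβ CG CD CR : ℝ)
    (x : Coeff N K × Matrix (Fin N) (Fin N) ℝ) : Prop :=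
  x ∈ problemSpace N K ∧ x.2 ∈ matrixSet N K ζ p γα γβ qα qβ CG CD CR ∧
    CoeffBounds γα γβ qα qβ x.1 ∧ coeffZero x.1 ≠ 0

/-- The factor `C_R^{ζN²}` dominates `1/(2√π) (ζN²)^{2q_α(N) - 1/2} C_R^{ζN²}` as `N → ∞`: the
logarithms are asymptotically equal. -/
def Dominates (ζ CR : ℝ) (qα : ℕ → ℝ) : Prop :=
  Tendsto (fun N : ℕ =>
    Real.log (1 / (2 * √Real.pi) * (ζ * (N : ℝ) ^ 2) ^ (2 * qα N - 1 / 2) *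
        CR ^ (ζ * (N : ℝ) ^ 2)) / Real.log (CR ^ (ζ * (N : ℝ) ^ 2))) atTop (𝓝 1)

end GBS

end

/-! Everything rests on two-sided control of `Haf(B_I)`. The `2k` rows of `B_I` are treated as a
word of `2k` letters. Its hafnian depends only on the content `I`, and by `pairHaf_eq` it is, up to
the factor `I!/(k! 2^k)`, the coefficient of `x^I` in the `k`-th power of the quadratic form of `B`.
Write `M_k = (2k)!/(k! 2^k)` for the number of perfect matchings, so that `M_k² = (2k)!
C(2k,k)/4^k`.

Importance sampling. Entrywise `Haf(B_I) ≤ b_max^k M_k` and `M_k² ≤ (2k)!/√π`, so the bound on `∑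
a_I² I!` makes the degree `k` part of the second moment at most `1/√π` times `k^{2q_β} (γ_β
b_max)^{2k} m_k/(2k)!`. Stirling's formula sums these terms to at most `G` (`term_le`,
`sum_le_GFun`). Together with `1/d < C_D N^p` and `μ ≥ a_0` this is the upper bound.

Plain Monte Carlo. The difference `Haf(B_{I+J}) - Haf(B_I) Haf(B_J)` counts, with weights, the
matchings that join the two blocks, so it is increasing in the entries of `B` and at least its value
for the constant matrix `b_min` (`le_haf_add_sub`). Summed over `k₁ + k₂ = k`, the constant case is
the exact value `C(2k,k)/2 - 1` of `sum_antidiagonal_matchings`. For `k ≥ 4` this is at least `17/64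
· 4^k/√k`, so the variance dominates the tail of the series `R`. Domination keeps `q_α` small enough
for the first three terms of `R` to cost at most six per cent. The denominator is controlled by `μ²
≤ Q^{GBS-I}` and the upper bound already proved.

The inequality `μ² ≤ Q^{GBS-I}` is Cauchy–Schwarz once `∑_I Haf(B_I)²/I! ≤ 1/d` is known. The left
side is invariant under orthogonal changes of basis, and for a diagonal matrix its partial sums are
bounded by a product of series `∑ C(2m,m) (λ²/4)^m = 1/√(1-λ²)`.

The open set comes from strict inequalities around `B = (1/(8N)) 1 + (3/(4N)) J`, where all entries
of `J` are one, with coefficients on the most balanced multi-indices and `q_α = q_β = -N`. -/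

noncomputable section

namespace GBS

/-! ### Words and their contents -/

section Words

variable {α ι κ : Type*} [Fintype α] [DecidableEq α] [Fintype ι] [DecidableEq ι] [Fintype κ]

/-- The content of a word: how often each letter occurs. -/
def content {α ι : Type*} [Fintype ι] (w : ι → α) : α →₀ ℕ := ∑ i, Finsupp.single (w i) 1

omit [Fintype α] [DecidableEq ι] in
theorem content_apply (w : ι → α) (a : α) : content w a = Fintype.card {i // w i = a} := by
  simp [content, Finsupp.finsetSum_apply, Finsupp.single_apply, Fintype.card_subtype]

omit [DecidableEq ι] in
theorem sum_content (w : ι → α) : ∑ a, content w a = Fintype.card ι := by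
  simp only [content, Finsupp.finsetSum_apply]
  rw [Finset.sum_comm]
  simp [Finsupp.single_apply]

omit [Fintype α] [DecidableEq α] [DecidableEq ι] in
theorem content_comp_equiv (w : ι → α) (e : κ ≃ ι) : content (w ∘ e) = content w :=
  e.sum_comp fun i => Finsupp.single (w i) 1

omit [Fintype α] [DecidableEq ι] in
theorem exists_equiv_of_content_eq (w : ι → α) (u : κ → α) (h : content w = content u) :
    ∃ e : κ ≃ ι, w ∘ e = u := by
  have hc : ∀ a, Nonempty ({i // u i = a} ≃ {i // w i = a}) := fun a => by
    rw [← Fintype.card_eq, ← content_apply, ← content_apply, h]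
  exact ⟨Equiv.ofFiberEquiv fun a => (hc a).some, funext fun i => Equiv.ofFiberEquiv_map _ i⟩

/-- The product of the factorials of a multi-index. -/
def factProd (I : α →₀ ℕ) : ℝ := ∏ a, ((I a).factorial : ℝ)

omit [DecidableEq α] in
theorem factProd_pos (I : α →₀ ℕ) : 0 < factProd I :=
  Finset.prod_pos fun _ _ => by positivity

/-- These permutations form a coset of the stabiliser of `w`, which is a product of symmetric groups
on the fibres of `w`. -/
theorem card_perm_comp_eq (w u : ι → α) (h : content u = content w) :
    ((Finset.univ.filter fun σ : Equiv.Perm ι => w ∘ σ = u).card : ℝ) = factProd (content w) := by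
  obtain ⟨e, rfl⟩ := exists_equiv_of_content_eq w u h.symm
  have h1 : (Finset.univ.filter fun σ : Equiv.Perm ι => w ∘ σ = w ∘ e).card =
      (Finset.univ.filter fun σ : Equiv.Perm ι => w ∘ σ = w).card := by
    refine Finset.card_bij (fun σ _ => σ * e⁻¹) ?_ ?_ ?_
    · intro σ hσ
      simp only [Finset.mem_filter, Finset.mem_univ, true_and] at hσ ⊢
      rw [Equiv.Perm.coe_mul, ← Function.comp_assoc, hσ, Function.comp_assoc, ← Equiv.Perm.coe_mul]
      simp
    · intro σ _ τ _ hστ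
      simpa using hστ
    · intro σ hσ
      refine ⟨σ * e, ?_, by simp⟩
      simp only [Finset.mem_filter, Finset.mem_univ, true_and] at hσ ⊢
      rw [Equiv.Perm.coe_mul, ← Function.comp_assoc, hσ]
  rw [h1, ← Fintype.card_subtype, DomMulAct.stabilizer_card]
  simp [factProd, content_apply]

theorem sum_perm_comp (w : ι → α) (F : (ι → α) → ℝ) :
    ∑ σ : Equiv.Perm ι, F (w ∘ σ) =
      factProd (content w) * ∑ u : ι → α with content u = content w, F u := by
  rw [Finset.mul_sum, ← Finset.sum_fiberwise_of_maps_to (s := Finset.univ)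
    (t := Finset.univ.filter fun u : ι → α => content u = content w)
    (g := fun σ : Equiv.Perm ι => w ∘ σ)]
  · refine Finset.sum_congr rfl fun u hu => ?_
    simp only [Finset.mem_filter, Finset.mem_univ, true_and] at hu
    rw [← card_perm_comp_eq w u hu, Finset.sum_congr rfl (g := fun _ => F u), Finset.sum_const,
      nsmul_eq_mul]
    intro σ hσ
    simp only [Finset.mem_filter, Finset.mem_univ, true_and] at hσ
    rw [hσ]
  · intro σ _
    simp [content_comp_equiv]

theorem card_words (w : ι → α) :
    factProd (content w) * ((Finset.univ.filter fun u : ι → α => content u = content w).card : ℝ)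
      = ((Fintype.card ι).factorial : ℝ) := by
  have h := sum_perm_comp w fun _ => 1
  simp only [Finset.sum_const, Finset.card_univ, Fintype.card_perm, nsmul_eq_mul, mul_one] at h
  exact h.symm

omit [DecidableEq ι] in
theorem exists_word (I : α →₀ ℕ) (h : ∑ a, I a = Fintype.card ι) :
    ∃ w : ι → α, content w = I := by
  have h1 : Fintype.card ι = Fintype.card (Σ a, Fin (I a)) := by simp [h]
  let e := Fintype.equivOfCardEq h1
  refine ⟨fun i => (e i).1, ?_⟩
  have := content_comp_equiv (fun s : Σ a, Fin (I a) => s.1) e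
  rw [Function.comp_def] at this
  rw [this]
  ext a
  rw [content_apply, Fintype.card_congr (Equiv.sigmaSubtype a), Fintype.card_fin]

end Words

/-! ### Hafnians of words -/

section PairHaf

variable {α : Type*}

/-- The weight `∏_j A(u(j,0), u(j,1))` of a word of pairs. -/
def pairWeight (A : Matrix α α ℝ) {k : ℕ} (u : Fin k × Fin 2 → α) : ℝ :=
  ∏ j, A (u (j, 0)) (u (j, 1))

/-- The hafnian of the matrix with entries `A (w i) (w j)`. -/
def pairHaf (A : Matrix α α ℝ) {k : ℕ} (w : Fin k × Fin 2 → α) : ℝ :=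
  1 / ((k.factorial : ℝ) * 2 ^ k) * ∑ σ : Equiv.Perm (Fin k × Fin 2), pairWeight A (w ∘ σ)

theorem pairHaf_comp (A : Matrix α α ℝ) {k : ℕ} (w : Fin k × Fin 2 → α)
    (e : Equiv.Perm (Fin k × Fin 2)) : pairHaf A (w ∘ e) = pairHaf A w := by
  unfold pairHaf
  congr 1
  exact Fintype.sum_equiv (Equiv.mulLeft e) _ _ fun σ => rfl

/-- Indexing positions by `Fin k × Fin 2` makes the matched pairs visible. By permutation invariance
`e` may be replaced by the bijection that sends `(j, 0)` and `(j, 1)` to `2j` and `2j + 1`. -/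
theorem hafnian_submatrix (A : Matrix α α ℝ) {n k : ℕ} (w : Fin n → α) (e : Fin k × Fin 2 ≃ Fin n) :
    hafnian (A.submatrix w w) = pairHaf A (w ∘ e) := by
  have hn : k * 2 = n := by simpa using Fintype.card_congr e
  subst hn
  have h1 : w ∘ e = (w ∘ finProdFinEquiv) ∘ (e.trans finProdFinEquiv.symm) := by
    ext i
    exact congrArg w (finProdFinEquiv.apply_symm_apply (e i)).symm
  rw [h1, pairHaf_comp]
  have hk : k * 2 / 2 = k := by omega
  unfold hafnian pairHaf
  rw [if_pos ⟨k, by ring⟩]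
  congr 1
  · simp only [hk]
  rw [← (finProdFinEquiv (m := k) (n := 2)).permCongr.sum_comp]
  refine Finset.sum_congr rfl fun σ _ => ?_
  unfold pairWeight
  rw [← (finCongr hk).prod_comp]
  refine Finset.prod_congr rfl fun j _ => ?_
  have h0 : (⟨2 * j.1, by have := j.2; omega⟩ : Fin (k * 2)) =
      finProdFinEquiv ((finCongr hk) j, (0 : Fin 2)) := by
    ext; simp [finProdFinEquiv]
  have h2 : (⟨2 * j.1 + 1, by have := j.2; omega⟩ : Fin (k * 2)) =
      finProdFinEquiv ((finCongr hk) j, (1 : Fin 2)) := by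
    ext; simp [finProdFinEquiv]; ring
  simp only [h0, h2, Matrix.submatrix_apply, Equiv.permCongr_apply, Equiv.symm_apply_apply,
    Function.comp_apply]

variable [Fintype α] [DecidableEq α]

/-- The quadratic form of `A` as a polynomial. -/
def quad (A : Matrix α α ℝ) : MvPolynomial α ℝ :=
  ∑ p : α × α, MvPolynomial.monomial (Finsupp.single p.1 1 + Finsupp.single p.2 1) (A p.1 p.2)

omit [Fintype α] [DecidableEq α] in
theorem prod_monomial {ι : Type*} (s : Finset ι) (f : ι → α →₀ ℕ) (c : ι → ℝ) :
    ∏ i ∈ s, MvPolynomial.monomial (f i) (c i) =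
      MvPolynomial.monomial (∑ i ∈ s, f i) (∏ i ∈ s, c i) := by
  classical
  induction s using Finset.induction_on with
  | empty => simp
  | insert i s hi ih =>
    rw [Finset.prod_insert hi, Finset.sum_insert hi, Finset.prod_insert hi, ih,
      MvPolynomial.monomial_mul]

/-- Expanding the power picks a pair of letters from each of the `k` factors, that is, a word of
length `2k`. -/
theorem coeff_quad_pow (A : Matrix α α ℝ) (k : ℕ) (I : α →₀ ℕ) :
    MvPolynomial.coeff I (quad A ^ k) =
      ∑ u : Fin k × Fin 2 → α with content u = I, pairWeight A u := by
  have h1 : quad A ^ k = ∑ u : Fin k × Fin 2 → α,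
      MvPolynomial.monomial (content u) (pairWeight A u) := by
    rw [quad, Fintype.sum_pow]
    let e : (Fin k → α × α) ≃ (Fin k × Fin 2 → α) :=
      (Equiv.arrowCongr (Equiv.refl _) (finTwoArrowEquiv α).symm).trans
        (Equiv.curry (Fin k) (Fin 2) α).symm
    rw [← e.sum_comp]
    refine Finset.sum_congr rfl fun v _ => ?_
    rw [prod_monomial]
    congr 1
    simp [content, Fintype.sum_prod_type, e, finTwoArrowEquiv]
  rw [h1, MvPolynomial.coeff_sum, Finset.sum_filter]
  refine Finset.sum_congr rfl fun u _ => ?_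
  rw [MvPolynomial.coeff_monomial]

/-- The generating function of the hafnians. It shows that only the content matters and turns block
structure into products of polynomials. -/
theorem pairHaf_eq (A : Matrix α α ℝ) {k : ℕ} (w : Fin k × Fin 2 → α) :
    pairHaf A w = factProd (content w) / ((k.factorial : ℝ) * 2 ^ k) *
      MvPolynomial.coeff (content w) (quad A ^ k) := by
  rw [pairHaf, sum_perm_comp w (pairWeight A), coeff_quad_pow]
  ring

theorem pairHaf_congr (A : Matrix α α ℝ) {k : ℕ} {w u : Fin k × Fin 2 → α}
    (h : content w = content u) : pairHaf A w = pairHaf A u := by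
  rw [pairHaf_eq, pairHaf_eq, h]

end PairHaf

/-! ### Block-diagonal hafnians -/

section Blocks

variable {α : Type*} [Fintype α] [DecidableEq α]

omit [DecidableEq α] in
theorem coeff_quad_pow_eq_zero (A : Matrix α α ℝ) (k : ℕ) (I : α →₀ ℕ) (h : ∑ a, I a ≠ k * 2) :
    MvPolynomial.coeff I (quad A ^ k) = 0 := by
  classical
  rw [coeff_quad_pow, Finset.sum_eq_zero]
  intro u hu
  refine absurd ?_ h
  rw [← (Finset.mem_filter.1 hu).2, sum_content]
  simp

omit [Fintype α] [DecidableEq α] in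
theorem mapDomain_inl_add_inr_inj {I J I' J' : α →₀ ℕ}
    (h : I.mapDomain (Sum.inl : α → α ⊕ α) + J.mapDomain (Sum.inr : α → α ⊕ α) =
      I'.mapDomain (Sum.inl : α → α ⊕ α) + J'.mapDomain (Sum.inr : α → α ⊕ α)) :
    I = I' ∧ J = J' := by
  constructor
  · ext a
    have := DFunLike.congr_fun h (Sum.inl a)
    simpa [Finsupp.mapDomain_apply Sum.inl_injective, Finsupp.mapDomain_of_notMem_range] using this
  · ext a
    have := DFunLike.congr_fun h (Sum.inr a)
    simpa [Finsupp.mapDomain_apply Sum.inr_injective, Finsupp.mapDomain_of_notMem_range] using this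

-- The two factors involve disjoint sets of variables, so a monomial splits in only one way.
omit [Fintype α] [DecidableEq α] in
theorem coeff_rename_mul_rename (I J : α →₀ ℕ) (p q : MvPolynomial α ℝ) :
    MvPolynomial.coeff (I.mapDomain (Sum.inl : α → α ⊕ α) + J.mapDomain (Sum.inr : α → α ⊕ α))
      (MvPolynomial.rename Sum.inl p * MvPolynomial.rename Sum.inr q) =
      MvPolynomial.coeff I p * MvPolynomial.coeff J q := by
  classical
  induction p using MvPolynomial.induction_on' with
  | add p₁ p₂ h₁ h₂ => simp only [map_add, add_mul, MvPolynomial.coeff_add, h₁, h₂]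
  | monomial u a =>
    induction q using MvPolynomial.induction_on' with
    | add q₁ q₂ h₁ h₂ => simp only [map_add, mul_add, MvPolynomial.coeff_add, h₁, h₂]
    | monomial v b =>
      rw [MvPolynomial.rename_monomial, MvPolynomial.rename_monomial, MvPolynomial.monomial_mul,
        MvPolynomial.coeff_monomial, MvPolynomial.coeff_monomial, MvPolynomial.coeff_monomial]
      by_cases h : u = I ∧ v = J
      · rw [if_pos h.1, if_pos h.2, h.1, h.2, if_pos rfl]
      · rw [if_neg fun h' => h (mapDomain_inl_add_inr_inj h')]
        by_cases hu : u = I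
        · rw [if_neg fun hv => h ⟨hu, hv⟩, mul_zero]
        · rw [if_neg hu, zero_mul]

omit [DecidableEq α] in
theorem quad_fromBlocks (B : Matrix α α ℝ) :
    quad (Matrix.fromBlocks B 0 0 B) =
      MvPolynomial.rename Sum.inl (quad B) + MvPolynomial.rename Sum.inr (quad B) := by
  simp [quad, Fintype.sum_prod_type, Fintype.sum_sum_type, MvPolynomial.rename_monomial,
    Finsupp.mapDomain_add, Finsupp.mapDomain_single]

omit [Fintype α] [DecidableEq α] in
theorem content_sumMap {ι κ : Type*} [Fintype ι] [Fintype κ] (w₁ : ι → α) (w₂ : κ → α) :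
    content (Sum.map w₁ w₂) = (content w₁).mapDomain (Sum.inl : α → α ⊕ α) +
      (content w₂).mapDomain (Sum.inr : α → α ⊕ α) := by
  simp [content, Fintype.sum_sum_type, Finsupp.mapDomain_finsetSum, Finsupp.mapDomain_single]

/-- The quadratic form is `q(x) + q(y)`. In the binomial expansion of its power only `q(x)^{k₁}
q(y)^{k₂}` has the right degrees, and its binomial coefficient matches the factorials. -/
theorem pairHaf_fromBlocks (B : Matrix α α ℝ) {k₁ k₂ : ℕ} (w₁ : Fin k₁ × Fin 2 → α)
    (w₂ : Fin k₂ × Fin 2 → α) (e : Fin (k₁ + k₂) × Fin 2 ≃ (Fin k₁ × Fin 2) ⊕ (Fin k₂ × Fin 2)) :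
    pairHaf (Matrix.fromBlocks B 0 0 B) (Sum.map w₁ w₂ ∘ e) = pairHaf B w₁ * pairHaf B w₂ := by
  have hs : ∀ {k : ℕ} (w : Fin k × Fin 2 → α), ∑ a, content w a = k * 2 := fun w => by
    rw [sum_content]; simp
  rw [pairHaf_eq, pairHaf_eq, pairHaf_eq, content_comp_equiv, content_sumMap, quad_fromBlocks,
    add_pow, MvPolynomial.coeff_sum, Finset.sum_eq_single_of_mem k₁ (by simp)]
  · rw [← map_pow, ← map_pow, ← map_natCast MvPolynomial.C, mul_comm _ (MvPolynomial.C _),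
      MvPolynomial.coeff_C_mul,
      coeff_rename_mul_rename, Nat.add_sub_cancel_left]
    have h1 : factProd ((content w₁).mapDomain (Sum.inl : α → α ⊕ α) +
        (content w₂).mapDomain (Sum.inr : α → α ⊕ α)) =
        factProd (content w₁) * factProd (content w₂) := by
      simp [factProd, Fintype.prod_sum_type, Finsupp.mapDomain_apply Sum.inl_injective,
        Finsupp.mapDomain_apply Sum.inr_injective, Finsupp.mapDomain_of_notMem_range]
    have h2 : (((k₁ + k₂).choose k₁ : ℕ) : ℝ) * ((k₁.factorial : ℝ) * k₂.factorial) =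
        (k₁ + k₂).factorial := by
      exact_mod_cast (by rw [← mul_assoc, Nat.choose_symm_add]; exact Nat.add_choose_mul_factorial_mul_factorial k₁ k₂)
    rw [h1, ← h2]
    have := Nat.factorial_pos k₁
    have := Nat.factorial_pos k₂
    have h3 : (((k₁ + k₂).choose k₁ : ℕ) : ℝ) ≠ 0 := by
      exact_mod_cast (Nat.choose_pos (Nat.le_add_right _ _)).ne'
    field_simp
    ring
  · intro m _ hm
    rw [← map_pow, ← map_pow, ← map_natCast MvPolynomial.C, mul_comm _ (MvPolynomial.C _),
      MvPolynomial.coeff_C_mul,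
      coeff_rename_mul_rename, coeff_quad_pow_eq_zero B m, zero_mul, mul_zero]
    rw [hs]
    omega

end Blocks

/-! ### Comparison of hafnians -/

section Compare

variable {α : Type*}

/-- The number `(2k)! / (k! 2^k)` of perfect matchings of `2k` points. -/
def matchings (k : ℕ) : ℝ := ((2 * k).factorial : ℝ) / ((k.factorial : ℝ) * 2 ^ k)

theorem matchings_pos (k : ℕ) : 0 < matchings k := by unfold matchings; positivity

theorem pairHaf_const (b : ℝ) {k : ℕ} (w : Fin k × Fin 2 → α) :
    pairHaf (Matrix.of fun _ _ => b) w = b ^ k * matchings k := by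
  simp only [pairHaf, pairWeight, matchings, Finset.prod_const, Finset.sum_const, Finset.card_univ,
    Matrix.of_apply, Fintype.card_fin, Fintype.card_perm, Fintype.card_prod, nsmul_eq_mul]
  rw [mul_comm k 2]
  ring

theorem pairHaf_mono {A A' : Matrix α α ℝ} (h0 : ∀ x y, 0 ≤ A x y) (h : ∀ x y, A x y ≤ A' x y)
    {k : ℕ} (w : Fin k × Fin 2 → α) : pairHaf A w ≤ pairHaf A' w :=
  mul_le_mul_of_nonneg_left (Finset.sum_le_sum fun _ _ =>
    Finset.prod_le_prod (fun _ _ => h0 _ _) fun _ _ => h _ _) (by positivity)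

/-- If every pair stays inside a block, both differences vanish. If some pair is mixed, the block
weights vanish and what remains is monotone in the entries. -/
theorem pairWeight_sub_le {B : Matrix α α ℝ} {b : ℝ} (hb : 0 ≤ b) (h : ∀ x y, b ≤ B x y) {k : ℕ}
    (u : Fin k × Fin 2 → α ⊕ α) :
    pairWeight (Matrix.of fun _ _ => b) u -
        pairWeight (Matrix.fromBlocks (Matrix.of fun _ _ => b) 0 0 (Matrix.of fun _ _ => b)) u ≤
      pairWeight (B.submatrix (Sum.elim id id) (Sum.elim id id)) u -
        pairWeight (Matrix.fromBlocks B 0 0 B) u := by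
  by_cases hu : ∀ j, (u (j, 0)).isLeft = (u (j, 1)).isLeft
  · have h1 : ∀ C : Matrix α α ℝ, pairWeight (Matrix.fromBlocks C 0 0 C) u =
        pairWeight (C.submatrix (Sum.elim id id) (Sum.elim id id)) u := fun C => by
      refine Finset.prod_congr rfl fun j _ => ?_
      have := hu j
      rcases h0 : u (j, 0) with x | x <;> rcases h1 : u (j, 1) with y | y <;> simp_all
    have h2 : pairWeight (Matrix.of fun _ _ => b) u =
      pairWeight ((Matrix.of fun _ _ => b : Matrix α α ℝ).submatrix (Sum.elim id id) (Sum.elim id id)) u := rfl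
    rw [h1 B, h1 (Matrix.of fun _ _ => b), h2, sub_self, sub_self]
  · push Not at hu
    obtain ⟨j, hj⟩ := hu
    have h1 : ∀ C : Matrix α α ℝ, pairWeight (Matrix.fromBlocks C 0 0 C) u = 0 := fun C => by
      refine Finset.prod_eq_zero (Finset.mem_univ j) ?_
      rcases h0 : u (j, 0) with x | x <;> rcases h1 : u (j, 1) with y | y <;> simp_all
    rw [h1, h1, sub_zero, sub_zero]
    exact Finset.prod_le_prod (fun _ _ => hb) fun _ _ => h _ _

theorem pairHaf_sub_le {B : Matrix α α ℝ} {b : ℝ} (hb : 0 ≤ b) (h : ∀ x y, b ≤ B x y) {k : ℕ}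
    (w : Fin k × Fin 2 → α ⊕ α) :
    pairHaf (Matrix.of fun _ _ => b) w - pairHaf (Matrix.fromBlocks (Matrix.of fun _ _ => b) 0 0 (Matrix.of fun _ _ => b)) w ≤
      pairHaf (B.submatrix (Sum.elim id id) (Sum.elim id id)) w -
        pairHaf (Matrix.fromBlocks B 0 0 B) w := by
  unfold pairHaf
  rw [← mul_sub, ← mul_sub, ← Finset.sum_sub_distrib, ← Finset.sum_sub_distrib]
  exact mul_le_mul_of_nonneg_left (Finset.sum_le_sum fun _ _ => pairWeight_sub_le hb h _)
    (by positivity)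

end Compare

/-! ### The hafnians `Haf(B_I)` -/

section Haf

variable {N : ℕ}

/-- Any word with content `I` computes `Haf(B_I)`. This is the passage from repeated matrices to
words, and later arguments choose the word freely. -/
theorem haf_eq_pairHaf (B : Matrix (Fin N) (Fin N) ℝ) {I : Fin N → ℕ} {k : ℕ}
    (w : Fin k × Fin 2 → Fin N) (hw : ∀ a, content w a = I a) : haf B I = pairHaf B w := by
  have hI : ∑ i, I i = k * 2 := by
    simp only [← hw, sum_content]; simp
  have e : Fin k × Fin 2 ≃ Fin (∑ i, I i) := Fintype.equivOfCardEq (by simp [hI])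
  rw [haf, repMatrix, hafnian_submatrix B _ e]
  refine pairHaf_congr B ?_
  rw [content_comp_equiv]
  ext a
  rw [hw, content_apply, Fintype.card_congr
    ((finSigmaFinEquiv.symm.subtypeEquiv fun _ => Iff.rfl).trans
      (Equiv.sigmaSubtype (β := fun i => Fin (I i)) a)), Fintype.card_fin]

theorem exists_word' {I : Fin N → ℕ} {k : ℕ} (hI : ∑ i, I i = 2 * k) :
    ∃ w : Fin k × Fin 2 → Fin N, ∀ a, content w a = I a := by
  obtain ⟨w, hw⟩ := exists_word (ι := Fin k × Fin 2) (Finsupp.equivFunOnFinite.symm I)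
    (by simp [hI, mul_comm])
  exact ⟨w, fun a => by rw [hw]; rfl⟩

theorem haf_nonneg {B : Matrix (Fin N) (Fin N) ℝ} (h : ∀ i j, 0 ≤ B i j) {I : Fin N → ℕ} {k : ℕ}
    (hI : ∑ i, I i = 2 * k) : 0 ≤ haf B I := by
  obtain ⟨w, hw⟩ := exists_word' hI
  rw [haf_eq_pairHaf B w hw]
  exact mul_nonneg (by positivity) (Finset.sum_nonneg fun _ _ => Finset.prod_nonneg fun _ _ => h _ _)

theorem haf_zero (B : Matrix (Fin N) (Fin N) ℝ) {I : Fin N → ℕ} (hI : ∑ i, I i = 0) :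
    haf B I = 1 := by
  obtain ⟨w, hw⟩ := exists_word' (k := 0) hI
  rw [haf_eq_pairHaf B w hw]
  simp [pairHaf, pairWeight]

theorem haf_le {B : Matrix (Fin N) (Fin N) ℝ} {b : ℝ} (h : ∀ i j, 0 ≤ B i j)
    (hb : ∀ i j, B i j ≤ b) {I : Fin N → ℕ} {k : ℕ} (hI : ∑ i, I i = 2 * k) :
    haf B I ≤ b ^ k * matchings k := by
  obtain ⟨w, hw⟩ := exists_word' hI
  rw [haf_eq_pairHaf B w hw, ← pairHaf_const b w]
  exact pairHaf_mono h hb w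

theorem le_haf {B : Matrix (Fin N) (Fin N) ℝ} {b : ℝ} (h : 0 ≤ b)
    (hb : ∀ i j, b ≤ B i j) {I : Fin N → ℕ} {k : ℕ} (hI : ∑ i, I i = 2 * k) :
    b ^ k * matchings k ≤ haf B I := by
  obtain ⟨w, hw⟩ := exists_word' hI
  rw [haf_eq_pairHaf B w hw, ← pairHaf_const b w]
  exact pairHaf_mono (fun _ _ => h) hb w

/-- Matchings inside the blocks contribute `Haf(B_I) Haf(B_J)`, so the right side collects the mixed
matchings. It is compared with the constant matrix `b`. -/
theorem le_haf_add_sub {B : Matrix (Fin N) (Fin N) ℝ} {b : ℝ} (hb : 0 ≤ b) (h : ∀ i j, b ≤ B i j)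
    {I J : Fin N → ℕ} {k₁ k₂ : ℕ} (hI : ∑ i, I i = 2 * k₁) (hJ : ∑ i, J i = 2 * k₂) :
    b ^ (k₁ + k₂) * (matchings (k₁ + k₂) - matchings k₁ * matchings k₂) ≤
      haf B (I + J) - haf B I * haf B J := by
  obtain ⟨w₁, h₁⟩ := exists_word' hI
  obtain ⟨w₂, h₂⟩ := exists_word' hJ
  have e : Fin (k₁ + k₂) × Fin 2 ≃ (Fin k₁ × Fin 2) ⊕ (Fin k₂ × Fin 2) :=
    Fintype.equivOfCardEq (by simp; ring)
  have h3 : haf B (I + J) =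
      pairHaf (B.submatrix (Sum.elim id id) (Sum.elim id id)) (Sum.map w₁ w₂ ∘ e) := by
    rw [haf_eq_pairHaf B (Sum.elim w₁ w₂ ∘ e)]
    · unfold pairHaf pairWeight
      congr 1
      refine Finset.sum_congr rfl fun σ _ => Finset.prod_congr rfl fun j _ => ?_
      have h4 : ∀ x, Sum.elim id id (Sum.map w₁ w₂ x) = Sum.elim w₁ w₂ x := by
        rintro (x | x) <;> rfl
      simp [h4]
    · intro a
      rw [content_comp_equiv, Pi.add_apply, ← h₁, ← h₂]
      simp [content, Fintype.sum_sum_type]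
  have h5 := pairHaf_sub_le hb h (Sum.map w₁ w₂ ∘ e)
  rw [← h3, pairHaf_fromBlocks B, pairHaf_fromBlocks (Matrix.of fun _ _ => b), pairHaf_const, pairHaf_const,
    pairHaf_const] at h5
  rw [haf_eq_pairHaf B w₁ h₁, haf_eq_pairHaf B w₂ h₂]
  refine le_trans (le_of_eq ?_) h5
  ring

/-- Matchings of two disjoint sets combine to a matching of the union. This is the block comparison
for the one-by-one matrix `1` with `b = 0`. -/
theorem matchings_mul_le (k₁ k₂ : ℕ) : matchings k₁ * matchings k₂ ≤ matchings (k₁ + k₂) := by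
  have h := le_haf_add_sub (B := Matrix.of fun _ _ : Fin 1 => 1) (b := 0) le_rfl (fun _ _ => zero_le_one)
    (I := fun _ => 2 * k₁) (J := fun _ => 2 * k₂) (k₁ := k₁) (k₂ := k₂)
    (by simp) (by simp)
  have h' : ∀ (I : Fin 1 → ℕ) (k : ℕ), ∑ i, I i = 2 * k →
      haf (Matrix.of fun _ _ : Fin 1 => (1 : ℝ)) I = matchings k := fun I k hI => by
    obtain ⟨w, hw⟩ := exists_word' hI
    rw [haf_eq_pairHaf _ w hw, pairHaf_const, one_pow, one_mul]
  rw [h' _ (k₁ + k₂) (by simp; ring), h' _ k₁ (by simp), h' _ k₂ (by simp)] at h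
  rcases Nat.eq_zero_or_pos (k₁ + k₂) with h0 | h0
  · obtain ⟨rfl, rfl⟩ : k₁ = 0 ∧ k₂ = 0 := by omega
    simp [matchings]
  · rw [zero_pow h0.ne', zero_mul] at h
    linarith

/-- With `x² - y² = (x - y)((x - y) + 2y)`, both factors are non-negative and bounded below by their
values for the constant matrix. -/
theorem le_haf_add_sq_sub {B : Matrix (Fin N) (Fin N) ℝ} {b : ℝ} (hb : 0 ≤ b)
    (h : ∀ i j, b ≤ B i j) {I J : Fin N → ℕ} {k₁ k₂ : ℕ} (hI : ∑ i, I i = 2 * k₁)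
    (hJ : ∑ i, J i = 2 * k₂) :
    b ^ (2 * (k₁ + k₂)) * (matchings (k₁ + k₂) ^ 2 - (matchings k₁ * matchings k₂) ^ 2) ≤
      haf B (I + J) ^ 2 - (haf B I * haf B J) ^ 2 := by
  have h1 := le_haf_add_sub hb h hI hJ
  have h2 := le_haf hb h hI
  have h3 := le_haf hb h hJ
  have h4 : b ^ (k₁ + k₂) * (matchings k₁ * matchings k₂) ≤ haf B I * haf B J := by
    calc _ = (b ^ k₁ * matchings k₁) * (b ^ k₂ * matchings k₂) := by ring
      _ ≤ _ := mul_le_mul h2 h3 (mul_nonneg (by positivity) (matchings_pos _).le)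
        ((mul_nonneg (by positivity) (matchings_pos _).le).trans h2)
  have h5 : 0 ≤ b ^ (k₁ + k₂) * (matchings (k₁ + k₂) - matchings k₁ * matchings k₂) :=
    mul_nonneg (by positivity) (sub_nonneg.2 (matchings_mul_le _ _))
  have h6 : 0 ≤ b ^ (k₁ + k₂) * (matchings k₁ * matchings k₂) :=
    mul_nonneg (by positivity) (mul_pos (matchings_pos _) (matchings_pos _)).le
  calc _ = (b ^ (k₁ + k₂) * (matchings (k₁ + k₂) - matchings k₁ * matchings k₂)) *
        (b ^ (k₁ + k₂) * (matchings (k₁ + k₂) - matchings k₁ * matchings k₂) +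
          2 * (b ^ (k₁ + k₂) * (matchings k₁ * matchings k₂))) := by ring
    _ ≤ (haf B (I + J) - haf B I * haf B J) *
        ((haf B (I + J) - haf B I * haf B J) + 2 * (haf B I * haf B J)) := by
      refine mul_le_mul h1 ?_ (by linarith) (by linarith)
      linarith
    _ = _ := by ring

end Haf

/-! ### Central binomial coefficients -/

/-- Let `S_n` be the sum and `T_n` the same sum weighted by the first index. Symmetry gives `n S_n =
2 T_n`, and the recursion of central binomials gives `T_{n+1} = 4 T_n + 2 S_n`. Hence `S_{n+1} = 4
S_n`. -/
theorem sum_antidiagonal_centralBinom (n : ℕ) :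
    ∑ p ∈ Finset.HasAntidiagonal.antidiagonal n, (p.1.centralBinom : ℝ) * p.2.centralBinom = 4 ^ n := by
  induction n with
  | zero => simp
  | succ n ih =>
    have hswap : ∀ m : ℕ, ∑ p ∈ Finset.HasAntidiagonal.antidiagonal m,
        (p.2 : ℝ) * ((p.1.centralBinom : ℝ) * p.2.centralBinom) =
        ∑ p ∈ Finset.HasAntidiagonal.antidiagonal m, (p.1 : ℝ) * ((p.1.centralBinom : ℝ) * p.2.centralBinom) :=
      fun m => by
        rw [← Finset.Nat.sum_antidiagonal_swap]
        exact Finset.sum_congr rfl fun p _ => by simp only [Prod.fst_swap, Prod.snd_swap]; ring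
    have hdeg : ∀ m : ℕ, (m : ℝ) * ∑ p ∈ Finset.HasAntidiagonal.antidiagonal m,
        ((p.1.centralBinom : ℝ) * p.2.centralBinom) = 2 * ∑ p ∈ Finset.HasAntidiagonal.antidiagonal m,
          (p.1 : ℝ) * ((p.1.centralBinom : ℝ) * p.2.centralBinom) := fun m => by
      rw [two_mul]
      nth_rewrite 2 [← hswap m]
      rw [← Finset.sum_add_distrib, Finset.mul_sum]
      refine Finset.sum_congr rfl fun p hp => ?_
      rw [← Finset.HasAntidiagonal.mem_antidiagonal.1 hp]
      push_cast
      ring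
    have h1 := hdeg (n + 1)
    rw [Finset.Nat.sum_antidiagonal_succ (f := fun p : ℕ × ℕ =>
      (p.1 : ℝ) * ((p.1.centralBinom : ℝ) * p.2.centralBinom))] at h1
    have h2 : ∀ p : ℕ × ℕ, ((p.1 + 1 : ℕ) : ℝ) * (((p.1 + 1).centralBinom : ℝ) * p.2.centralBinom)
        = 4 * ((p.1 : ℝ) * ((p.1.centralBinom : ℝ) * p.2.centralBinom)) +
          2 * ((p.1.centralBinom : ℝ) * p.2.centralBinom) := fun p => by
      have : ((p.1 + 1 : ℕ) : ℝ) * ((p.1 + 1).centralBinom : ℝ) =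
          2 * (2 * p.1 + 1) * p.1.centralBinom := by
        exact_mod_cast Nat.succ_mul_centralBinom_succ p.1
      rw [← mul_assoc, this]
      ring
    simp only [h2] at h1
    rw [Finset.sum_add_distrib, ← Finset.mul_sum, ← Finset.mul_sum, ih] at h1
    have h3 := hdeg n
    rw [ih] at h3
    have hn : ((n + 1 : ℕ) : ℝ) ≠ 0 := by positivity
    apply mul_left_cancel₀ hn
    rw [h1]
    push_cast
    rw [pow_succ]
    linear_combination -4 * h3

theorem summable_centralBinom {x : ℝ} (h0 : 0 ≤ x) (h1 : x < 1) :
    Summable fun m : ℕ => (m.centralBinom : ℝ) * (x / 4) ^ m := by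
  refine (summable_geometric_of_lt_one h0 h1).of_nonneg_of_le (fun m => by positivity) fun m => ?_
  have : (m.centralBinom : ℝ) ≤ 4 ^ m := by exact_mod_cast m.centralBinom_le_four_pow
  calc _ ≤ 4 ^ m * (x / 4) ^ m := by gcongr
    _ = x ^ m := by rw [← mul_pow]; congr 1; ring

/-- By the convolution identity the square of the series is the geometric series in `x`, and the
series itself is non-negative. -/
theorem tsum_centralBinom {x : ℝ} (h0 : 0 ≤ x) (h1 : x < 1) :
    ∑' m : ℕ, (m.centralBinom : ℝ) * (x / 4) ^ m = 1 / √(1 - x) := by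
  have hs := summable_centralBinom h0 h1
  have h2 := tsum_mul_tsum_eq_tsum_sum_antidiagonal_of_summable_norm hs.norm hs.norm
  have h3 : ∀ n : ℕ, ∑ p ∈ Finset.HasAntidiagonal.antidiagonal n, ((p.1.centralBinom : ℝ) * (x / 4) ^ p.1) *
      ((p.2.centralBinom : ℝ) * (x / 4) ^ p.2) = x ^ n := fun n => by
    have : ∀ p ∈ Finset.HasAntidiagonal.antidiagonal n, ((p.1.centralBinom : ℝ) * (x / 4) ^ p.1) *
      ((p.2.centralBinom : ℝ) * (x / 4) ^ p.2) =
        ((p.1.centralBinom : ℝ) * p.2.centralBinom) * (x / 4) ^ n := fun p hp => by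
      rw [← Finset.HasAntidiagonal.mem_antidiagonal.1 hp, pow_add]; ring
    rw [Finset.sum_congr rfl this, ← Finset.sum_mul, sum_antidiagonal_centralBinom, ← mul_pow]
    congr 1; ring
  simp only [h3] at h2
  rw [tsum_geometric_of_lt_one h0 h1] at h2
  have h4 : 0 ≤ ∑' m : ℕ, (m.centralBinom : ℝ) * (x / 4) ^ m := tsum_nonneg fun m => by positivity
  rw [← Real.sqrt_mul_self h4, h2, Real.sqrt_inv, one_div]

/-! ### The normalisation of the sampling distribution -/

section Orthogonal

variable {α : Type*} [Fintype α] [DecidableEq α]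

omit [DecidableEq α] in
theorem pairWeight_conj {A M O : Matrix α α ℝ}
    (h : ∀ a b, A a b = ∑ p : α × α, O a p.1 * O b p.2 * M p.1 p.2) {k : ℕ}
    (w : Fin k × Fin 2 → α) :
    pairWeight A w = ∑ v : Fin k × Fin 2 → α, (∏ i, O (w i) (v i)) * pairWeight M v := by
  classical
  unfold pairWeight
  simp only [h]
  rw [Finset.prod_univ_sum, Fintype.piFinset_univ]
  let e : (Fin k → α × α) ≃ (Fin k × Fin 2 → α) :=
    (Equiv.arrowCongr (Equiv.refl _) (finTwoArrowEquiv α).symm).trans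
      (Equiv.curry (Fin k) (Fin 2) α).symm
  rw [← e.sum_comp]
  refine Finset.sum_congr rfl fun v _ => ?_
  rw [Fintype.prod_prod_type, ← Finset.prod_mul_distrib]
  refine Finset.prod_congr rfl fun j _ => ?_
  simp [e, finTwoArrowEquiv]

-- By multilinearity the hafnians of all words of length `2k` form a tensor on which `O` acts by its
-- `2k`-th tensor power.
omit [DecidableEq α] in
theorem pairHaf_conj {A M O : Matrix α α ℝ}
    (h : ∀ a b, A a b = ∑ p : α × α, O a p.1 * O b p.2 * M p.1 p.2) {k : ℕ}
    (w : Fin k × Fin 2 → α) :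
    pairHaf A w = ∑ v : Fin k × Fin 2 → α, (∏ i, O (w i) (v i)) * pairHaf M v := by
  have h1 : ∀ σ : Equiv.Perm (Fin k × Fin 2), pairWeight A (w ∘ σ) =
      ∑ v : Fin k × Fin 2 → α, (∏ i, O (w i) (v i)) * pairWeight M (v ∘ σ) := fun σ => by
    rw [pairWeight_conj h, ← (σ.arrowCongr (Equiv.refl α)).symm.sum_comp]
    refine Finset.sum_congr rfl fun v _ => ?_
    congr 1
    exact Fintype.prod_equiv σ _ _ fun i => rfl
  unfold pairHaf
  simp only [h1]
  rw [Finset.sum_comm, Finset.mul_sum]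
  refine Finset.sum_congr rfl fun v _ => ?_
  rw [← Finset.mul_sum]
  ring

/-- The tensor power of an orthogonal matrix is orthogonal, so it preserves the sum of squares of
the components. -/
theorem sum_pairHaf_sq_conj {A M O : Matrix α α ℝ}
    (h : ∀ a b, A a b = ∑ p : α × α, O a p.1 * O b p.2 * M p.1 p.2)
    (hO : ∀ c c', ∑ a, O a c * O a c' = if c = c' then 1 else 0) (k : ℕ) :
    ∑ w : Fin k × Fin 2 → α, pairHaf A w ^ 2 = ∑ w : Fin k × Fin 2 → α, pairHaf M w ^ 2 := by
  have h1 : ∀ v v' : Fin k × Fin 2 → α,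
      ∑ w : Fin k × Fin 2 → α, (∏ i, O (w i) (v i)) * ∏ i, O (w i) (v' i) =
        if v = v' then 1 else 0 := fun v v' => by
    have := Finset.prod_univ_sum (fun _ : Fin k × Fin 2 => (Finset.univ : Finset α))
      fun i a => O a (v i) * O a (v' i)
    rw [Fintype.piFinset_univ] at this
    simp only [← Finset.prod_mul_distrib]
    rw [← this]
    simp only [hO]
    rw [Finset.prod_ite_zero]
    simp [funext_iff]
  calc _ = ∑ w : Fin k × Fin 2 → α, ∑ v : Fin k × Fin 2 → α, ∑ v' : Fin k × Fin 2 → α,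
        pairHaf M v * pairHaf M v' * ((∏ i, O (w i) (v i)) * ∏ i, O (w i) (v' i)) := by
        refine Finset.sum_congr rfl fun w _ => ?_
        rw [pairHaf_conj h, sq, Finset.sum_mul_sum]
        refine Finset.sum_congr rfl fun v _ => Finset.sum_congr rfl fun v' _ => ?_
        ring
    _ = ∑ v : Fin k × Fin 2 → α, ∑ v' : Fin k × Fin 2 → α, pairHaf M v * pairHaf M v' *
        ∑ w : Fin k × Fin 2 → α, (∏ i, O (w i) (v i)) * ∏ i, O (w i) (v' i) := by
        rw [Finset.sum_comm]
        refine Finset.sum_congr rfl fun v _ => ?_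
        rw [Finset.sum_comm]
        refine Finset.sum_congr rfl fun v' _ => ?_
        rw [Finset.mul_sum]
    _ = _ := by
        simp only [h1, mul_ite, mul_one, mul_zero, Finset.sum_ite_eq, Finset.mem_univ, if_true, sq]

end Orthogonal

/-! ### The weight sum and its reduction to diagonal matrices. -/

section Normalization

variable {N : ℕ}

/-- Exactly `(2k)!/I!` words have content `I`, so the weighted sum over multi-indices is a plain sum
over words, to which orthogonal invariance applies. -/
theorem sum_haf_sq_div (B : Matrix (Fin N) (Fin N) ℝ) (k : ℕ) :
    ∑ I ∈ Finset.piAntidiag (Finset.univ : Finset (Fin N)) (2 * k),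
      haf B I ^ 2 / multiFactorial I =
      (∑ w : Fin k × Fin 2 → Fin N, pairHaf B w ^ 2) / ((2 * k).factorial : ℝ) := by
  rw [← Finset.sum_fiberwise_of_maps_to (s := Finset.univ)
    (t := Finset.piAntidiag (Finset.univ : Finset (Fin N)) (2 * k))
    (g := fun w : Fin k × Fin 2 → Fin N => ⇑(content w)), Finset.sum_div]
  · refine Finset.sum_congr rfl fun I hI => ?_
    obtain ⟨w, hw⟩ := exists_word' ((mem_MIdx_iff N k I).1 hI)
    have hwI : ⇑(content w) = I := funext hw
    have h1 : ∀ u ∈ Finset.univ.filter fun u : Fin k × Fin 2 → Fin N => ⇑(content u) = I,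
        pairHaf B u ^ 2 = haf B I ^ 2 := fun u hu => by
      rw [haf_eq_pairHaf B u fun a => congrFun (Finset.mem_filter.1 hu).2 a]
    have h2 : (Finset.univ.filter fun u : Fin k × Fin 2 → Fin N => ⇑(content u) = I) =
        Finset.univ.filter fun u => content u = content w := by
      ext u
      simp [← hwI]
    rw [Finset.sum_congr rfl h1, Finset.sum_const, nsmul_eq_mul, h2]
    have h3 := card_words w
    have h4 : multiFactorial I = factProd (content w) := by rw [← hwI]; rfl
    have h5 := factProd_pos (content w)
    rw [Fintype.card_prod, Fintype.card_fin, Fintype.card_fin, mul_comm k 2] at h3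
    rw [h4, ← h3]
    have h6 : ((Finset.univ.filter fun u : Fin k × Fin 2 → Fin N =>
        content u = content w).card : ℝ) ≠ 0 := by
      have : 0 < (Finset.univ.filter fun u : Fin k × Fin 2 → Fin N => content u = content w).card :=
        Finset.card_pos.2 ⟨w, by simp⟩
      positivity
    field_simp
  · intro w _
    rw [mem_MIdx_iff, sum_content]
    simp [mul_comm]

theorem quad_diagonal (l : Fin N → ℝ) :
    quad (Matrix.diagonal l) = ∑ a, MvPolynomial.monomial (Finsupp.single a 2) (l a) := by
  rw [quad, Fintype.sum_prod_type]
  refine Finset.sum_congr rfl fun a _ => ?_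
  rw [Finset.sum_eq_single a]
  · simp [← Finsupp.single_add]
  · intro b _ hb
    simp [Matrix.diagonal_apply_ne' _ hb]
  · simp

theorem coeff_quad_diagonal_pow (l : Fin N → ℝ) (k : ℕ) (I : Fin N →₀ ℕ) :
    MvPolynomial.coeff I (quad (Matrix.diagonal l) ^ k) =
      ∑ J ∈ Finset.piAntidiag (Finset.univ : Finset (Fin N)) k,
        if (fun a => 2 * J a) = ⇑I then (Nat.multinomial Finset.univ J : ℝ) * ∏ a, l a ^ J a
        else 0 := by
  rw [quad_diagonal, Finset.sum_pow_eq_sum_piAntidiag, MvPolynomial.coeff_sum]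
  refine Finset.sum_congr rfl fun J _ => ?_
  simp only [MvPolynomial.monomial_pow]
  rw [prod_monomial, ← map_natCast MvPolynomial.C, MvPolynomial.coeff_C_mul,
    MvPolynomial.coeff_monomial, mul_ite, mul_zero]
  refine if_congr ?_ rfl rfl
  rw [← DFunLike.coe_fn_eq]
  have : ⇑(∑ a, J a • Finsupp.single a 2 : Fin N →₀ ℕ) = fun a => 2 * J a := by
    ext a
    simp [Finsupp.finsetSum_apply, Finsupp.single_apply, mul_comm]
  rw [this]

theorem haf_diagonal (l : Fin N → ℝ) {k : ℕ} {I : Fin N → ℕ} (hI : ∑ i, I i = 2 * k) :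
    haf (Matrix.diagonal l) I = multiFactorial I / ((k.factorial : ℝ) * 2 ^ k) *
      ∑ J ∈ Finset.piAntidiag (Finset.univ : Finset (Fin N)) k,
        if (fun a => 2 * J a) = I then (Nat.multinomial Finset.univ J : ℝ) * ∏ a, l a ^ J a
        else 0 := by
  obtain ⟨w, hw⟩ := exists_word' hI
  have hwI : ⇑(content w) = I := funext hw
  rw [haf_eq_pairHaf _ w hw, pairHaf_eq, coeff_quad_diagonal_pow]
  simp only [← hwI]
  rfl

theorem haf_diagonal_two_mul (l : Fin N → ℝ) {k : ℕ} {J : Fin N → ℕ} (hJ : ∑ i, J i = k) :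
    haf (Matrix.diagonal l) (fun a => 2 * J a) =
      ∏ a, ((2 * J a).factorial : ℝ) / ((J a).factorial * 2 ^ J a) * l a ^ J a := by
  have h2J : ∑ a, 2 * J a = 2 * k := by rw [← Finset.mul_sum, hJ]
  rw [haf_diagonal l h2J, Finset.sum_eq_single_of_mem J (by simp [Finset.mem_piAntidiag, hJ])]
  · rw [if_pos rfl]
    have h1 : (∏ a, ((J a).factorial : ℝ)) * (Nat.multinomial Finset.univ J : ℝ) = k.factorial := by
      have := Nat.multinomial_spec Finset.univ J
      rw [hJ] at this
      exact_mod_cast this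
    have h2 : ∏ a, (2 : ℝ) ^ J a = 2 ^ k := by rw [Finset.prod_pow_eq_pow_sum, hJ]
    have h3 : ∏ a, ((J a).factorial : ℝ) ≠ 0 :=
      Finset.prod_ne_zero_iff.2 fun a _ => by positivity
    have h4 : (Nat.multinomial Finset.univ J : ℝ) ≠ 0 := fun h => by
      rw [h, mul_zero] at h1
      exact (by positivity : (k.factorial : ℝ) ≠ 0) h1.symm
    rw [Finset.prod_mul_distrib, Finset.prod_div_distrib, Finset.prod_mul_distrib, h2, ← h1]
    unfold multiFactorial
    field_simp
  · intro J' _ hJ'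
    refine if_neg fun h => hJ' (funext fun a => ?_)
    have : 2 * J' a = 2 * J a := congrFun h a
    omega

/-- For a diagonal matrix only multi-indices with even entries contribute, and the weight factorises
with `((2j)!/(j! 2^j))²/(2j)! = C(2j,j)/4^j`. -/
theorem sum_haf_diagonal_sq_div (l : Fin N → ℝ) (k : ℕ) :
    ∑ I ∈ Finset.piAntidiag (Finset.univ : Finset (Fin N)) (2 * k),
      haf (Matrix.diagonal l) I ^ 2 / multiFactorial I =
    ∑ J ∈ Finset.piAntidiag (Finset.univ : Finset (Fin N)) k,
      ∏ a, ((J a).centralBinom : ℝ) * (l a ^ 2 / 4) ^ J a := by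
  have hinj : Function.Injective fun (J : Fin N → ℕ) (a : Fin N) => 2 * J a := fun J J' h =>
    funext fun a => by have := congrFun h a; simp only at this; omega
  symm
  calc _ = ∑ J ∈ Finset.piAntidiag (Finset.univ : Finset (Fin N)) k,
        haf (Matrix.diagonal l) (fun a => 2 * J a) ^ 2 / multiFactorial (fun a => 2 * J a) := by
        refine Finset.sum_congr rfl fun J hJ => ?_
        rw [haf_diagonal_two_mul l (k := k) (by simpa [Finset.mem_piAntidiag] using hJ),
          multiFactorial, ← Finset.prod_pow, ← Finset.prod_div_distrib]
        refine Finset.prod_congr rfl fun a _ => ?_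
        have h1 : ((J a).centralBinom : ℝ) * ((J a).factorial * (J a).factorial) =
            (2 * J a).factorial := by
          rw [Nat.centralBinom_eq_two_mul_choose, ← mul_assoc]
          have := Nat.choose_mul_factorial_mul_factorial (show J a ≤ 2 * J a by omega)
          rw [show 2 * J a - J a = J a by omega] at this
          exact_mod_cast this
        have h2 : ((J a).centralBinom : ℝ) ≠ 0 := by exact_mod_cast (J a).centralBinom_ne_zero
        rw [← h1, div_pow, ← pow_mul, show (4 : ℝ) = 2 ^ 2 by norm_num, ← pow_mul]
        field_simp
        ring
    _ = ∑ I ∈ (Finset.piAntidiag (Finset.univ : Finset (Fin N)) k).image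
          fun (J : Fin N → ℕ) (a : Fin N) => 2 * J a,
        haf (Matrix.diagonal l) I ^ 2 / multiFactorial I := by
        rw [Finset.sum_image hinj.injOn]
    _ = _ := by
        refine Finset.sum_subset ?_ ?_
        · intro I hI
          obtain ⟨J, hJ, rfl⟩ := Finset.mem_image.1 hI
          rw [mem_MIdx_iff, ← Finset.mul_sum]
          congr 1
          simpa [Finset.mem_piAntidiag] using hJ
        · intro I hI hI'
          rw [haf_diagonal l ((mem_MIdx_iff N k I).1 hI), Finset.sum_eq_zero]
          · simp
          · intro J hJ
            exact if_neg fun h => hI' (Finset.mem_image.2 ⟨J, hJ, h⟩)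

/-- Multi-indices of degree below `M` lie in the cube `{0, …, M-1}^N`. Only this inequality is
needed, which avoids infinite products of series. -/
theorem sum_sum_prod_le (c : Fin N → ℕ → ℝ) (hc : ∀ a m, 0 ≤ c a m) (M : ℕ) :
    ∑ k ∈ Finset.range M, ∑ J ∈ Finset.piAntidiag (Finset.univ : Finset (Fin N)) k,
      ∏ a, c a (J a) ≤ ∏ a, ∑ m ∈ Finset.range M, c a m := by
  rw [Finset.prod_univ_sum, ← Finset.sum_biUnion]
  · refine Finset.sum_le_sum_of_subset_of_nonneg ?_ fun J _ _ => Finset.prod_nonneg fun a _ => hc _ _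
    intro J hJ
    obtain ⟨k, hk, hJ⟩ := Finset.mem_biUnion.1 hJ
    have hJ' : ∑ a, J a = k := by simpa [Finset.mem_piAntidiag] using hJ
    refine Fintype.mem_piFinset.2 fun a => Finset.mem_range.2 ?_
    have : J a ≤ ∑ a, J a := Finset.single_le_sum (fun _ _ => Nat.zero_le _) (Finset.mem_univ a)
    have := Finset.mem_range.1 hk
    omega
  · intro k _ k' _ hkk
    refine Finset.disjoint_left.2 fun J hJ hJ' => hkk ?_
    have h1 : ∑ a, J a = k := by simpa [Finset.mem_piAntidiag] using hJ
    have h2 : ∑ a, J a = k' := by simpa [Finset.mem_piAntidiag] using hJ'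
    exact h1.symm.trans h2

theorem isHermitian_of_mem {B : Matrix (Fin N) (Fin N) ℝ} (hB : B ∈ matrixSpace N) :
    B.IsHermitian := by
  rw [Matrix.IsHermitian, Matrix.conjTranspose_eq_transpose_of_trivial]
  exact hB.2.1

theorem eigenvalues_mem_Ioo {B : Matrix (Fin N) (Fin N) ℝ} (hB : B ∈ matrixSpace N) (j : Fin N) :
    0 < (isHermitian_of_mem hB).eigenvalues j ∧ (isHermitian_of_mem hB).eigenvalues j < 1 :=
  hB.2.2 _ ((isHermitian_of_mem hB).eigenvalues_mem_spectrum_real j)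

theorem exists_orthogonal {B : Matrix (Fin N) (Fin N) ℝ} (hB : B.IsHermitian) :
    ∃ O : Matrix (Fin N) (Fin N) ℝ,
      (∀ a b, B a b = ∑ p : Fin N × Fin N,
        O a p.1 * O b p.2 * Matrix.diagonal hB.eigenvalues p.1 p.2) ∧
      ∀ c c', ∑ a, O a c * O a c' = if c = c' then 1 else 0 := by
  refine ⟨hB.eigenvectorUnitary, fun a b => ?_, fun c c' => ?_⟩
  · conv_lhs => rw [hB.spectral_theorem, Unitary.conjStarAlgAut_apply]
    rw [Matrix.mul_apply, Fintype.sum_prod_type, Finset.sum_comm]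
    refine Finset.sum_congr rfl fun c _ => ?_
    rw [Matrix.mul_apply, Finset.sum_mul]
    refine Finset.sum_congr rfl fun d _ => ?_
    simp [Matrix.star_apply, Matrix.diagonal_apply]
    split_ifs <;> ring
  · have h := congrFun (congrFun (Unitary.coe_star_mul_self hB.eigenvectorUnitary) c) c'
    rw [Matrix.mul_apply, Matrix.one_apply] at h
    simpa [Matrix.star_apply] using h

/-- The hafnian weights are sub-normalised (in fact they sum up to one). -/
theorem sum_haf_sq_div_le {B : Matrix (Fin N) (Fin N) ℝ} (hB : B ∈ matrixSpace N) (M : ℕ) :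
    ∑ k ∈ Finset.range M, ∑ I ∈ Finset.piAntidiag (Finset.univ : Finset (Fin N)) (2 * k),
      haf B I ^ 2 / multiFactorial I ≤ 1 / normConst B := by
  have hH := isHermitian_of_mem hB
  obtain ⟨O, h1, h2⟩ := exists_orthogonal hH
  have h3 : ∀ k : ℕ, ∑ I ∈ Finset.piAntidiag (Finset.univ : Finset (Fin N)) (2 * k),
      haf B I ^ 2 / multiFactorial I = ∑ J ∈ Finset.piAntidiag (Finset.univ : Finset (Fin N)) k,
      ∏ a, ((J a).centralBinom : ℝ) * (hH.eigenvalues a ^ 2 / 4) ^ J a := fun k => by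
    rw [← sum_haf_diagonal_sq_div, sum_haf_sq_div, sum_haf_sq_div, sum_pairHaf_sq_conj h1 h2]
  have hev : ∀ a, 0 ≤ hH.eigenvalues a ^ 2 ∧ hH.eigenvalues a ^ 2 < 1 := fun a => by
    have := eigenvalues_mem_Ioo hB a
    exact ⟨sq_nonneg _, by nlinarith⟩
  simp only [h3]
  refine (sum_sum_prod_le (fun a m => (m.centralBinom : ℝ) * (hH.eigenvalues a ^ 2 / 4) ^ m)
    (fun a m => by positivity) M).trans ?_
  rw [normConst, dif_pos hH, one_div, ← Finset.prod_inv_distrib]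
  refine Finset.prod_le_prod (fun a _ => Finset.sum_nonneg fun m _ => by positivity) fun a _ => ?_
  rw [← one_div, ← tsum_centralBinom (hev a).1 (hev a).2]
  exact (summable_centralBinom (hev a).1 (hev a).2).sum_le_tsum _ fun m _ => by positivity

end Normalization

/-! ### Stirling bounds -/

/-- The logarithm of the Stirling sequence drops by at most `1/12` from its first term to its limit
`log √π`. -/
theorem stirlingSeq_one_le : Stirling.stirlingSeq 1 ≤ √Real.pi * Real.exp (1 / 12) := by
  have h1 : Tendsto (fun n => Real.log (Stirling.stirlingSeq (n + 1))) atTop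
      (𝓝 (Real.log √Real.pi)) :=
    ((Stirling.tendsto_stirlingSeq_sqrt_pi.comp (tendsto_add_atTop_nat 1)).log
      (by positivity))
  have h2 : Real.log (Stirling.stirlingSeq 1) - 12⁻¹ ≤ Real.log √Real.pi :=
    ge_of_tendsto' h1 fun n => by linarith [Stirling.log_stirlingSeq_bounded_aux n]
  have h3 : 0 < Stirling.stirlingSeq 1 := Stirling.stirlingSeq'_pos 0
  rw [← Real.exp_log h3, ← Real.exp_log (show 0 < √Real.pi by positivity), ← Real.exp_add]
  exact Real.exp_le_exp.2 (by linarith)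

theorem factorial_le_stirling {s : ℕ} (hs : 1 ≤ s) :
    (s.factorial : ℝ) ≤ √(2 * Real.pi * s) * (s / Real.exp 1) ^ s * Real.exp (1 / 12) := by
  have h1 : Stirling.stirlingSeq s ≤ √Real.pi * Real.exp (1 / 12) := by
    obtain ⟨t, rfl⟩ : ∃ t, s = t + 1 := ⟨s - 1, by omega⟩
    exact (Stirling.stirlingSeq'_antitone (Nat.zero_le t)).trans stirlingSeq_one_le
  have hs' : (0 : ℝ) < s := by exact_mod_cast hs
  rw [Stirling.stirlingSeq, div_le_iff₀ (by positivity)] at h1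
  refine h1.trans (le_of_eq ?_)
  rw [show 2 * Real.pi * s = Real.pi * (2 * s) by ring, Real.sqrt_mul Real.pi_pos.le]
  ring

/-- Stirling's upper bound for `s!` meets the lower bound for `(Ns)!`. The powers of `e` cancel, and
the base `Ns` in place of `s` leaves the factor `N^{Ns}`. -/
theorem factorial_pow_le {N s : ℕ} (hN : 1 ≤ N) (hs : 1 ≤ s) :
    (s.factorial : ℝ) ^ N ≤ (2 * Real.pi) ^ (((N : ℝ) - 1) / 2) * (N : ℝ) ^ (-(1 / 2) : ℝ) *
      Real.exp ((N : ℝ) / 12) * (s : ℝ) ^ (((N : ℝ) - 1) / 2) / (N : ℝ) ^ (N * s) *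
      ((N * s).factorial : ℝ) := by
  have hs' : (0 : ℝ) < s := by exact_mod_cast hs
  have hN' : (0 : ℝ) < N := by exact_mod_cast hN
  have h2 := Stirling.le_factorial_stirling (N * s)
  have h3 : √(2 * Real.pi * s) ^ N = √(2 * Real.pi * s) * (2 * Real.pi) ^ (((N : ℝ) - 1) / 2) *
      (s : ℝ) ^ (((N : ℝ) - 1) / 2) := by
    rw [mul_assoc (√_), ← Real.mul_rpow (by positivity) hs'.le, Real.sqrt_eq_rpow, ← Real.rpow_natCast,
      ← Real.rpow_mul (by positivity), ← Real.rpow_add (by positivity)]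
    congr 1; ring
  have h4 : √(2 * Real.pi * ((N * s : ℕ) : ℝ)) = √N * √(2 * Real.pi * s) := by
    rw [← Real.sqrt_mul hN'.le]; congr 1; push_cast; ring
  have h5 : (N : ℝ) ^ (-(1 / 2) : ℝ) * √N = 1 := by
    rw [Real.sqrt_eq_rpow, ← Real.rpow_add hN']; norm_num
  calc (s.factorial : ℝ) ^ N
      ≤ (√(2 * Real.pi * s) * (s / Real.exp 1) ^ s * Real.exp (1 / 12)) ^ N :=
        pow_le_pow_left₀ (by positivity) (factorial_le_stirling hs) N
    _ = √(2 * Real.pi * s) * (2 * Real.pi) ^ (((N : ℝ) - 1) / 2) *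
      (s : ℝ) ^ (((N : ℝ) - 1) / 2) * (s / Real.exp 1) ^ (N * s) * Real.exp ((N : ℝ) / 12) := by
        rw [mul_pow, mul_pow, h3, ← pow_mul, mul_comm s N, ← Real.exp_nat_mul]
        congr 2; ring
    _ = (2 * Real.pi) ^ (((N : ℝ) - 1) / 2) * (N : ℝ) ^ (-(1 / 2) : ℝ) *
      Real.exp ((N : ℝ) / 12) * (s : ℝ) ^ (((N : ℝ) - 1) / 2) / (N : ℝ) ^ (N * s) *
      (√(2 * Real.pi * ((N * s : ℕ) : ℝ)) * (((N * s : ℕ) : ℝ) / Real.exp 1) ^ (N * s)) := by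
        rw [h4]
        have h6 : (((N * s : ℕ) : ℝ) / Real.exp 1) ^ (N * s) =
            (N : ℝ) ^ (N * s) * (s / Real.exp 1) ^ (N * s) := by
          rw [← mul_pow]; congr 1; push_cast; ring
        rw [h6]
        have h7 : (N : ℝ) ^ (N * s) ≠ 0 := by positivity
        generalize (s / Real.exp 1) ^ (N * s) = y at *
        rw [div_mul_eq_mul_div, eq_div_iff h7]
        linear_combination (-(√(2 * Real.pi * s) * (2 * Real.pi) ^ (((N : ℝ) - 1) / 2) *
          (s : ℝ) ^ (((N : ℝ) - 1) / 2) * y * Real.exp ((N : ℝ) / 12) * (N : ℝ) ^ (N * s))) * h5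
    _ ≤ _ := by
        refine mul_le_mul_of_nonneg_left h2 (by positivity)

/-- The ratio of consecutive central binomials is at most `4`, so the case `k = 1`, which is `√π ≤
2`, suffices. -/
theorem sqrt_pi_mul_centralBinom_le {k : ℕ} (hk : 1 ≤ k) :
    √Real.pi * (k.centralBinom : ℝ) ≤ 4 ^ k := by
  induction k, hk using Nat.le_induction with
  | base =>
    have h : √Real.pi ≤ 2 := Real.sqrt_le_iff.2 ⟨by norm_num, by linarith [Real.pi_lt_four]⟩
    have : Nat.centralBinom 1 = 2 := by decide
    rw [this]; push_cast; linarith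
  | succ k hk ih =>
    have h1 : ((k + 1).centralBinom : ℝ) ≤ 4 * k.centralBinom := by
      have h := Nat.succ_mul_centralBinom_succ k
      have h2 : (k + 1) * (k + 1).centralBinom ≤ (k + 1) * (4 * k.centralBinom) := by
        rw [h]; nlinarith
      exact_mod_cast Nat.le_of_mul_le_mul_left h2 (Nat.succ_pos k)
    calc _ ≤ √Real.pi * (4 * k.centralBinom) := by gcongr
      _ = 4 * (√Real.pi * k.centralBinom) := by ring
      _ ≤ 4 * 4 ^ k := by gcongr
      _ = _ := by ring

theorem factorial_two_mul_eq (k : ℕ) :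
    ((2 * k).factorial : ℝ) = k.centralBinom * (k.factorial : ℝ) ^ 2 := by
  rw [Nat.centralBinom_eq_two_mul_choose, sq, ← mul_assoc]
  have := Nat.choose_mul_factorial_mul_factorial (show k ≤ 2 * k by omega)
  rw [show 2 * k - k = k by omega] at this
  exact_mod_cast this.symm

theorem matchings_sq (k : ℕ) :
    matchings k ^ 2 = (2 * k).factorial * (k.centralBinom / 4 ^ k) := by
  have h1 : (k.factorial : ℝ) ≠ 0 := by positivity
  rw [matchings, div_pow, mul_pow, ← pow_mul, mul_comm k 2, pow_mul, factorial_two_mul_eq]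
  norm_num
  field_simp

theorem matchings_sq_le {k : ℕ} (hk : 1 ≤ k) :
    matchings k ^ 2 ≤ 1 / √Real.pi * (2 * k).factorial := by
  have h1 := sqrt_pi_mul_centralBinom_le hk
  have h2 : 0 < √Real.pi := by positivity
  rw [matchings_sq, mul_comm]
  refine mul_le_mul_of_nonneg_right ?_ (by positivity)
  rw [div_le_div_iff₀ (by positivity) h2]
  linarith

/-! ### Polylogarithms -/

theorem summable_polyLog (s : ℝ) (K : ℕ∞) {z : ℝ} (hz : 0 ≤ z) (h : K = ⊤ → z < 1) :
    Summable fun k : ℕ => if 1 ≤ k ∧ (k : ℕ∞) ≤ K then z ^ k / (k : ℝ) ^ s else 0 := by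
  induction K using ENat.recTopCoe with
  | coe n =>
    refine summable_of_ne_finset_zero (s := Finset.range (n + 1)) fun k hk => if_neg fun h' => ?_
    have := Nat.cast_le.1 h'.2
    simp at hk
    omega
  | top =>
    have hz1 := h rfl
    have h1 : Summable fun k : ℕ => (k : ℝ) ^ ⌈|s|⌉₊ * z ^ k :=
      summable_pow_mul_geometric_of_norm_lt_one _ (by rwa [Real.norm_of_nonneg hz])
    refine h1.of_nonneg_of_le (fun k => by split_ifs <;> positivity) fun k => ?_
    split_ifs with hk
    · have hk1 : (1 : ℝ) ≤ k := by exact_mod_cast hk.1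
      rw [div_eq_mul_inv, ← Real.rpow_neg (by linarith), mul_comm,
        ← Real.rpow_natCast (k : ℝ)]
      refine mul_le_mul_of_nonneg_right (Real.rpow_le_rpow_of_exponent_le hk1 ?_) (by positivity)
      exact (neg_le_abs s).trans (Nat.le_ceil _)
    · positivity

theorem sum_le_polyLog (s : ℝ) (K : ℕ∞) {z : ℝ} (hz : 0 ≤ z) (h : K = ⊤ → z < 1)
    (F : Finset ℕ) (hF : ∀ k ∈ F, 1 ≤ k ∧ (k : ℕ∞) ≤ K) :
    ∑ k ∈ F, z ^ k / (k : ℝ) ^ s ≤ polyLog s K z := by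
  refine le_trans (le_of_eq ?_) ((summable_polyLog s K hz h).sum_le_tsum F fun k _ => ?_)
  · exact Finset.sum_congr rfl fun k hk => (if_pos (hF k hk)).symm
  · split_ifs <;> positivity

theorem polyLog_nonneg (s : ℝ) (K : ℕ∞) {z : ℝ} (hz : 0 ≤ z) : 0 ≤ polyLog s K z :=
  tsum_nonneg fun k => by split_ifs <;> positivity

theorem polyLog_coe (s : ℝ) (n : ℕ) (z : ℝ) :
    polyLog s (n : ℕ∞) z = ∑ k ∈ Finset.Icc 1 n, z ^ k / (k : ℝ) ^ s := by
  rw [polyLog, tsum_eq_sum (s := Finset.Icc 1 n)]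
  · refine Finset.sum_congr rfl fun k hk => if_pos ?_
    simpa using hk
  · intro k hk
    refine if_neg fun h => hk ?_
    simpa using h

/-! ### The function `G` -/

theorem sQuot_eq_zero {N k : ℕ} (hk : 1 ≤ k) (h : k ≤ N / 2) : sQuot N k = 0 := by
  unfold sQuot
  exact Nat.div_eq_of_lt (by omega)

theorem one_le_sQuot {N k : ℕ} (hN : 1 ≤ N) (h : N / 2 < k) : 1 ≤ sQuot N k := by
  unfold sQuot
  exact (Nat.one_le_div_iff hN).2 (by omega)

theorem rpow_le_of_le_of_le {q k y : ℝ} (hy : 0 < y) (h1 : y / 2 ≤ k) (h2 : k ≤ y) :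
    k ^ q ≤ 2 ^ (-min q 0) * y ^ q := by
  rcases le_total 0 q with hq | hq
  · rw [min_eq_right hq, neg_zero, Real.rpow_zero, one_mul]
    exact Real.rpow_le_rpow (by linarith) h2 hq
  · rw [min_eq_left hq, Real.rpow_neg (by norm_num), ← Real.inv_rpow (by norm_num),
      ← Real.mul_rpow (by norm_num) hy.le]
    exact Real.rpow_le_rpow_of_nonpos (by linarith) (by linarith) hq

/-- With `2k = Ns + r` the term separates into a function of `r` and a function of `s`. The sum over
`k` can then be bounded by a product of two polylogarithms. -/
theorem term_le {N k : ℕ} (hN : 1 ≤ N) (hk : N / 2 < k) (q : ℝ) {z : ℝ} (hz : 0 ≤ z) :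
    (k : ℝ) ^ q * z ^ (2 * k) * mCoef N k / ((2 * k).factorial : ℝ) ≤
      (2 : ℝ) ^ (-min q 0) * (2 * Real.pi) ^ (((N : ℝ) - 1) / 2) * (N : ℝ) ^ (q - 1 / 2) *
      Real.exp ((N : ℝ) / 12) * ((2 * z / N) ^ rRem N k / (rRem N k : ℝ) ^ (0 : ℝ)) *
      ((z ^ N / (N : ℝ) ^ N) ^ sQuot N k / (sQuot N k : ℝ) ^ (1 / 2 - (N : ℝ) / 2 - q)) := by
  obtain ⟨h2k, hr1, hrN⟩ := sQuot_rRem_spec N k hN (by omega)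
  have hs1 := one_le_sQuot hN hk
  unfold mCoef
  generalize sQuot N k = s at *
  generalize rRem N k = r at *
  have hs' : (0 : ℝ) < s := by exact_mod_cast hs1
  have hN' : (0 : ℝ) < N := by exact_mod_cast hN
  have hNs : N ≤ N * s := Nat.le_mul_of_pos_right N hs1
  -- Since `r ≤ N ≤ Ns`, the number `k` lies between `Ns/2` and `Ns`. The lower end matters only for
  -- negative `q` and is the source of `2^{-q^-}`.
  have hkq : (k : ℝ) ^ q ≤ 2 ^ (-min q 0) * ((N : ℝ) * s) ^ q := by
    have h2k' : 2 * (k : ℝ) = N * s + r := by exact_mod_cast h2k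
    have hr' : (r : ℝ) ≤ N * s := by exact_mod_cast hrN.trans hNs
    have hr0 : (0 : ℝ) ≤ r := by positivity
    exact rpow_le_of_le_of_le (by positivity) (by linarith) (by linarith)
  -- Here `s + 1 ≤ 2s`, and the factor `(Ns)^r` is absorbed into `(2k)!` by the next estimate.
  have hm : ((s : ℝ) + 1) ^ r ≤ (2 / N) ^ r * ((N : ℝ) * s) ^ r := by
    rw [← mul_pow]
    refine pow_le_pow_left₀ (by positivity) ?_ r
    have : (1 : ℝ) ≤ s := by exact_mod_cast hs1
    rw [show 2 / (N : ℝ) * (N * s) = 2 * s by field_simp]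
    linarith
  have hfac : ((N * s).factorial : ℝ) * ((N : ℝ) * s) ^ r ≤ ((2 * k).factorial : ℝ) := by
    rw [h2k]
    exact_mod_cast (Nat.mul_le_mul_left _ (Nat.pow_le_pow_left (Nat.le_succ _) r)).trans
      (Nat.factorial_mul_pow_le_factorial (m := N * s) (n := r))
  have hpow := factorial_pow_le hN hs1
  rw [div_le_iff₀ (by positivity)]
  have hz2 : z ^ (2 * k) = (z ^ N) ^ s * z ^ r := by rw [h2k, pow_add, pow_mul]
  rw [hz2]
  set P : ℝ := (2 * Real.pi) ^ (((N : ℝ) - 1) / 2) with hP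
  set E := Real.exp ((N : ℝ) / 12) with hE
  have hPpos : 0 < P := by positivity
  have hEpos : 0 < E := by positivity
  calc (k : ℝ) ^ q * ((z ^ N) ^ s * z ^ r) * ((s.factorial : ℝ) ^ N * ((s : ℝ) + 1) ^ r)
      ≤ (2 ^ (-min q 0) * ((N : ℝ) * s) ^ q) * ((z ^ N) ^ s * z ^ r) *
        ((P * (N : ℝ) ^ (-(1 / 2) : ℝ) * E * (s : ℝ) ^ (((N : ℝ) - 1) / 2) / (N : ℝ) ^ (N * s) *
          ((N * s).factorial : ℝ)) * ((2 / N) ^ r * ((N : ℝ) * s) ^ r)) := by gcongr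
    _ = (2 ^ (-min q 0) * ((N : ℝ) * s) ^ q) * ((z ^ N) ^ s * z ^ r) *
        ((P * (N : ℝ) ^ (-(1 / 2) : ℝ) * E * (s : ℝ) ^ (((N : ℝ) - 1) / 2) / (N : ℝ) ^ (N * s)) *
          (2 / N) ^ r) * (((N * s).factorial : ℝ) * ((N : ℝ) * s) ^ r) := by ring
    _ ≤ (2 ^ (-min q 0) * ((N : ℝ) * s) ^ q) * ((z ^ N) ^ s * z ^ r) *
        ((P * (N : ℝ) ^ (-(1 / 2) : ℝ) * E * (s : ℝ) ^ (((N : ℝ) - 1) / 2) / (N : ℝ) ^ (N * s)) *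
          (2 / N) ^ r) * ((2 * k).factorial : ℝ) := by gcongr
    _ = _ := by
      congr 1
      have e1 : ((N : ℝ) * s) ^ q = (N : ℝ) ^ q * (s : ℝ) ^ q := Real.mul_rpow hN'.le hs'.le
      have e2 : (N : ℝ) ^ (q - 1 / 2) = (N : ℝ) ^ q * (N : ℝ) ^ (-(1 / 2) : ℝ) := by
        rw [← Real.rpow_add hN']; congr 1
      have e3 : (s : ℝ) ^ (1 / 2 - (N : ℝ) / 2 - q) =
          ((s : ℝ) ^ q * (s : ℝ) ^ (((N : ℝ) - 1) / 2))⁻¹ := by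
        rw [← Real.rpow_add hs', ← Real.rpow_neg hs'.le]; congr 1; ring
      rw [e1, e2, e3, Real.rpow_zero, div_one, div_inv_eq_mul, div_pow (z ^ N), ← pow_mul (N : ℝ),
        show 2 * z / (N : ℝ) = 2 / N * z by ring, mul_pow (2 / (N : ℝ)) z]
      ring

theorem mCoef_eq_one {N k : ℕ} (hk : 1 ≤ k) (h : k ≤ N / 2) : mCoef N k = 1 := by
  simp [mCoef, sQuot_eq_zero hk h]

theorem sQuot_mono (N : ℕ) : Monotone (sQuot N) := fun a b h =>
  Nat.div_le_div_right (by omega)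

theorem sQuot_le_map {N k : ℕ} {K : ℕ∞} (h : (k : ℕ∞) ≤ K) :
    ((sQuot N k : ℕ) : ℕ∞) ≤ ENat.map (sQuot N) K := by
  induction K using ENat.recTopCoe with
  | coe n => rw [ENat.map_natCast]; exact Nat.cast_le.2 (sQuot_mono N (Nat.cast_le.1 h))
  | top => simp only [ENat.map_top]; exact le_top

theorem mCoef_pos (N k : ℕ) : 0 < mCoef N k := by unfold mCoef; positivity

/-- Degrees up to `N/2` have `s_k = 0` and `m_k = 1` and give `h`. For larger degrees `k ↦ (r_k,
s_k)` is injective, and enlarging its image to a full rectangle gives the product of polylogarithms.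
-/
theorem sum_le_GFun {N : ℕ} {K : ℕ∞} (hN : 1 ≤ N) (q : ℝ) {z : ℝ} (hz : 0 ≤ z)
    (hK : K = ⊤ → z < N) (F : Finset ℕ) (hF : ∀ k ∈ F, 1 ≤ k ∧ (k : ℕ∞) ≤ K) :
    ∑ k ∈ F, (k : ℝ) ^ q * z ^ (2 * k) * mCoef N k / ((2 * k).factorial : ℝ) ≤ GFun q K N z := by
  have hN' : (0 : ℝ) < N := by exact_mod_cast hN
  rw [← Finset.sum_filter_add_sum_filter_not F (fun k => k ≤ N / 2)]
  unfold GFun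
  refine add_le_add ?_ ?_
  · calc _ = ∑ k ∈ F with k ≤ N / 2, (k : ℝ) ^ q / ((2 * k).factorial : ℝ) * z ^ (2 * k) := by
          refine Finset.sum_congr rfl fun k hk => ?_
          rw [Finset.mem_filter] at hk
          rw [mCoef_eq_one (hF k hk.1).1 hk.2]
          ring
      _ ≤ _ := by
          refine Finset.sum_le_sum_of_subset_of_nonneg (fun k hk => ?_) fun k _ _ => by positivity
          rw [Finset.mem_filter] at hk
          exact Finset.mem_Icc.2 ⟨(hF k hk.1).1, hk.2⟩
  · set c := (2 : ℝ) ^ (-min q 0) * (2 * Real.pi) ^ (((N : ℝ) - 1) / 2) * (N : ℝ) ^ (q - 1 / 2) *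
      Real.exp ((N : ℝ) / 12) with hc
    have hcpos : 0 < c := by positivity
    set F' := F.filter fun k => ¬ k ≤ N / 2 with hF'
    have hmem : ∀ k ∈ F', 1 ≤ k ∧ (k : ℕ∞) ≤ K ∧ N / 2 < k := fun k hk => by
      rw [hF', Finset.mem_filter] at hk
      exact ⟨(hF k hk.1).1, (hF k hk.1).2, not_le.1 hk.2⟩
    let g : ℕ × ℕ → ℝ := fun p => c * ((2 * z / N) ^ p.1 / (p.1 : ℝ) ^ (0 : ℝ)) *
      ((z ^ N / (N : ℝ) ^ N) ^ p.2 / (p.2 : ℝ) ^ (1 / 2 - (N : ℝ) / 2 - q))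
    have hinj : Set.InjOn (fun k => (rRem N k, sQuot N k)) F' := fun k hk k' hk' h => by
      have h1 := (sQuot_rRem_spec N k hN (hmem k hk).1).1
      have h2 := (sQuot_rRem_spec N k' hN (hmem k' hk').1).1
      simp only [Prod.mk.injEq] at h
      rw [h.1, h.2, ← h2] at h1
      omega
    calc _ ≤ ∑ k ∈ F', g (rRem N k, sQuot N k) :=
          Finset.sum_le_sum fun k hk => term_le hN (hmem k hk).2.2 q hz
      _ = ∑ p ∈ F'.image fun k => (rRem N k, sQuot N k), g p := by rw [Finset.sum_image hinj]
      _ ≤ ∑ p ∈ (Finset.Icc 1 N) ×ˢ (F'.image (sQuot N)), g p := by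
          refine Finset.sum_le_sum_of_subset_of_nonneg (fun p hp => ?_) fun p _ _ => by
            simp only [g]; positivity
          obtain ⟨k, hk, rfl⟩ := Finset.mem_image.1 hp
          have := sQuot_rRem_spec N k hN (hmem k hk).1
          exact Finset.mem_product.2 ⟨Finset.mem_Icc.2 this.2, Finset.mem_image_of_mem _ hk⟩
      _ = c * (∑ r ∈ Finset.Icc 1 N, (2 * z / N) ^ r / (r : ℝ) ^ (0 : ℝ)) *
          ∑ s ∈ F'.image (sQuot N),
            (z ^ N / (N : ℝ) ^ N) ^ s / (s : ℝ) ^ (1 / 2 - (N : ℝ) / 2 - q) := by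
          rw [mul_assoc, Finset.sum_mul_sum, ← Finset.sum_product', Finset.mul_sum]
          refine Finset.sum_congr rfl fun p _ => ?_
          simp only [g]
          ring
      _ ≤ _ := by
          rw [polyLog_coe]
          refine mul_le_mul_of_nonneg_left (sum_le_polyLog _ _ (by positivity) ?_ _ ?_) (by positivity)
          · intro hKt
            have : K = ⊤ := by
              induction K using ENat.recTopCoe with
              | coe n => rw [ENat.map_natCast] at hKt; exact absurd hKt (ENat.natCast_ne_top _)
              | top => rfl
            rw [← div_pow]
            exact pow_lt_one₀ (by positivity) ((div_lt_one hN').2 (hK this)) (by omega)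
          · intro s hs
            obtain ⟨k, hk, rfl⟩ := Finset.mem_image.1 hs
            exact ⟨one_le_sQuot hN (hmem k hk).2.2, sQuot_le_map (hmem k hk).2.1⟩

/-! ### The second moment of the importance estimator -/

section UpperBound

variable {N : ℕ} {K : ℕ∞}

theorem le_bmax (B : Matrix (Fin N) (Fin N) ℝ) (i j : Fin N) : B i j ≤ bmax B :=
  (le_abs_self _).trans
    (le_ciSup (f := fun ij : Fin N × Fin N => |B ij.1 ij.2|) (Set.finite_range _).bddAbove (i, j))

theorem bmax_nonneg (B : Matrix (Fin N) (Fin N) ℝ) : 0 ≤ bmax B :=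
  Real.iSup_nonneg fun _ => abs_nonneg _

theorem bmin_le (B : Matrix (Fin N) (Fin N) ℝ) (i j : Fin N) : bmin B ≤ B i j :=
  ciInf_le (f := fun ij : Fin N × Fin N => B ij.1 ij.2) (Set.finite_range _).bddBelow (i, j)

theorem bmin_nonneg {B : Matrix (Fin N) (Fin N) ℝ} (h : ∀ i j, 0 < B i j) : 0 ≤ bmin B :=
  Real.iInf_nonneg fun _ => (h _ _).le

theorem multiFactorial_pos (I : Fin N → ℕ) : 0 < multiFactorial I :=
  Finset.prod_pos fun _ _ => by positivity

theorem MIdx.sum_eq {k : ℕ} (I : MIdx N k) : ∑ i, I.1 i = 2 * k := (mem_MIdx_iff N k I.1).1 I.2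

instance subsingleton_MIdx_zero : Subsingleton (MIdx N 0) := ⟨fun I J => Subtype.ext <| funext fun i => by
  have h1 := Finset.sum_eq_zero_iff.1 I.sum_eq i (Finset.mem_univ i)
  have h2 := Finset.sum_eq_zero_iff.1 J.sum_eq i (Finset.mem_univ i)
  rw [h1, h2]⟩

/-- The degree `0`. -/
def Deg.zero (K : ℕ∞) : Deg K := ⟨0, by simp⟩

/-- The sum of all `a_I` with `|I| = 2k`. -/
def coeffSum (a : Coeff N K) (k : Deg K) : ℝ := ∑ I : MIdx N k.1, (a k I : ℝ)

theorem coeffSum_nonneg (a : Coeff N K) (k : Deg K) : 0 ≤ coeffSum a k :=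
  Finset.sum_nonneg fun _ _ => NNReal.coe_nonneg _

theorem sum_MIdx_zero (f : MIdx N 0 → ℝ) : ∑ I, f I = f ⟨0, by simp⟩ :=
  Fintype.sum_subsingleton f _

theorem haf_zero_index (B : Matrix (Fin N) (Fin N) ℝ) : haf B 0 = 1 := haf_zero B (by simp)

/-- The degree `k` part of `∑ a_I² I! Haf(B_I)²`. -/
def secondMoment (B : Matrix (Fin N) (Fin N) ℝ) (a : Coeff N K) (k : Deg K) : ℝ :=
  ∑ I : MIdx N k.1, (a k I : ℝ) ^ 2 * multiFactorial I.1 * haf B I.1 ^ 2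

theorem secondMoment_nonneg (B : Matrix (Fin N) (Fin N) ℝ) (a : Coeff N K) (k : Deg K) :
    0 ≤ secondMoment B a k :=
  Finset.sum_nonneg fun I _ => by have := multiFactorial_pos I.1; positivity

theorem secondMoment_zero (B : Matrix (Fin N) (Fin N) ℝ) (a : Coeff N K) :
    secondMoment B a (Deg.zero K) = coeffZero a ^ 2 := by
  refine (sum_MIdx_zero fun I => (a (Deg.zero K) I : ℝ) ^ 2 * multiFactorial I.1 *
    haf B I.1 ^ 2).trans ?_
  simp [haf_zero_index, multiFactorial, coeffZero, Deg.zero]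

/-- One factor `(2k)!` of the squared factorial in the coefficient bound is cancelled by `M_k² ≤
(2k)!/√π`. -/
theorem secondMoment_le {B : Matrix (Fin N) (Fin N) ℝ} (hB : ∀ i j, 0 < B i j) {a : Coeff N K}
    {γα γβ qα qβ : ℝ} (ha : CoeffBounds γα γβ qα qβ a) (k : Deg K) (hk : 1 ≤ k.1) :
    secondMoment B a k ≤ 1 / √Real.pi * ((k.1 : ℝ) ^ (2 * qβ) * (γβ * bmax B) ^ (2 * k.1) *
      mCoef N k.1 / ((2 * k.1).factorial : ℝ)) := by
  have hb := bmax_nonneg B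
  have hfac : ((2 * k.1).factorial : ℝ) ≠ 0 := by positivity
  calc secondMoment B a k
      ≤ ∑ I : MIdx N k.1, (a k I : ℝ) ^ 2 * multiFactorial I.1 *
          (bmax B ^ (2 * k.1) * (1 / √Real.pi * (2 * k.1).factorial)) := by
        refine Finset.sum_le_sum fun I _ => mul_le_mul_of_nonneg_left ?_ ?_
        · have h0 := haf_nonneg (fun i j => (hB i j).le) I.sum_eq
          have h1 := haf_le (fun i j => (hB i j).le) (le_bmax B) I.sum_eq
          calc haf B I.1 ^ 2 ≤ (bmax B ^ k.1 * matchings k.1) ^ 2 := pow_le_pow_left₀ h0 h1 2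
            _ = bmax B ^ (2 * k.1) * matchings k.1 ^ 2 := by ring
            _ ≤ _ := mul_le_mul_of_nonneg_left (matchings_sq_le hk) (by positivity)
        · have := multiFactorial_pos I.1; positivity
    _ = (∑ I : MIdx N k.1, (a k I : ℝ) ^ 2 * multiFactorial I.1) *
          (bmax B ^ (2 * k.1) * (1 / √Real.pi * (2 * k.1).factorial)) := by rw [Finset.sum_mul]
    _ ≤ ((k.1 : ℝ) ^ (2 * qβ) * γβ ^ (2 * k.1) / ((2 * k.1).factorial : ℝ) ^ 2 * mCoef N k.1) *
          (bmax B ^ (2 * k.1) * (1 / √Real.pi * (2 * k.1).factorial)) :=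
        mul_le_mul_of_nonneg_right (ha k hk).2.2 (by positivity)
    _ = _ := by
        rw [mul_pow]
        field_simp

theorem sum_secondMoment_le {B : Matrix (Fin N) (Fin N) ℝ} (hN : 1 ≤ N) (hB : ∀ i j, 0 < B i j)
    {a : Coeff N K} {γα γβ qα qβ : ℝ} (hγ : 0 < γβ) (hK : K = ⊤ → γβ * bmax B < N)
    (ha : CoeffBounds γα γβ qα qβ a) (F : Finset (Deg K)) :
    ∑ k ∈ F, secondMoment B a k ≤
      coeffZero a ^ 2 + 1 / √Real.pi * GFun (2 * qβ) K N (γβ * bmax B) := by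
  classical
  have hinj : Set.InjOn (Subtype.val : Deg K → ℕ) (F.erase (Deg.zero K)) :=
    Subtype.val_injective.injOn
  have hne : ∀ k ∈ F.erase (Deg.zero K), 1 ≤ k.1 := fun k hk =>
    Nat.one_le_iff_ne_zero.2 fun h => (Finset.mem_erase.1 hk).1 (Subtype.ext h)
  calc ∑ k ∈ F, secondMoment B a k
      ≤ ∑ k ∈ insert (Deg.zero K) (F.erase (Deg.zero K)), secondMoment B a k := by
        refine Finset.sum_le_sum_of_subset_of_nonneg ?_ fun k _ _ => secondMoment_nonneg B a k
        exact Finset.subset_insert_iff.2 subset_rfl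
    _ = coeffZero a ^ 2 + ∑ k ∈ F.erase (Deg.zero K), secondMoment B a k := by
        rw [Finset.sum_insert (by simp), secondMoment_zero]
    _ ≤ _ := by
        refine add_le_add_right ?_ _
        calc _ ≤ ∑ k ∈ F.erase (Deg.zero K), 1 / √Real.pi * ((k.1 : ℝ) ^ (2 * qβ) *
                (γβ * bmax B) ^ (2 * k.1) * mCoef N k.1 / ((2 * k.1).factorial : ℝ)) :=
              Finset.sum_le_sum fun k hk => secondMoment_le hB ha k (hne k hk)
          _ = 1 / √Real.pi * ∑ k ∈ (F.erase (Deg.zero K)).image Subtype.val, ((k : ℝ) ^ (2 * qβ) *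
                (γβ * bmax B) ^ (2 * k) * mCoef N k / ((2 * k).factorial : ℝ)) := by
              rw [Finset.sum_image hinj, Finset.mul_sum]
          _ ≤ _ := by
              refine mul_le_mul_of_nonneg_left (sum_le_GFun hN _ (mul_nonneg hγ.le (bmax_nonneg B))
                hK _ fun k hk => ?_) (by positivity)
              obtain ⟨k, hk', rfl⟩ := Finset.mem_image.1 hk
              exact ⟨hne k hk', k.2⟩

theorem normConst_nonneg (B : Matrix (Fin N) (Fin N) ℝ) : 0 ≤ normConst B := by
  unfold normConst
  split_ifs
  · exact Finset.prod_nonneg fun _ _ => Real.sqrt_nonneg _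
  · exact le_rfl

theorem QGBS_nonneg (B : Matrix (Fin N) (Fin N) ℝ) (a : Coeff N K) : 0 ≤ QGBS B a :=
  mul_nonneg (one_div_nonneg.2 (normConst_nonneg B)) (tsum_nonneg (secondMoment_nonneg B a))

variable {ζ p γα γβ qα qβ CG CD CR : ℝ} {x : Coeff N K × Matrix (Fin N) (Fin N) ℝ}

theorem Admissible.coeffZero_pos (h : Admissible ζ p γα γβ qα qβ CG CD CR x) :
    0 < coeffZero x.1 :=
  lt_of_le_of_ne (NNReal.coe_nonneg _) h.2.2.2.symm

theorem Admissible.QGBS_lt (h : Admissible ζ p γα γβ qα qβ CG CD CR x) (hN : 1 ≤ N)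
    (hγ : 0 < γβ) : QGBS x.2 x.1 <
      CD * (N : ℝ) ^ p * (coeffZero x.1 ^ 2 + 1 / √Real.pi * CG * (N : ℝ) ^ 3) := by
  have ha0 := h.coeffZero_pos
  obtain ⟨⟨hB, hS⟩, ⟨-, hK, hG, -, hd⟩, hc, -⟩ := h
  have h1 : ∑' k, secondMoment x.2 x.1 k ≤
      coeffZero x.1 ^ 2 + 1 / √Real.pi * GFun (2 * qβ) K N (γβ * bmax x.2) :=
    hS.2.2.1.tsum_le_of_sum_le (sum_secondMoment_le hN hB.1 hγ hK hc)
  have h2 : ∑' k, secondMoment x.2 x.1 k ≤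
      coeffZero x.1 ^ 2 + 1 / √Real.pi * CG * (N : ℝ) ^ 3 := by
    refine h1.trans (add_le_add_right ?_ _)
    rw [mul_assoc]
    exact mul_le_mul_of_nonneg_left hG.le (by positivity)
  -- Positivity, supplied by `a_0`, keeps the inequality `1/d < C_D N^p` strict after
  -- multiplication.
  have h3 : 0 < ∑' k, secondMoment x.2 x.1 k := by
    refine lt_of_lt_of_le (pow_pos ha0 2) ?_
    rw [← secondMoment_zero x.2 x.1]
    exact hS.2.2.1.le_tsum (Deg.zero K) fun k _ => secondMoment_nonneg x.2 x.1 k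
  have h4 : 0 ≤ 1 / normConst x.2 := one_div_nonneg.2 (normConst_nonneg _)
  calc QGBS x.2 x.1 = 1 / normConst x.2 * ∑' k, secondMoment x.2 x.1 k := rfl
    _ < CD * (N : ℝ) ^ p * ∑' k, secondMoment x.2 x.1 k := mul_lt_mul_of_pos_right hd h3
    _ ≤ _ := mul_le_mul_of_nonneg_left h2 (h4.trans hd.le)

theorem coeffZero_le_mu {B : Matrix (Fin N) (Fin N) ℝ} {a : Coeff N K}
    (ha : Summable fun k : Deg K => ∑ I : MIdx N k.1, (a k I : ℝ) * haf B I.1 ^ 2) :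
    coeffZero a ≤ mu B a := by
  have h1 := ha.le_tsum (Deg.zero K) fun k _ => Finset.sum_nonneg fun I _ => by positivity
  have h2 := sum_MIdx_zero fun I : MIdx N 0 => (a (Deg.zero K) I : ℝ) * haf B I.1 ^ 2
  rw [haf_zero_index, one_pow, mul_one] at h2
  exact h2.symm.trans_le h1

theorem sum_Deg_haf_sq_div_le {B : Matrix (Fin N) (Fin N) ℝ} (hB : B ∈ matrixSpace N)
    (F : Finset (Deg K)) :
    ∑ k ∈ F, ∑ I : MIdx N k.1, haf B I.1 ^ 2 / multiFactorial I.1 ≤ 1 / normConst B := by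
  classical
  have h1 : ∀ k : ℕ, ∑ I : MIdx N k, haf B I.1 ^ 2 / multiFactorial I.1 =
      ∑ I ∈ Finset.piAntidiag (Finset.univ : Finset (Fin N)) (2 * k),
        haf B I ^ 2 / multiFactorial I := fun k =>
    Finset.sum_coe_sort _ fun I => haf B I ^ 2 / multiFactorial I
  obtain ⟨M, hM⟩ := (F.image Subtype.val).exists_nat_subset_range
  refine le_trans ?_ (sum_haf_sq_div_le hB M)
  simp only [h1]
  rw [← Finset.sum_image (f := fun k => ∑ I ∈ Finset.piAntidiag
    (Finset.univ : Finset (Fin N)) (2 * k), haf B I ^ 2 / multiFactorial I)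
    (g := Subtype.val) Subtype.val_injective.injOn]
  refine Finset.sum_le_sum_of_subset_of_nonneg hM fun k _ _ => Finset.sum_nonneg fun I _ => ?_
  have := multiFactorial_pos I
  positivity

/-- The importance estimator has non-negative variance. -/
theorem mu_sq_le_QGBS {B : Matrix (Fin N) (Fin N) ℝ} (hB : B ∈ matrixSpace N) {a : Coeff N K}
    (ha : a ∈ coeffSpace K B) : mu B a ^ 2 ≤ QGBS B a := by
  have hmu : 0 ≤ mu B a := (NNReal.coe_nonneg _).trans (coeffZero_le_mu ha.1)
  suffices h : mu B a ≤ √(QGBS B a) by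
    calc _ ≤ √(QGBS B a) ^ 2 := pow_le_pow_left₀ hmu h 2
      _ = _ := Real.sq_sqrt (QGBS_nonneg B a)
  refine ha.1.tsum_le_of_sum_le fun F => Real.le_sqrt_of_sq_le ?_
  rw [Finset.sum_sigma']
  -- Cauchy–Schwarz, splitting `a_I Haf²` into `Haf/√(I!)` and `a_I √(I!) Haf`.
  have h1 := Finset.sum_sq_le_sum_mul_sum_of_sq_le_mul
    (F.sigma fun k => (Finset.univ : Finset (MIdx N k.1)))
    (r := fun i => (a i.1 i.2 : ℝ) * haf B i.2.1 ^ 2)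
    (f := fun i => haf B i.2.1 ^ 2 / multiFactorial i.2.1)
    (g := fun i => (a i.1 i.2 : ℝ) ^ 2 * multiFactorial i.2.1 * haf B i.2.1 ^ 2)
    (fun i _ => div_nonneg (sq_nonneg _) (multiFactorial_pos _).le)
    (fun i _ => mul_nonneg (mul_nonneg (sq_nonneg _) (multiFactorial_pos _).le) (sq_nonneg _))
    (fun i _ => le_of_eq (by
      have := (multiFactorial_pos i.2.1).ne'
      field_simp))
  refine h1.trans ?_
  rw [Finset.sum_sigma, Finset.sum_sigma]
  exact mul_le_mul (sum_Deg_haf_sq_div_le hB F)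
    (ha.2.2.1.sum_le_tsum F fun k _ => secondMoment_nonneg B a k)
    (Finset.sum_nonneg fun k _ => secondMoment_nonneg B a k)
    (one_div_nonneg.2 (normConst_nonneg B))

theorem Admissible.nGBS_lt (h : Admissible ζ p γα γβ qα qβ CG CD CR x) (hN : 1 ≤ N)
    (hγ : 0 < γβ) {ε δ : ℝ} (hε : 0 < ε) (hδ : 0 < δ) :
    nGBS x.2 x.1 ε δ < 1 / (ε ^ 2 * δ) * (CD * (N : ℝ) ^ p
      + CG * CD * (N : ℝ) ^ (3 + p) / (coeffZero x.1 ^ 2 * √Real.pi) - 1) := by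
  have hQ := h.QGBS_lt hN hγ
  have ha0 := h.coeffZero_pos
  have hmu := coeffZero_le_mu h.1.2.1
  have hN' : (0 : ℝ) < N := by exact_mod_cast hN
  have hpi : 0 < √Real.pi := by positivity
  have hQ0 := QGBS_nonneg x.2 x.1
  have h3 : (N : ℝ) ^ (3 + p) = (N : ℝ) ^ 3 * (N : ℝ) ^ p := by
    rw [Real.rpow_add hN']; norm_cast
  have h6 : nGBS x.2 x.1 ε δ = 1 / (ε ^ 2 * δ) * (QGBS x.2 x.1 / mu x.2 x.1 ^ 2 - 1) := by
    have : mu x.2 x.1 ≠ 0 := (lt_of_lt_of_le ha0 hmu).ne'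
    unfold nGBS
    field_simp
  rw [h6]
  generalize mu x.2 x.1 = m at *
  generalize coeffZero x.1 = a₀ at *
  have hm : 0 < m := lt_of_lt_of_le ha0 hmu
  have h4 : QGBS x.2 x.1 / m ^ 2 ≤ QGBS x.2 x.1 / a₀ ^ 2 := by gcongr
  have h5 : QGBS x.2 x.1 / a₀ ^ 2 <
      CD * (N : ℝ) ^ p + CG * CD * (N : ℝ) ^ (3 + p) / (a₀ ^ 2 * √Real.pi) := by
    rw [div_lt_iff₀ (by positivity)]
    refine hQ.trans_eq ?_
    rw [h3]
    field_simp
  exact mul_lt_mul_of_pos_left (by linarith) (by positivity)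

end UpperBound

/-! ### The variance of the plain Monte Carlo estimator -/

theorem sum_range_two_mul_add_one (f : ℕ → ℝ) (n : ℕ) :
    ∑ i ∈ Finset.range (2 * n + 1), f i =
      ∑ j ∈ Finset.range (n + 1), f (2 * j) + ∑ j ∈ Finset.range n, f (2 * j + 1) := by
  induction n with
  | zero => simp
  | succ n ih =>
    rw [show 2 * (n + 1) + 1 = 2 * n + 1 + 1 + 1 by ring, Finset.sum_range_succ,
      Finset.sum_range_succ, ih, Finset.sum_range_succ (fun j => f (2 * j)) (n + 1),
      Finset.sum_range_succ (fun j => f (2 * j + 1)) n,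
      show 2 * n + 1 + 1 = 2 * (n + 1) by ring]
    ring

theorem sum_choose_even {k : ℕ} (hk : 1 ≤ k) :
    ∑ p ∈ Finset.HasAntidiagonal.antidiagonal k, ((2 * k).choose (2 * p.1) : ℝ) = 4 ^ k / 2 := by
  rw [Finset.Nat.sum_antidiagonal_eq_sum_range_succ_mk]
  have h1 : ∑ i ∈ Finset.range (2 * k + 1), ((2 * k).choose i : ℝ) = 4 ^ k := by
    have := Nat.sum_range_choose (2 * k)
    rw [pow_mul] at this
    exact_mod_cast this
  have h2 : ∑ i ∈ Finset.range (2 * k + 1), (-1 : ℝ) ^ i * ((2 * k).choose i : ℝ) = 0 := by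
    have := Int.alternating_sum_range_choose_of_ne (n := 2 * k) (by omega)
    exact_mod_cast this
  rw [sum_range_two_mul_add_one] at h1 h2
  simp only [pow_succ, pow_mul] at h2
  norm_num at h2
  simp only at h1 ⊢
  linarith

/-- Inserting `M_k² = (2k)! C(2k,k)/4^k`, the first part sums the binomials `C(2k,2i)` to `4^k/2`,
and the second is the convolution of central binomials, equal to `4^k`. -/
theorem sum_antidiagonal_matchings {k : ℕ} (hk : 1 ≤ k) :
    ∑ p ∈ Finset.HasAntidiagonal.antidiagonal k, (matchings k ^ 2 -
      (matchings p.1 * matchings p.2) ^ 2) / (((2 * p.1).factorial : ℝ) * (2 * p.2).factorial) =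
      (k.centralBinom : ℝ) / 2 - 1 := by
  have h1 : ∀ p ∈ Finset.HasAntidiagonal.antidiagonal k, (matchings k ^ 2 -
      (matchings p.1 * matchings p.2) ^ 2) / (((2 * p.1).factorial : ℝ) * (2 * p.2).factorial) =
      (k.centralBinom : ℝ) / 4 ^ k * ((2 * k).choose (2 * p.1) : ℝ) -
        (p.1.centralBinom : ℝ) * p.2.centralBinom / 4 ^ k := fun p hp => by
    have hp' := Finset.HasAntidiagonal.mem_antidiagonal.1 hp
    have h2 : ((2 * k).choose (2 * p.1) : ℝ) * (((2 * p.1).factorial : ℝ) *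
        (2 * p.2).factorial) = (2 * k).factorial := by
      have := Nat.choose_mul_factorial_mul_factorial (show 2 * p.1 ≤ 2 * k by omega)
      rw [show 2 * k - 2 * p.1 = 2 * p.2 by omega, mul_assoc] at this
      exact_mod_cast this
    have h4 : (4 : ℝ) ^ k = 4 ^ p.1 * 4 ^ p.2 := by rw [← pow_add, hp']
    rw [mul_pow, matchings_sq, matchings_sq, matchings_sq, ← h2, h4]
    have h5 : ((2 * p.1).factorial : ℝ) ≠ 0 := by positivity
    have h6 : ((2 * p.2).factorial : ℝ) ≠ 0 := by positivity
    field_simp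
  rw [Finset.sum_congr rfl h1, Finset.sum_sub_distrib, ← Finset.mul_sum, sum_choose_even hk,
    ← Finset.sum_div, sum_antidiagonal_centralBinom]
  field_simp

theorem matchings_sub_nonneg {k : ℕ} {p : ℕ × ℕ} (hp : p.1 + p.2 = k) :
    0 ≤ matchings k ^ 2 - (matchings p.1 * matchings p.2) ^ 2 := by
  rw [← hp]
  have h1 := matchings_mul_le p.1 p.2
  have h2 := mul_pos (matchings_pos p.1) (matchings_pos p.2)
  nlinarith

theorem matchings_zero : matchings 0 = 1 := by simp [matchings]

/-- A lower bound for `(k₁ k₂)^q` when `k₁ + k₂ = k` and `k₁, k₂ ≥ 1`. -/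
def splitBound (q : ℝ) (k : ℕ) : ℝ := if 0 ≤ q then ((k : ℝ) / 2) ^ q else (k : ℝ) ^ (2 * q)

theorem splitBound_nonneg (q : ℝ) (k : ℕ) : 0 ≤ splitBound q k := by
  unfold splitBound; split_ifs <;> positivity

/-- For `k₁, k₂ ≥ 1` with sum `k` the product `k₁ k₂` lies between `k/2` and `k²`. -/
theorem splitBound_le {q : ℝ} {k : ℕ} {p : ℕ × ℕ} (hp : p.1 + p.2 = k) (h1 : 1 ≤ p.1)
    (h2 : 1 ≤ p.2) : splitBound q k ≤ (p.1 : ℝ) ^ q * (p.2 : ℝ) ^ q := by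
  have h1' : (1 : ℝ) ≤ p.1 := by exact_mod_cast h1
  have h2' : (1 : ℝ) ≤ p.2 := by exact_mod_cast h2
  have hp' : (p.1 : ℝ) + p.2 = k := by exact_mod_cast hp
  rw [← Real.mul_rpow (by linarith) (by linarith)]
  unfold splitBound
  split_ifs with hq
  · exact Real.rpow_le_rpow (by positivity) (by nlinarith) hq
  · rw [Real.rpow_mul (by positivity)]
    refine Real.rpow_le_rpow_of_nonpos (by nlinarith) ?_ (not_le.1 hq).le
    rw [← hp']
    norm_cast
    nlinarith

/-! ### The variance, bounded below degree by degree. -/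

section LowerBound

variable {N : ℕ} {K : ℕ∞}

/-- The sums `coeffSum`, extended by zero. -/
def coeffSumNat (a : Coeff N K) (k : ℕ) : ℝ :=
  open Classical in if h : (k : ℕ∞) ≤ K then coeffSum a ⟨k, h⟩ else 0

theorem coeffSumNat_of_le (a : Coeff N K) {k : ℕ} (h : (k : ℕ∞) ≤ K) :
    coeffSumNat a k = coeffSum a ⟨k, h⟩ := dif_pos h

theorem coeffSumNat_coe (a : Coeff N K) (k : Deg K) : coeffSumNat a k.1 = coeffSum a k :=
  coeffSumNat_of_le a k.2

theorem coeffSumNat_of_not_le (a : Coeff N K) {k : ℕ} (h : ¬ (k : ℕ∞) ≤ K) :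
    coeffSumNat a k = 0 := dif_neg h

theorem coeffSumNat_nonneg (a : Coeff N K) (k : ℕ) : 0 ≤ coeffSumNat a k := by
  by_cases h : (k : ℕ∞) ≤ K
  · rw [coeffSumNat_of_le a h]; exact coeffSum_nonneg a _
  · rw [coeffSumNat_of_not_le a h]

/-- A lower bound for the contribution of a pair of degrees to the Monte Carlo variance. -/
def pairBound (b : ℝ) (a : Coeff N K) (p : ℕ × ℕ) : ℝ :=
  coeffSumNat a p.1 * coeffSumNat a p.2 *
    (b ^ (2 * (p.1 + p.2)) * (matchings (p.1 + p.2) ^ 2 - (matchings p.1 * matchings p.2) ^ 2))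

theorem pairBound_nonneg {b : ℝ} (hb : 0 ≤ b) (a : Coeff N K) (p : ℕ × ℕ) :
    0 ≤ pairBound b a p :=
  mul_nonneg (mul_nonneg (coeffSumNat_nonneg _ _) (coeffSumNat_nonneg _ _))
    (mul_nonneg (by positivity) (matchings_sub_nonneg rfl))

/-- The lower bound for the hafnian difference depends on `I` and `J` only through their degrees, so
the double sum of coefficients factorises. -/
theorem pairBound_le {B : Matrix (Fin N) (Fin N) ℝ} {b : ℝ} (hb : 0 ≤ b) (h : ∀ i j, b ≤ B i j)
    (a : Coeff N K) (k : Deg K × Deg K) :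
    pairBound b a (k.1.1, k.2.1) ≤
      (∑ I : MIdx N k.1.1, ∑ J : MIdx N k.2.1,
        (a k.1 I : ℝ) * (a k.2 J : ℝ) * haf B (I.1 + J.1) ^ 2) -
      (∑ I : MIdx N k.1.1, (a k.1 I : ℝ) * haf B I.1 ^ 2) *
        ∑ J : MIdx N k.2.1, (a k.2 J : ℝ) * haf B J.1 ^ 2 := by
  unfold pairBound
  rw [coeffSumNat_coe, coeffSumNat_coe, coeffSum, coeffSum, Finset.sum_mul_sum,
    Finset.sum_mul_sum, Finset.sum_mul, ← Finset.sum_sub_distrib]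
  refine Finset.sum_le_sum fun I _ => ?_
  rw [Finset.sum_mul, ← Finset.sum_sub_distrib]
  refine Finset.sum_le_sum fun J _ => ?_
  have h1 := le_haf_add_sq_sub hb h I.sum_eq J.sum_eq
  have h2 : 0 ≤ (a k.1 I : ℝ) * a k.2 J := by positivity
  calc _ ≤ _ := mul_le_mul_of_nonneg_left h1 h2
    _ = _ := by ring

theorem sum_pairBound_le {B : Matrix (Fin N) (Fin N) ℝ} (hB : ∀ i j, 0 < B i j) {a : Coeff N K}
    (ha : a ∈ coeffSpace K B) (G : Finset (ℕ × ℕ)) :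
    ∑ p ∈ G, pairBound (bmin B) a p ≤ QMC B a - mu B a ^ 2 := by
  have hb := bmin_nonneg hB
  have hinj : Function.Injective fun k : Deg K × Deg K => (k.1.1, k.2.1) := fun k k' h => by
    simp only [Prod.mk.injEq] at h
    exact Prod.ext (Subtype.ext h.1) (Subtype.ext h.2)
  have h1 : mu B a ^ 2 = ∑' k : Deg K × Deg K,
      (∑ I : MIdx N k.1.1, (a k.1 I : ℝ) * haf B I.1 ^ 2) *
        ∑ J : MIdx N k.2.1, (a k.2 J : ℝ) * haf B J.1 ^ 2 := by
    rw [sq]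
    exact tsum_mul_tsum_of_summable_norm ha.1.norm ha.1.norm
  have h2 := summable_mul_of_summable_norm ha.1.norm ha.1.norm
  rw [h1, QMC, ← ha.2.2.2.tsum_sub h2, ← Finset.sum_preimage _ G hinj.injOn]
  · calc _ ≤ ∑ k ∈ G.preimage _ hinj.injOn, _ :=
          Finset.sum_le_sum fun k _ => pairBound_le hb (bmin_le B) a k
      _ ≤ _ := (ha.2.2.2.sub h2).sum_le_tsum _ fun k _ =>
          (pairBound_nonneg hb a _).trans (pairBound_le hb (bmin_le B) a k)
  · intro p _ hp
    unfold pairBound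
    by_cases h1 : (p.1 : ℕ∞) ≤ K
    · by_cases h2 : (p.2 : ℕ∞) ≤ K
      · exact absurd ⟨(⟨p.1, h1⟩, ⟨p.2, h2⟩), rfl⟩ hp
      · rw [coeffSumNat_of_not_le a h2, mul_zero, zero_mul]
    · rw [coeffSumNat_of_not_le a h1, zero_mul, zero_mul]

/-- Pairs containing degree `0` have zero matching difference because `M_0 = 1`. Hence `a_0` plays
no role and the coefficient bounds are used only in degrees at least `1`. -/
theorem le_sum_antidiagonal_pairBound {a : Coeff N K} {b γα γβ qα qβ : ℝ} (hγ : 0 < γα)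
    (ha : CoeffBounds γα γβ qα qβ a) (hb : 0 ≤ b) {k : ℕ} (hk : 1 ≤ k) (hkK : (k : ℕ∞) ≤ K) :
    splitBound qα k * (4 * γα * b ^ 2) ^ k * (((k.centralBinom : ℝ) / 2 - 1) / 4 ^ k) ≤
      ∑ p ∈ Finset.HasAntidiagonal.antidiagonal k, pairBound b a p := by
  have h1 : splitBound qα k * (4 * γα * b ^ 2) ^ k * (((k.centralBinom : ℝ) / 2 - 1) / 4 ^ k) =
      ∑ p ∈ Finset.HasAntidiagonal.antidiagonal k, splitBound qα k * (γα ^ k * b ^ (2 * k)) *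
        ((matchings k ^ 2 - (matchings p.1 * matchings p.2) ^ 2) /
          (((2 * p.1).factorial : ℝ) * (2 * p.2).factorial)) := by
    rw [← Finset.mul_sum, sum_antidiagonal_matchings hk, mul_pow, mul_pow, ← pow_mul]
    field_simp
  rw [h1]
  refine Finset.sum_le_sum fun p hp => ?_
  have hp' := Finset.HasAntidiagonal.mem_antidiagonal.1 hp
  have hT := matchings_sub_nonneg hp'
  rcases Nat.eq_zero_or_pos p.1 with h0 | h0
  · have : p.2 = k := by omega
    rw [h0, this, matchings_zero, one_mul, sub_self, zero_div, mul_zero]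
    exact pairBound_nonneg hb a p
  rcases Nat.eq_zero_or_pos p.2 with h0' | h0'
  · have : p.1 = k := by omega
    rw [h0', this, matchings_zero, mul_one, sub_self, zero_div, mul_zero]
    exact pairBound_nonneg hb a p
  have hle : ∀ {i : ℕ}, i ≤ k → (i : ℕ∞) ≤ K := fun hi =>
    le_trans (by exact_mod_cast hi) hkK
  have hA : ∀ {i : ℕ}, 1 ≤ i → i ≤ k →
      (i : ℝ) ^ qα * γα ^ i / ((2 * i).factorial : ℝ) ≤ coeffSumNat a i := fun hi hik => by
    rw [coeffSumNat_of_le a (hle hik)]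
    exact (ha ⟨_, hle hik⟩ hi).1
  unfold pairBound
  rw [hp']
  have hγk : γα ^ k = γα ^ p.1 * γα ^ p.2 := by rw [← pow_add, hp']
  calc _ ≤ ((p.1 : ℝ) ^ qα * (p.2 : ℝ) ^ qα) * (γα ^ k * b ^ (2 * k)) *
        ((matchings k ^ 2 - (matchings p.1 * matchings p.2) ^ 2) /
          (((2 * p.1).factorial : ℝ) * (2 * p.2).factorial)) := by
        have := splitBound_le (q := qα) hp' h0 h0'
        gcongr
    _ = ((p.1 : ℝ) ^ qα * γα ^ p.1 / ((2 * p.1).factorial : ℝ)) *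
        ((p.2 : ℝ) ^ qα * γα ^ p.2 / ((2 * p.2).factorial : ℝ)) *
        (b ^ (2 * k) * (matchings k ^ 2 - (matchings p.1 * matchings p.2) ^ 2)) := by
        rw [hγk]
        field_simp
    _ ≤ _ := by
        refine mul_le_mul_of_nonneg_right ?_ (mul_nonneg (by positivity) hT)
        exact mul_le_mul (hA h0 (by omega)) (hA h0' (by omega)) (by positivity)
          (coeffSumNat_nonneg _ _)

/-- The sequence `C(2k,k) √k/4^k` increases, and its value at `k = 4` is `35/64`. -/
theorem centralBinom_lower {k : ℕ} (hk : 4 ≤ k) :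
    35 / 64 * 4 ^ k ≤ (k.centralBinom : ℝ) * √k := by
  induction k, hk using Nat.le_induction with
  | base =>
    have h1 : Nat.centralBinom 4 = 70 := by decide
    have h2 : √((4 : ℕ) : ℝ) = 2 := by
      rw [show ((4 : ℕ) : ℝ) = 2 ^ 2 by norm_num]; exact Real.sqrt_sq (by norm_num)
    rw [h1, h2]; norm_num
  | succ k hk ih =>
    have hk0 : (0 : ℝ) < k := by exact_mod_cast (by omega : 0 < k)
    have h1 : ((k : ℝ) + 1) * ((k + 1).centralBinom : ℝ) = 2 * (2 * k + 1) * k.centralBinom := by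
      exact_mod_cast Nat.succ_mul_centralBinom_succ k
    have h2 : √((k + 1 : ℕ) : ℝ) * √((k + 1 : ℕ) : ℝ) = k + 1 := by
      rw [Real.mul_self_sqrt (by positivity)]; push_cast; ring
    have h3 : 4 * (√(k : ℝ) * √((k + 1 : ℕ) : ℝ)) ≤ 2 * (2 * k + 1) := by
      have := Real.sq_sqrt hk0.le
      nlinarith [sq_nonneg (√(k : ℝ) - √((k + 1 : ℕ) : ℝ))]
    have h4 : 0 < √((k + 1 : ℕ) : ℝ) := by positivity
    have h5 : 4 * (k.centralBinom * √(k : ℝ)) ≤ ((k + 1).centralBinom : ℝ) * √((k + 1 : ℕ) : ℝ) := by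
      refine le_of_mul_le_mul_right ?_ h4
      calc 4 * (k.centralBinom * √(k : ℝ)) * √((k + 1 : ℕ) : ℝ)
          = k.centralBinom * (4 * (√(k : ℝ) * √((k + 1 : ℕ) : ℝ))) := by ring
        _ ≤ k.centralBinom * (2 * (2 * k + 1)) := by gcongr
        _ = ((k : ℝ) + 1) * ((k + 1).centralBinom : ℝ) := by rw [h1]; ring
        _ = _ := by rw [← h2]; ring
    rw [pow_succ]
    linarith

theorem sqrt_le_four_pow {k : ℕ} (hk : 4 ≤ k) : 2 * √(k : ℝ) ≤ 1 / 64 * 4 ^ k := by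
  have h1 : ∀ k : ℕ, 4 ≤ k → 128 * k ≤ 2 * 4 ^ k := fun k hk => by
    induction k, hk using Nat.le_induction with
    | base => norm_num
    | succ k hk ih => rw [pow_succ]; omega
  have h2 : (128 : ℝ) * k ≤ 2 * 4 ^ k := by exact_mod_cast h1 k hk
  have h3 : √(k : ℝ) ≤ k / 2 := by
    refine Real.sqrt_le_iff.2 ⟨by positivity, ?_⟩
    have : (4 : ℝ) ≤ k := by exact_mod_cast hk
    nlinarith
  linarith

/-- Half of `35/64` is `35/128`, and the subtracted `4^{-k}` costs at most `1/(128 √k)`, leaving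
`34/128 = 17/64`. -/
theorem variance_coeff_lower {k : ℕ} (hk : 4 ≤ k) :
    17 / 64 / √(k : ℝ) ≤ ((k.centralBinom : ℝ) / 2 - 1) / 4 ^ k := by
  have hk0 : (0 : ℝ) < k := by exact_mod_cast (by omega : 0 < k)
  have h1 := centralBinom_lower hk
  have h2 := sqrt_le_four_pow hk
  rw [div_le_div_iff₀ (by positivity) (by positivity)]
  linarith

/-- The terms of the series defining `R_{q,K}`, without the constant. -/
def rTerm (q w : ℝ) (k : ℕ) : ℝ := splitBound q k * w ^ k / √(k : ℝ)

theorem rTerm_nonneg (q : ℝ) {w : ℝ} (hw : 0 ≤ w) (k : ℕ) : 0 ≤ rTerm q w k :=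
  div_nonneg (mul_nonneg (splitBound_nonneg q k) (by positivity)) (by positivity)

theorem sum_rTerm_le_variance {B : Matrix (Fin N) (Fin N) ℝ} (hB : ∀ i j, 0 < B i j)
    {a : Coeff N K} (haB : a ∈ coeffSpace K B) {γα γβ qα qβ : ℝ} (hγ : 0 < γα)
    (ha : CoeffBounds γα γβ qα qβ a) {M : ℕ} (hM : (M : ℕ∞) ≤ K) :
    17 / 64 * ∑ k ∈ Finset.Icc 4 M, rTerm qα (4 * γα * bmin B ^ 2) k ≤ QMC B a - mu B a ^ 2 := by
  have hb := bmin_nonneg hB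
  refine le_trans ?_ (sum_pairBound_le hB haB
    ((Finset.Icc 4 M).biUnion fun k => Finset.HasAntidiagonal.antidiagonal k))
  rw [Finset.sum_biUnion, Finset.mul_sum]
  · refine Finset.sum_le_sum fun k hk => ?_
    rw [Finset.mem_Icc] at hk
    refine le_trans ?_ (le_sum_antidiagonal_pairBound hγ ha hb (by omega)
      (le_trans (by exact_mod_cast hk.2) hM))
    have h1 := variance_coeff_lower hk.1
    have h2 : 0 ≤ splitBound qα k * (4 * γα * bmin B ^ 2) ^ k :=
      mul_nonneg (splitBound_nonneg _ _) (by positivity)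
    calc _ = splitBound qα k * (4 * γα * bmin B ^ 2) ^ k * (17 / 64 / √(k : ℝ)) := by
          unfold rTerm; ring
      _ ≤ _ := mul_le_mul_of_nonneg_left h1 h2
  · intro k _ k' _ hkk
    refine Finset.disjoint_left.2 fun p hp hp' => hkk ?_
    rw [Finset.HasAntidiagonal.mem_antidiagonal] at hp hp'
    exact hp.symm.trans hp'

end LowerBound

/-! ### The exponential lower bound -/

/-- The case distinction in `R` is exactly that of `splitBound`, so `R` becomes one series with the
terms met in the variance bound. -/
theorem RFun_eq (q : ℝ) (K : ℕ∞) (w : ℝ) :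
    RFun q K w = 1 / (2 * √Real.pi) *
      ∑' k : ℕ, if 1 ≤ k ∧ (k : ℕ∞) ≤ K then rTerm q w k else 0 := by
  unfold RFun polyLog
  split_ifs with hq
  · rw [mul_comm ((2 : ℝ) ^ (-q)), mul_assoc, ← tsum_mul_left]
    congr 2
    ext k
    rw [mul_ite, mul_zero]
    refine ite_congr rfl (fun hk => ?_) fun _ => rfl
    have hk0 : (0 : ℝ) < k := by exact_mod_cast hk.1
    rw [rTerm, splitBound, if_pos hq, Real.rpow_sub hk0, ← Real.sqrt_eq_rpow,
      Real.div_rpow hk0.le (by norm_num), Real.rpow_neg (by norm_num)]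
    have h1 : 0 < (k : ℝ) ^ q := by positivity
    have h2 : 0 < (2 : ℝ) ^ q := by positivity
    have h3 : 0 < √(k : ℝ) := by positivity
    field_simp
  · congr 2
    ext k
    refine ite_congr rfl (fun hk => ?_) fun _ => rfl
    have hk0 : (0 : ℝ) < k := by exact_mod_cast hk.1
    rw [rTerm, splitBound, if_neg hq, Real.rpow_sub hk0, ← Real.sqrt_eq_rpow]
    have h1 : 0 < (k : ℝ) ^ (2 * q) := by positivity
    have h3 : 0 < √(k : ℝ) := by positivity
    field_simp

theorem exists_sum_rTerm_gt {q w Y : ℝ} (hw : 0 ≤ w) (hY : 0 < Y) {K : ℕ∞}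
    (hK : (4 : ℕ∞) ≤ K) (h : RFun q K w > 1 / (2 * √Real.pi) * Y) :
    ∃ M : ℕ, 4 ≤ M ∧ (M : ℕ∞) ≤ K ∧ Y < ∑ k ∈ Finset.Icc 1 M, rTerm q w k := by
  rw [RFun_eq] at h
  have h1 := lt_of_mul_lt_mul_left h (by positivity)
  have hs : Summable fun k : ℕ => if 1 ≤ k ∧ (k : ℕ∞) ≤ K then rTerm q w k else 0 := by
    -- A divergent sum has the value `0`, so the strict lower bound itself forces convergence.
    by_contra hs
    rw [tsum_eq_zero_of_not_summable hs] at h1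
    exact absurd h1 hY.not_gt
  obtain ⟨M, hM⟩ := (hs.hasSum.tendsto_sum_nat.eventually (lt_mem_nhds h1)).exists
  have hnn : ∀ k, 0 ≤ rTerm q w k := rTerm_nonneg q hw
  have key : ∀ M' : ℕ, (∀ k < M, 1 ≤ k ∧ (k : ℕ∞) ≤ K → k ≤ M') →
      Y < ∑ k ∈ Finset.Icc 1 M', rTerm q w k := fun M' hM' => by
    refine hM.trans_le ?_
    rw [← Finset.sum_filter]
    refine Finset.sum_le_sum_of_subset_of_nonneg (fun k hk => ?_) fun k _ _ => hnn k
    rw [Finset.mem_filter, Finset.mem_range] at hk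
    exact Finset.mem_Icc.2 ⟨hk.2.1, hM' k hk.1 hk.2⟩
  induction K using ENat.recTopCoe with
  | coe n =>
    exact ⟨n, by exact_mod_cast hK, le_rfl, key n fun k _ hk => by exact_mod_cast hk.2⟩
  | top => exact ⟨M + 4, by omega, le_top, key _ fun k hk _ => by omega⟩

theorem splitBound_le_two_rpow (q : ℝ) {k : ℕ} (hk : 1 ≤ k) (hk3 : k ≤ 3) :
    splitBound q k ≤ 16 ^ |q| := by
  have h1 : (1 : ℝ) ≤ k := by exact_mod_cast hk
  have h3 : (k : ℝ) ≤ 3 := by exact_mod_cast hk3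
  unfold splitBound
  split_ifs with hq
  · rw [abs_of_nonneg hq]
    exact Real.rpow_le_rpow (by positivity) (by linarith) hq
  · exact (Real.rpow_le_one_of_one_le_of_nonpos h1 (by linarith)).trans
      (Real.one_le_rpow (by norm_num) (abs_nonneg q))

/-- For negative `q` this is an equality, since `4^{2q} = 16^{-|q|}`; this explains the base `16`.
-/
theorem one_le_splitBound_four (q : ℝ) : 1 ≤ 16 ^ |q| * splitBound q 4 := by
  unfold splitBound
  split_ifs with hq
  · have h1 : (1 : ℝ) ≤ 16 ^ |q| := Real.one_le_rpow (by norm_num) (abs_nonneg q)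
    have h2 : (1 : ℝ) ≤ (((4 : ℕ) : ℝ) / 2) ^ q := Real.one_le_rpow (by norm_num) hq
    nlinarith
  · rw [abs_of_neg (not_le.1 hq), Real.rpow_mul (by norm_num)]
    norm_num
    rw [← Real.rpow_add (by norm_num)]
    simp

/-- Up to a small loss, the first three terms of `R` may be omitted. -/
theorem exists_sum_rTerm_ge {q w Y : ℝ} (hw : 0 ≤ w) (hY : 50000000 * (16 ^ |q|) ^ 7 ≤ Y)
    {K : ℕ∞} (hK : (4 : ℕ∞) ≤ K) (h : RFun q K w > 1 / (2 * √Real.pi) * Y) :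
    ∃ M : ℕ, (M : ℕ∞) ≤ K ∧ 94 / 100 * Y ≤ ∑ k ∈ Finset.Icc 4 M, rTerm q w k := by
  set P : ℝ := 16 ^ |q| with hP
  have hP1 : 1 ≤ P := Real.one_le_rpow (by norm_num) (abs_nonneg q)
  have hY0 : 0 < Y := lt_of_lt_of_le (by positivity) hY
  -- For large `w` the fourth term alone is at least `Y`. Otherwise `w` is at most `W =
  -- (2PY)^{1/4}`, which makes the first three terms of order `Y^{3/4}`.
  by_cases hcase : 2 * P * Y ≤ w ^ 4
  · refine ⟨4, hK, ?_⟩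
    rw [Finset.Icc_self, Finset.sum_singleton, rTerm]
    have h2 : √((4 : ℕ) : ℝ) = 2 := by
      rw [show ((4 : ℕ) : ℝ) = 2 ^ 2 by norm_num]; exact Real.sqrt_sq (by norm_num)
    rw [h2, le_div_iff₀ (by norm_num)]
    have h1 := one_le_splitBound_four q
    have h3 := splitBound_nonneg q 4
    calc 94 / 100 * Y * 2 ≤ 2 * Y * 1 := by linarith
      _ ≤ 2 * Y * (P * splitBound q 4) := by gcongr
      _ = splitBound q 4 * (2 * P * Y) := by ring
      _ ≤ _ := by gcongr
  · obtain ⟨M, hM4, hMK, hM⟩ := exists_sum_rTerm_gt hw hY0 hK h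
    refine ⟨M, hMK, ?_⟩
    rw [not_le] at hcase
    set W := (2 * P * Y) ^ (1 / 4 : ℝ) with hW
    have hPY : 1 ≤ 2 * P * Y := by
      have : (1 : ℝ) ≤ P ^ 7 := one_le_pow₀ hP1
      nlinarith
    have hW1 : 1 ≤ W := Real.one_le_rpow hPY (by norm_num)
    have hW4 : W ^ 4 = 2 * P * Y := by
      rw [hW, ← Real.rpow_natCast, ← Real.rpow_mul (by linarith)]; norm_num
    have hwW : w ≤ W := by
      refine le_of_lt (lt_of_pow_lt_pow_left₀ 4 (by linarith) ?_)
      rw [hW4]; exact hcase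
    -- The hypothesis on `Y` gives `W⁴ = 2PY ≥ 10⁸ P⁸`; the constant `50000000` and the exponent `7`
    -- are chosen for this.
    have hWP : 100 * P ^ 2 ≤ W := by
      refine le_of_pow_le_pow_left₀ (n := 4) (by norm_num) (by linarith) ?_
      rw [hW4]
      nlinarith
    have hterm : ∀ k : ℕ, 1 ≤ k → k ≤ 3 → rTerm q w k ≤ P * W ^ 3 := fun k h1 h3 => by
      have hk1 : (1 : ℝ) ≤ k := by exact_mod_cast h1
      unfold rTerm
      refine (div_le_self (mul_nonneg (splitBound_nonneg _ _) (by positivity)) ?_).trans ?_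
      · rw [Real.one_le_sqrt]; exact hk1
      · refine mul_le_mul (splitBound_le_two_rpow q h1 h3) ?_ (by positivity) (by positivity)
        exact (pow_le_pow_left₀ hw hwW k).trans (pow_le_pow_right₀ hW1 h3)
    have hsplit : ∑ k ∈ Finset.Icc 1 M, rTerm q w k =
        ∑ k ∈ Finset.Icc 1 3, rTerm q w k + ∑ k ∈ Finset.Icc 4 M, rTerm q w k := by
      rw [← Finset.sum_union]
      · congr 1
        ext k
        simp only [Finset.mem_union, Finset.mem_Icc]
        omega
      · refine Finset.disjoint_left.2 fun k hk hk' => ?_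
        rw [Finset.mem_Icc] at hk hk'
        omega
    have hfirst : ∑ k ∈ Finset.Icc 1 3, rTerm q w k ≤ 3 * (P * W ^ 3) := by
      have := Finset.sum_le_card_nsmul (Finset.Icc 1 3) (rTerm q w) (P * W ^ 3) fun k hk => by
        rw [Finset.mem_Icc] at hk; exact hterm k hk.1 hk.2
      simpa using this
    -- Indeed `P W³ = P W⁴/W ≤ 2P²Y/(100P²) = Y/50`.
    have hsmall : 3 * (P * W ^ 3) ≤ 6 / 100 * Y := by
      have h5 : W ^ 3 * (100 * P ^ 2) ≤ 2 * P * Y := by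
        rw [← hW4, pow_succ W 3]; gcongr
      have h6 : 50 * (P * W ^ 3) ≤ Y := by
        have hP0 : 0 < P := by linarith
        refine le_of_mul_le_mul_right ?_ (show 0 < 2 * P by linarith)
        linarith
      linarith
    linarith

theorem lower_const : Real.exp (1 / 25 - 1 / 6) / (2 * √Real.pi) ≤ 17 / 64 * (94 / 100) := by
  have h1 : (1772 / 1000 : ℝ) ≤ √Real.pi := by
    refine Real.le_sqrt_of_sq_le ?_
    have := Real.pi_gt_d4
    norm_num at this ⊢
    linarith
  -- Here `19/150 = 1/6 - 1/25`, so the quadratic bound for the exponential yields an upper bound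
  -- for its reciprocal.
  have h2 := Real.quadratic_le_exp_of_nonneg (x := 19 / 150) (by norm_num)
  have h3 : Real.exp (1 / 25 - 1 / 6) * Real.exp (19 / 150) = 1 := by
    rw [← Real.exp_add]; norm_num
  have h4 : Real.exp (1 / 25 - 1 / 6) ≤ 0.882 := by
    have := Real.exp_pos (1 / 25 - 1 / 6)
    nlinarith
  rw [div_le_iff₀ (by positivity)]
  linarith

/-! ### Growth of the main term along a dominating sequence. -/

section Asymptotics

variable {ζ CR : ℝ} {qα : ℕ → ℝ}

/-- The main term of the lower bound. -/
def mainTerm (ζ CR q : ℝ) (N : ℕ) : ℝ :=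
  (ζ * (N : ℝ) ^ 2) ^ (2 * q - 1 / 2) * CR ^ (ζ * (N : ℝ) ^ 2)

theorem log_mainTerm {q : ℝ} {N : ℕ} (hζ : 0 < ζ) (hCR : 1 < CR) (hN : 1 ≤ N) :
    Real.log (1 / (2 * √Real.pi) * (ζ * (N : ℝ) ^ 2) ^ (2 * q - 1 / 2) *
        CR ^ (ζ * (N : ℝ) ^ 2)) = -Real.log (2 * √Real.pi) +
        (2 * q - 1 / 2) * Real.log (ζ * (N : ℝ) ^ 2) + ζ * (N : ℝ) ^ 2 * Real.log CR := by
  have hN' : (0 : ℝ) < N := by exact_mod_cast hN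
  have h1 : 0 < ζ * (N : ℝ) ^ 2 := by positivity
  rw [Real.log_mul (by positivity) (by positivity), Real.log_mul (by positivity) (by positivity),
    Real.log_rpow h1, Real.log_rpow (by linarith), one_div, Real.log_inv]

/-- The logarithmic quotient minus `1` is this expression divided by `ζN² log C_R`. -/
theorem Dominates.eventually_abs_le (h : Dominates ζ CR qα) (hζ : 0 < ζ) (hCR : 1 < CR)
    {η : ℝ} (hη : 0 < η) : ∀ᶠ N : ℕ in atTop, |-Real.log (2 * √Real.pi) +
        (2 * qα N - 1 / 2) * Real.log (ζ * (N : ℝ) ^ 2)| ≤ η * (ζ * (N : ℝ) ^ 2 * Real.log CR) := by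
  have hL := Real.log_pos hCR
  filter_upwards [(Metric.tendsto_nhds.1 h) η hη, eventually_ge_atTop 1] with N hN hN1
  have hN' : (0 : ℝ) < N := by exact_mod_cast hN1
  have h1 : 0 < ζ * (N : ℝ) ^ 2 * Real.log CR := by positivity
  rw [log_mainTerm hζ hCR hN1, Real.log_rpow (by linarith), Real.dist_eq, add_div, div_self h1.ne',
    add_sub_cancel_right, abs_div, abs_of_pos h1, div_lt_iff₀ h1] at hN
  exact hN.le

theorem tendsto_zeta_mul_sq (hζ : 0 < ζ) :
    Tendsto (fun N : ℕ => ζ * (N : ℝ) ^ 2) atTop atTop :=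
  ((tendsto_pow_atTop two_ne_zero).comp tendsto_natCast_atTop_atTop).const_mul_atTop hζ

/-- Although `q_α(N)` may be unbounded, domination forces `|q_α(N)| = o(N²)`, so any fixed power of
`16^{|q_α|}` is subexponential in `N²`. -/
theorem Dominates.eventually_le_mainTerm (h : Dominates ζ CR qα) (hζ : 0 < ζ) (hCR : 1 < CR) :
    ∀ᶠ N : ℕ in atTop, 50000000 * ((16 : ℝ) ^ |qα N|) ^ 7 ≤ mainTerm ζ CR (qα N) N := by
  have hL := Real.log_pos hCR
  have h16 : 0 < Real.log 16 := Real.log_pos (by norm_num)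
  -- The losses from the main term, from `16^{7|q_α|}` and from the constants are each at most a
  -- quarter of `ζN² log C_R`.
  obtain ⟨η, hη, hη2, hη3⟩ : ∃ η : ℝ, 0 < η ∧ η ≤ 1 / 4 ∧ 7 * Real.log 16 * η ≤ 1 / 4 := by
    refine ⟨min (1 / 4) (1 / 4 / (7 * Real.log 16)), by positivity, min_le_left _ _, ?_⟩
    calc _ ≤ 7 * Real.log 16 * (1 / 4 / (7 * Real.log 16)) := by gcongr; exact min_le_right _ _
      _ = _ := by field_simp
  have ht := tendsto_zeta_mul_sq hζ
  have hc1 : 0 ≤ Real.log (2 * √Real.pi) := Real.log_nonneg (by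
    have : 1 ≤ √Real.pi := Real.one_le_sqrt.2 (by linarith [Real.pi_gt_three])
    linarith)
  have hlog2 : 0 ≤ Real.log 50000000 := Real.log_nonneg (by norm_num)
  filter_upwards [h.eventually_abs_le hζ hCR hη, eventually_ge_atTop 1,
    (Real.tendsto_log_atTop.comp ht).eventually_ge_atTop 1,
    ht.eventually_ge_atTop (4 * (Real.log 50000000 + 7 * Real.log 16 *
      (Real.log (2 * √Real.pi) + 1)) / Real.log CR)]
    with N hN hN1 hlog hbig
  simp only [Function.comp_apply] at hlog
  have hN' : (0 : ℝ) < N := by exact_mod_cast hN1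
  have h1 : 0 < ζ * (N : ℝ) ^ 2 := by positivity
  rw [div_le_iff₀ hL] at hbig
  set X := ζ * (N : ℝ) ^ 2 with hX
  set c := Real.log (2 * √Real.pi) with hc
  have hX0 : 0 ≤ η * (X * Real.log CR) := by positivity
  obtain ⟨hlo, hhi⟩ := abs_le.1 hN
  have hq : |qα N| ≤ η * (X * Real.log CR) + c + 1 := by
    have h2 : |(2 * qα N - 1 / 2) * Real.log X| ≤ η * (X * Real.log CR) + c := by
      rw [abs_le]; constructor <;> linarith
    have h3 : |2 * qα N - 1 / 2| ≤ η * (X * Real.log CR) + c := by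
      rw [abs_mul, abs_of_pos (by linarith : 0 < Real.log X)] at h2
      nlinarith [abs_nonneg (2 * qα N - 1 / 2)]
    obtain ⟨h4, h5⟩ := abs_le.1 h3
    rw [abs_le]; constructor <;> linarith
  have hpos : 0 < mainTerm ζ CR (qα N) N := by unfold mainTerm; positivity
  rw [← Real.log_le_log_iff (by positivity) hpos, Real.log_mul (by norm_num) (by positivity),
    Real.log_pow, Real.log_rpow (by norm_num), mainTerm, Real.log_mul (by positivity)
    (by positivity), Real.log_rpow h1, Real.log_rpow (by linarith)]
  rw [← hX]
  push_cast
  have h7 : 7 * (|qα N| * Real.log 16) ≤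
      7 * Real.log 16 * η * (X * Real.log CR) + 7 * Real.log 16 * (c + 1) := by
    calc _ = 7 * Real.log 16 * |qα N| := by ring
      _ ≤ 7 * Real.log 16 * (η * (X * Real.log CR) + c + 1) := by gcongr
      _ = _ := by ring
  have h8 : 7 * Real.log 16 * η * (X * Real.log CR) ≤ 1 / 4 * (X * Real.log CR) := by gcongr
  have h9 : η * (X * Real.log CR) ≤ 1 / 4 * (X * Real.log CR) := by gcongr
  linarith

theorem four_le_of_le {K : ℕ∞} {y : ℝ} (hy : 4 ≤ y) (h : ENNReal.ofReal y ≤ (K : ℝ≥0∞)) :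
    (4 : ℕ∞) ≤ K := by
  have h1 : ENNReal.ofReal 4 ≤ (K : ℝ≥0∞) := (ENNReal.ofReal_le_ofReal hy).trans h
  have h2 : ((4 : ℕ∞) : ℝ≥0∞) ≤ (K : ℝ≥0∞) := by
    convert h1 using 1
    simp
  exact_mod_cast h2

theorem Dominates.exists_nMC_gt (h : Dominates ζ CR qα) (hζ : 0 < ζ) (hCR : 1 < CR) :
    ∃ N₁ : ℕ, ∀ (N : ℕ) (K : ℕ∞) (p γα γβ qβ CG CD ε δ : ℝ),
      N₁ ≤ N → ENNReal.ofReal (ζ * (N : ℝ) ^ 2) ≤ (K : ℝ≥0∞) → 0 < γα → 0 < γβ → 0 < ε → 0 < δ →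
      ∀ x : Coeff N K × Matrix (Fin N) (Fin N) ℝ,
        Admissible ζ p γα γβ (qα N) qβ CG CD CR x →
        nMC x.2 x.1 ε δ > 1 / (ε ^ 2 * δ) *
          ((Real.exp (1 / 25 - 1 / 6) / (2 * √Real.pi) *
              (ζ * (N : ℝ) ^ 2) ^ (2 * qα N - 1 / 2) * CR ^ (ζ * (N : ℝ) ^ 2)) /
            (CD * (N : ℝ) ^ p * (coeffZero x.1 ^ 2 + 1 / √Real.pi * CG * (N : ℝ) ^ 3))) := by
  obtain ⟨N₁, hN₁⟩ := eventually_atTop.1 ((h.eventually_le_mainTerm hζ hCR).and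
    ((eventually_ge_atTop 1).and ((tendsto_zeta_mul_sq hζ).eventually_ge_atTop 4)))
  refine ⟨N₁, fun N K p γα γβ qβ CG CD ε δ hN hK hγα hγβ hε hδ x hx => ?_⟩
  obtain ⟨hmain, hN1, hN4⟩ := hN₁ N hN
  have hB := hx.1.1
  have hQ := hx.QGBS_lt hN1 hγβ
  have hmuQ := mu_sq_le_QGBS hB hx.1.2
  have hmu : 0 < mu x.2 x.1 := hx.coeffZero_pos.trans_le (coeffZero_le_mu hx.1.2.1)
  have hw : 0 ≤ 4 * γα * bmin x.2 ^ 2 := by positivity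
  have hR : RFun (qα N) K (4 * γα * bmin x.2 ^ 2) >
      1 / (2 * √Real.pi) * mainTerm ζ CR (qα N) N := by
    have := hx.2.1.2.2.2.1
    rwa [mul_assoc (1 / (2 * √Real.pi))] at this
  obtain ⟨M, hMK, hM⟩ := exists_sum_rTerm_ge hw hmain (four_le_of_le hN4 hK) hR
  have hvar := sum_rTerm_le_variance hB.1 hx.1.2 hγα hx.2.2.1 hMK
  have hY : 0 < mainTerm ζ CR (qα N) N := lt_of_lt_of_le (by positivity) hmain
  rw [mul_assoc (Real.exp (1 / 25 - 1 / 6) / (2 * √Real.pi))]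
  change _ < _
  rw [show (ζ * (N : ℝ) ^ 2) ^ (2 * qα N - 1 / 2) * CR ^ (ζ * (N : ℝ) ^ 2) =
    mainTerm ζ CR (qα N) N from rfl]
  set D := CD * (N : ℝ) ^ p * (coeffZero x.1 ^ 2 + 1 / √Real.pi * CG * (N : ℝ) ^ 3) with hD
  set c := Real.exp (1 / 25 - 1 / 6) / (2 * √Real.pi) with hc
  set Y := mainTerm ζ CR (qα N) N with hYdef
  have hc0 : 0 < c := by positivity
  have hcY : c * Y ≤ QMC x.2 x.1 - mu x.2 x.1 ^ 2 := by
    refine le_trans ?_ hvar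
    calc c * Y ≤ 17 / 64 * (94 / 100) * Y := mul_le_mul_of_nonneg_right lower_const hY.le
      _ = 17 / 64 * (94 / 100 * Y) := by ring
      _ ≤ _ := by gcongr
  -- The upper bound for the importance estimator is reused to bound the denominator `μ²`.
  have hmuD : mu x.2 x.1 ^ 2 < D := hmuQ.trans_lt hQ
  have hmu2 : 0 < mu x.2 x.1 ^ 2 := by positivity
  calc 1 / (ε ^ 2 * δ) * (c * Y / D) < 1 / (ε ^ 2 * δ) * (c * Y / mu x.2 x.1 ^ 2) := by
        refine mul_lt_mul_of_pos_left ?_ (by positivity)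
        exact div_lt_div_of_pos_left (by positivity) hmu2 hmuD
    _ ≤ 1 / (ε ^ 2 * δ) * ((QMC x.2 x.1 - mu x.2 x.1 ^ 2) / mu x.2 x.1 ^ 2) := by gcongr
    _ = nMC x.2 x.1 ε δ := by
        unfold nMC
        field_simp

end Asymptotics

/-! ### The rates -/

section Rates

variable {ζ CR : ℝ} {qα : ℕ → ℝ}

/-- The gap `log C_R - log C` times `ζN²` pays with one half for the power of `ζN²` in the main term
and with the other for `N^{3+p}`. -/
theorem Dominates.eventually_rate (h : Dominates ζ CR qα) (hζ : 0 < ζ) (hCR : 1 < CR) {C : ℝ}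
    (hC : 1 < C) (hCCR : C < CR) (p : ℝ) :
    ∀ᶠ N : ℕ in atTop, (N : ℝ) ^ (3 + p) * C ^ (ζ * (N : ℝ) ^ 2) ≤ mainTerm ζ CR (qα N) N := by
  have hL := Real.log_pos hCR
  have hκ : 0 < Real.log CR - Real.log C := sub_pos.2 (Real.log_lt_log (by linarith) hCCR)
  have hc1 : 0 ≤ Real.log (2 * √Real.pi) := Real.log_nonneg (by
    have : 1 ≤ √Real.pi := Real.one_le_sqrt.2 (by linarith [Real.pi_gt_three])
    linarith)
  have ht : Tendsto (fun N : ℕ => (N : ℝ)) atTop atTop := tendsto_natCast_atTop_atTop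
  filter_upwards [h.eventually_abs_le hζ hCR
    (show 0 < (Real.log CR - Real.log C) / (2 * Real.log CR) by positivity),
    eventually_ge_atTop 1,
    ht.eventually_ge_atTop (2 * |3 + p| / (ζ * (Real.log CR - Real.log C)))] with N hN hN1 hbig
  have hN' : (1 : ℝ) ≤ N := by exact_mod_cast hN1
  have h1 : 0 < ζ * (N : ℝ) ^ 2 := by positivity
  have hpos : 0 < mainTerm ζ CR (qα N) N := by unfold mainTerm; positivity
  rw [← Real.log_le_log_iff (by positivity) hpos, Real.log_mul (by positivity) (by positivity),
    mainTerm, Real.log_mul (by positivity) (by positivity), Real.log_rpow (by linarith),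
    Real.log_rpow (by linarith), Real.log_rpow h1, Real.log_rpow (by linarith)]
  have h2 := (abs_le.1 hN).1
  have h3 : (Real.log CR - Real.log C) / (2 * Real.log CR) * (ζ * (N : ℝ) ^ 2 * Real.log CR) =
      ζ * (N : ℝ) ^ 2 * (Real.log CR - Real.log C) / 2 := by field_simp
  rw [h3] at h2
  rw [div_le_iff₀ (by positivity)] at hbig
  have h4 : (3 + p) * Real.log N ≤ ζ * (N : ℝ) ^ 2 * (Real.log CR - Real.log C) / 2 := by
    calc (3 + p) * Real.log N ≤ |3 + p| * N := by
          refine mul_le_mul (le_abs_self _) ?_ (Real.log_nonneg hN') (abs_nonneg _)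
          exact (Real.log_le_sub_one_of_pos (by linarith)).trans (by linarith)
      _ ≤ N * (ζ * (Real.log CR - Real.log C)) / 2 * N := by gcongr; linarith
      _ = _ := by ring
  linarith

theorem Dominates.exists_rates (h : Dominates ζ CR qα) {p CG CD a₀ C : ℝ} (hζ : 0 < ζ)
    (hCG : 0 < CG) (hCD : 0 < CD) (hCR : 1 < CR) (ha₀ : 0 < a₀) (hC : 1 < C)
    (hCCR : C < CR) :
    ∃ (c₁ c₂ : ℝ) (N₁ : ℕ), 0 < c₁ ∧ 0 < c₂ ∧
      ∀ (N : ℕ) (K : ℕ∞) (γα γβ qβ ε δ : ℝ),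
        N₁ ≤ N → ENNReal.ofReal (ζ * (N : ℝ) ^ 2) ≤ (K : ℝ≥0∞) →
        0 < γα → 0 < γβ → 0 < ε → ε < 1 → 0 < δ → δ < 1 →
        ∀ x : Coeff N K × Matrix (Fin N) (Fin N) ℝ,
          Admissible ζ p γα γβ (qα N) qβ CG CD CR x → coeffZero x.1 = a₀ →
          nGBS x.2 x.1 ε δ ≤ 1 / (ε ^ 2 * δ) * (c₁ * (N : ℝ) ^ (3 + p)) ∧
          nMC x.2 x.1 ε δ ≥ 1 / (ε ^ 2 * δ) * (c₂ * C ^ (ζ * (N : ℝ) ^ 2)) := by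
  obtain ⟨N₁, hN₁⟩ := h.exists_nMC_gt hζ hCR
  obtain ⟨N₂, hN₂⟩ := eventually_atTop.1 (h.eventually_rate hζ hCR hC hCCR p)
  set c := Real.exp (1 / 25 - 1 / 6) / (2 * √Real.pi) with hc
  have hc0 : 0 < c := by positivity
  refine ⟨CD + CG * CD / (a₀ ^ 2 * √Real.pi), c / (CD * (a₀ ^ 2 + 1 / √Real.pi * CG)),
    max 1 (max N₁ N₂), by positivity, by positivity, ?_⟩
  intro N K γα γβ qβ ε δ hN hK hγα hγβ hε _ hδ _ x hx hxa
  have hN1 : 1 ≤ N := (le_max_left _ _).trans hN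
  have hNN1 : N₁ ≤ N := (le_max_left _ _).trans ((le_max_right _ _).trans hN)
  have hNN2 : N₂ ≤ N := (le_max_right _ _).trans ((le_max_right _ _).trans hN)
  have hN' : (1 : ℝ) ≤ N := by exact_mod_cast hN1
  have h3p : (N : ℝ) ^ (3 + p) = (N : ℝ) ^ 3 * (N : ℝ) ^ p := by
    rw [Real.rpow_add (by linarith)]; norm_cast
  have hN3 : (1 : ℝ) ≤ (N : ℝ) ^ 3 := one_le_pow₀ hN'
  have hNp : (N : ℝ) ^ p ≤ (N : ℝ) ^ (3 + p) :=
    Real.rpow_le_rpow_of_exponent_le hN' (by linarith)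
  constructor
  · refine (hx.nGBS_lt hN1 hγβ hε hδ).le.trans (mul_le_mul_of_nonneg_left ?_ (by positivity))
    rw [hxa]
    have h1 : CD * (N : ℝ) ^ p ≤ CD * (N : ℝ) ^ (3 + p) := by gcongr
    calc _ ≤ CD * (N : ℝ) ^ (3 + p) + CG * CD * (N : ℝ) ^ (3 + p) / (a₀ ^ 2 * √Real.pi) := by
          linarith
      _ = _ := by ring
  · refine (mul_le_mul_of_nonneg_left ?_ (by positivity)).trans
      (hN₁ N K p γα γβ qβ CG CD ε δ hNN1 hK hγα hγβ hε hδ x hx).le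
    rw [hxa, mul_assoc (Real.exp (1 / 25 - 1 / 6) / (2 * √Real.pi))]
    have hD : CD * (N : ℝ) ^ p * (a₀ ^ 2 + 1 / √Real.pi * CG * (N : ℝ) ^ 3) ≤
        CD * (a₀ ^ 2 + 1 / √Real.pi * CG) * (N : ℝ) ^ (3 + p) := by
      have h1 : a₀ ^ 2 + 1 / √Real.pi * CG * (N : ℝ) ^ 3 ≤
          (a₀ ^ 2 + 1 / √Real.pi * CG) * (N : ℝ) ^ 3 := by
        nlinarith [sq_nonneg a₀]
      calc _ ≤ CD * (N : ℝ) ^ p * ((a₀ ^ 2 + 1 / √Real.pi * CG) * (N : ℝ) ^ 3) := by gcongr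
        _ = _ := by rw [h3p]; ring
    have hr := hN₂ N hNN2
    rw [div_mul_eq_mul_div, div_le_div_iff₀ (by positivity) (by positivity)]
    calc _ ≤ c * C ^ (ζ * (N : ℝ) ^ 2) *
          (CD * (a₀ ^ 2 + 1 / √Real.pi * CG) * (N : ℝ) ^ (3 + p)) := by gcongr
      _ = c * ((N : ℝ) ^ (3 + p) * C ^ (ζ * (N : ℝ) ^ 2)) *
          (CD * (a₀ ^ 2 + 1 / √Real.pi * CG)) := by ring
      _ ≤ c * mainTerm ζ CR (qα N) N * (CD * (a₀ ^ 2 + 1 / √Real.pi * CG)) := by gcongr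
      _ = _ := rfl

end Rates

/-! ### Bounds for the problem family -/

theorem one_sub_sum_le_prod {ι : Type*} (s : Finset ι) (f : ι → ℝ) (h0 : ∀ i ∈ s, 0 ≤ f i)
    (h1 : ∀ i ∈ s, f i ≤ 1) : 1 - ∑ i ∈ s, f i ≤ ∏ i ∈ s, (1 - f i) := by
  classical
  induction s using Finset.induction_on with
  | empty => simp
  | insert i s hi ih =>
    rw [Finset.sum_insert hi, Finset.prod_insert hi]
    have h2 := ih (fun j hj => h0 j (Finset.mem_insert_of_mem hj))
      fun j hj => h1 j (Finset.mem_insert_of_mem hj)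
    have h3 := h0 i (Finset.mem_insert_self i s)
    have h4 := h1 i (Finset.mem_insert_self i s)
    have h5 : 0 ≤ ∑ j ∈ s, f j := Finset.sum_nonneg fun j hj => h0 j (Finset.mem_insert_of_mem hj)
    nlinarith [mul_le_mul_of_nonneg_left h2 (sub_nonneg.2 h4)]

/-! ### Spectrum and normalisation constant of concrete matrices. -/

section Matrices

variable {N : ℕ}

/-- The Frobenius norm is orthogonally invariant. It bounds `1/d` by a condition that is visibly
open in the entries. -/
theorem sum_eigenvalues_sq {B : Matrix (Fin N) (Fin N) ℝ} (hB : B.IsHermitian) :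
    ∑ j, hB.eigenvalues j ^ 2 = ∑ i, ∑ j, B i j ^ 2 := by
  obtain ⟨O, h1, h2⟩ := exists_orthogonal hB
  have h3 : ∀ a b, B a b = ∑ c, O a c * O b c * hB.eigenvalues c := fun a b => by
    rw [h1, Fintype.sum_prod_type]
    refine Finset.sum_congr rfl fun c _ => ?_
    rw [Finset.sum_eq_single c]
    · simp
    · intro d _ hd
      simp [Matrix.diagonal_apply_ne' _ hd]
    · simp
  symm
  calc ∑ a, ∑ b, B a b ^ 2 = ∑ a, ∑ b, ∑ c, ∑ d, (O a c * O a d) * (O b c * O b d) *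
        (hB.eigenvalues c * hB.eigenvalues d) := by
        refine Finset.sum_congr rfl fun a _ => Finset.sum_congr rfl fun b _ => ?_
        rw [h3, sq, Finset.sum_mul_sum]
        refine Finset.sum_congr rfl fun c _ => Finset.sum_congr rfl fun d _ => ?_
        ring
    _ = ∑ c, ∑ d, (∑ a, O a c * O a d) * (∑ b, O b c * O b d) *
        (hB.eigenvalues c * hB.eigenvalues d) := by
        simp only [Finset.sum_mul]
        rw [Finset.sum_congr rfl fun a _ => Finset.sum_comm, Finset.sum_comm]
        refine Finset.sum_congr rfl fun c _ => ?_
        rw [Finset.sum_congr rfl fun a _ => Finset.sum_comm, Finset.sum_comm]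
        refine Finset.sum_congr rfl fun d _ => Finset.sum_congr rfl fun i _ => ?_
        rw [Finset.mul_sum, Finset.sum_mul]
    _ = _ := by
        simp only [h2]
        simp [sq]

/-- The product inequality `∏ (1 - λ²) ≥ 1 - ∑ λ² ≥ 1/5` gives `d ≥ 4/9`, because `16/81 < 1/5`. -/
theorem one_div_normConst_lt {B : Matrix (Fin N) (Fin N) ℝ} (hB : B ∈ matrixSpace N)
    (h : ∑ i, ∑ j, B i j ^ 2 < 4 / 5) : 1 / normConst B < 3 := by
  have hH := isHermitian_of_mem hB
  have h1 : (1 / 5 : ℝ) ≤ ∏ j, (1 - hH.eigenvalues j ^ 2) := by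
    refine le_trans ?_ (one_sub_sum_le_prod _ _ (fun j _ => sq_nonneg _) fun j _ => ?_)
    · rw [sum_eigenvalues_sq hH]; linarith
    · have := eigenvalues_mem_Ioo hB j
      nlinarith
  have h2 : (4 / 9 : ℝ) ≤ normConst B := by
    rw [normConst, dif_pos hH, ← Real.sqrt_prod _ fun j _ => ?_]
    · refine Real.le_sqrt_of_sq_le (le_trans (by norm_num) h1)
    · have := eigenvalues_mem_Ioo hB j
      nlinarith
  rw [div_lt_iff₀ (by linarith)]
  linarith

/-- The matrix `x · 1 + y · J`, where all entries of `J` are `1`. -/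
def scalarAddConst (N : ℕ) (x y : ℝ) : Matrix (Fin N) (Fin N) ℝ :=
  Matrix.of fun i j => (if i = j then x else 0) + y

theorem scalarAddConst_mem {x y : ℝ} (hx : 0 < x) (hy : 0 < y) (h : x + N * y < 1) :
    scalarAddConst N x y ∈ matrixSpace N := by
  have hT : (scalarAddConst N x y).transpose = scalarAddConst N x y := by
    ext i j
    simp [scalarAddConst, eq_comm]
  have hH : (scalarAddConst N x y).IsHermitian := by
    rw [Matrix.IsHermitian, Matrix.conjTranspose_eq_transpose_of_trivial, hT]
  refine ⟨fun i j => ?_, hT, fun l hl => ?_⟩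
  · simp only [scalarAddConst, Matrix.of_apply]
    split_ifs <;> linarith
  · rw [hH.spectrum_real_eq_range_eigenvalues] at hl
    obtain ⟨m, rfl⟩ := hl
    have hv := hH.mulVec_eigenvectorBasis m
    have hv0 := hH.eigenvectorBasis.orthonormal.ne_zero m
    set v := hH.eigenvectorBasis m with hvdef
    set l := hH.eigenvalues m with hl
    have h1 : ∀ i, x * v i + y * ∑ j, v j = l * v i := fun i => by
      have := congrFun hv i
      simpa [Matrix.mulVec, dotProduct, scalarAddConst, add_mul, Finset.sum_add_distrib,
        ← Finset.mul_sum] using this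
    have hNy : 0 ≤ (N : ℝ) * y := by positivity
    -- An eigenvector with coordinate sum zero has eigenvalue `x`; otherwise summing the coordinates
    -- gives `x + Ny`.
    by_cases hS : ∑ j, v j = 0
    · obtain ⟨i, hi⟩ : ∃ i, v i ≠ 0 := by
        by_contra hcon
        push Not at hcon
        exact hv0 (by ext i; exact hcon i)
      have h2 := h1 i
      rw [hS, mul_zero, add_zero] at h2
      have : x = l := mul_right_cancel₀ hi h2
      constructor <;> linarith
    · have h2 : (x + N * y) * ∑ j, v j = l * ∑ j, v j := by
        have := Finset.sum_congr (rfl : (Finset.univ : Finset (Fin N)) = Finset.univ)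
          fun i _ => h1 i
        rw [Finset.sum_add_distrib, ← Finset.mul_sum, ← Finset.mul_sum, Finset.sum_const,
          Finset.card_univ, Fintype.card_fin, nsmul_eq_mul, ← Finset.mul_sum] at this
        linarith
      have : x + N * y = l := mul_right_cancel₀ hS h2
      constructor <;> linarith

theorem sum_scalarAddConst_sq (x y : ℝ) :
    ∑ i, ∑ j, scalarAddConst N x y i j ^ 2 = N * (x ^ 2 + 2 * x * y) + (N * y) ^ 2 := by
  have h1 : ∀ i j : Fin N, scalarAddConst N x y i j ^ 2 =
      (if i = j then x ^ 2 + 2 * x * y else 0) + y ^ 2 := fun i j => by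
    simp only [scalarAddConst, Matrix.of_apply]
    split_ifs <;> ring
  simp only [h1, Finset.sum_add_distrib, Finset.sum_ite_eq, Finset.mem_univ, if_true,
    Finset.sum_const, Finset.card_univ, Fintype.card_fin, nsmul_eq_mul]
  ring

theorem bmax_le [NeZero N] {B : Matrix (Fin N) (Fin N) ℝ} {b : ℝ} (h0 : ∀ i j, 0 ≤ B i j)
    (h : ∀ i j, B i j ≤ b) : bmax B ≤ b :=
  ciSup_le fun ij => by rw [abs_of_nonneg (h0 _ _)]; exact h _ _

theorem le_bmin [NeZero N] {B : Matrix (Fin N) (Fin N) ℝ} {b : ℝ} (h : ∀ i j, b ≤ B i j) :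
    b ≤ bmin B := le_ciInf fun _ => h _ _

end Matrices

/-! ### Balanced multi-indices -/

theorem two_mul_eq (N k : ℕ) (hN : 1 ≤ N) :
    2 * k = N * sQuot N k + rRem N k ∧ rRem N k ≤ N := by
  rcases Nat.eq_zero_or_pos k with rfl | hk
  · simp [sQuot, rRem]
  · exact ⟨(sQuot_rRem_spec N k hN hk).1, (sQuot_rRem_spec N k hN hk).2.2⟩

/-- The multi-index of degree `2k` with entries as equal as possible. -/
def balanced (N k : ℕ) : Fin N → ℕ := fun j => sQuot N k + if j.1 < rRem N k then 1 else 0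

theorem card_filter_rRem (N k : ℕ) (hN : 1 ≤ N) :
    (Finset.univ.filter fun j : Fin N => j.1 < rRem N k).card = rRem N k := by
  rw [Fin.card_filter_val_lt, min_eq_right (two_mul_eq N k hN).2]

theorem balanced_mem (N k : ℕ) (hN : 1 ≤ N) :
    balanced N k ∈ Finset.piAntidiag (Finset.univ : Finset (Fin N)) (2 * k) := by
  rw [mem_MIdx_iff]
  simp only [balanced]
  rw [Finset.sum_add_distrib, ← Finset.card_filter, card_filter_rRem N k hN]
  simpa using (two_mul_eq N k hN).1.symm

/-- This is where `m_k` comes from: a family concentrated on balanced multi-indices has `∑ a_I² I! =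
(∑ a_I)² m_k` in degree `k`. -/
theorem multiFactorial_balanced (N k : ℕ) (hN : 1 ≤ N) :
    multiFactorial (balanced N k) = mCoef N k := by
  have h1 : ∀ j : Fin N, ((balanced N k j).factorial : ℝ) = ((sQuot N k).factorial : ℝ) *
      if j.1 < rRem N k then (sQuot N k : ℝ) + 1 else 1 := fun j => by
    unfold balanced
    split_ifs
    · rw [Nat.factorial_succ]; push_cast; ring
    · simp
  unfold multiFactorial mCoef
  simp only [h1]
  rw [Finset.prod_mul_distrib, Finset.prod_ite, Finset.prod_const, Finset.prod_const, Finset.prod_const,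
    card_filter_rRem N k hN]
  simp

/-! ### The functions `G` and `R` for the problem family -/

/-- For `k ≥ 2` the factor `k^{-2N} ≤ 4^{-N}` beats `z^{2k}/(2k)! ≤ e^z ≤ 4^N`. Only `k = 1`
remains, where `z²/2 ≤ N²`. -/
theorem hFun_le {N : ℕ} (hN : 1 ≤ N) {z : ℝ} (hz : 0 ≤ z) (hzN : z ≤ N / 2) :
    hFun (2 * -(N : ℝ)) (N / 2) z ≤ (N : ℝ) ^ 3 := by
  have hN' : (1 : ℝ) ≤ N := by exact_mod_cast hN
  have h1 : ∀ k ∈ Finset.Icc 1 (N / 2), (k : ℝ) ^ (2 * -(N : ℝ)) / ((2 * k).factorial : ℝ) *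
      z ^ (2 * k) ≤ (N : ℝ) ^ 2 := fun k hk => by
    rw [Finset.mem_Icc] at hk
    have hk1 : (1 : ℝ) ≤ k := by exact_mod_cast hk.1
    rcases hk.1.eq_or_lt with rfl | hk2
    · have h3 : ((2 * 1).factorial : ℝ) = 2 := by norm_num [Nat.factorial]
      rw [h3]
      simp only [Nat.cast_one, Real.one_rpow, mul_one]
      nlinarith
    · have h2 : (k : ℝ) ^ (2 * -(N : ℝ)) ≤ (1 / 4) ^ N := by
        calc (k : ℝ) ^ (2 * -(N : ℝ)) ≤ 2 ^ (2 * -(N : ℝ)) :=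
              Real.rpow_le_rpow_of_nonpos (by norm_num) (by exact_mod_cast hk2) (by linarith)
          _ = (1 / 4) ^ N := by
              rw [Real.rpow_mul (by norm_num), Real.rpow_neg (by norm_num), Real.rpow_natCast,
                ← inv_pow]
              norm_num
      have h3 : z ^ (2 * k) / ((2 * k).factorial : ℝ) ≤ 4 ^ N := by
        calc _ ≤ Real.exp z := Real.pow_div_factorial_le_exp z hz _
          _ ≤ Real.exp (N * 1) := Real.exp_le_exp.2 (by linarith)
          _ = Real.exp 1 ^ N := Real.exp_nat_mul 1 N
          _ ≤ 4 ^ N := pow_le_pow_left₀ (Real.exp_pos 1).le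
              (by linarith [Real.exp_one_lt_d9]) N
      calc _ = (k : ℝ) ^ (2 * -(N : ℝ)) * (z ^ (2 * k) / ((2 * k).factorial : ℝ)) := by ring
        _ ≤ (1 / 4) ^ N * 4 ^ N := by gcongr
        _ = 1 := by rw [← mul_pow]; norm_num
        _ ≤ _ := one_le_pow₀ hN'
  have h2 := Finset.sum_le_card_nsmul _ _ _ h1
  rw [Nat.card_Icc, nsmul_eq_mul] at h2
  refine h2.trans ?_
  have h3 : ((N / 2 + 1 - 1 : ℕ) : ℝ) ≤ N := by exact_mod_cast (by omega : N / 2 + 1 - 1 ≤ N)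
  calc _ ≤ (N : ℝ) * (N : ℝ) ^ 2 := by gcongr
    _ = _ := by ring

theorem sum_Icc_half_pow (n : ℕ) : ∑ k ∈ Finset.Icc 1 n, (1 / 2 : ℝ) ^ k = 1 - (1 / 2) ^ n := by
  induction n with
  | zero => simp
  | succ n ih => rw [Finset.sum_Icc_succ_top (by omega), ih, pow_succ]; ring

theorem polyLog_le_one {s : ℝ} (hs : 0 ≤ s) (n : ℕ) {y : ℝ} (hy : 0 ≤ y) (hy2 : y ≤ 1 / 2) :
    polyLog s (n : ℕ∞) y ≤ 1 := by
  rw [polyLog_coe]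
  calc _ ≤ ∑ k ∈ Finset.Icc 1 n, (1 / 2 : ℝ) ^ k := by
        refine Finset.sum_le_sum fun k hk => ?_
        rw [Finset.mem_Icc] at hk
        have hk1 : (1 : ℝ) ≤ k := by exact_mod_cast hk.1
        refine (div_le_self (by positivity) (Real.one_le_rpow hk1 hs)).trans ?_
        gcongr
    _ = 1 - (1 / 2) ^ n := sum_Icc_half_pow n
    _ ≤ 1 := by linarith [pow_pos (show (0 : ℝ) < 1 / 2 by norm_num) n]

theorem polyLog_zero_le (n : ℕ) {y : ℝ} (hy : 0 ≤ y) (hy1 : y ≤ 1) :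
    polyLog 0 (n : ℕ∞) y ≤ n := by
  rw [polyLog_coe]
  have h1 := Finset.sum_le_card_nsmul (Finset.Icc 1 n) (fun k => y ^ k / (k : ℝ) ^ (0 : ℝ)) 1
    fun k _ => by rw [Real.rpow_zero, div_one]; exact pow_le_one₀ hy hy1
  simpa using h1

theorem GFun_lt {N : ℕ} (hN : 10 ≤ N) (K : ℕ) {z : ℝ} (hz : 0 ≤ z) (hzN : z ≤ N / 2) :
    GFun (2 * -(N : ℝ)) (K : ℕ∞) N z < 3 * (N : ℝ) ^ 3 := by
  have hN' : (10 : ℝ) ≤ N := by exact_mod_cast hN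
  have hN0 : (0 : ℝ) < N := by linarith
  have h1 := hFun_le (by omega) hz hzN
  have e1 : (2 : ℝ) ^ (-min (2 * -(N : ℝ)) 0) ≤ 4 ^ N := by
    rw [min_eq_left (by linarith), show -(2 * -(N : ℝ)) = 2 * N by ring,
      Real.rpow_mul (by norm_num), Real.rpow_natCast]
    norm_num
  have e2 : (2 * Real.pi) ^ (((N : ℝ) - 1) / 2) ≤ 7 ^ N := by
    calc _ ≤ (2 * Real.pi) ^ (N : ℝ) := Real.rpow_le_rpow_of_exponent_le
          (by linarith [Real.pi_gt_three]) (by linarith)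
      _ = (2 * Real.pi) ^ N := Real.rpow_natCast _ _
      _ ≤ 7 ^ N := pow_le_pow_left₀ (by positivity) (by linarith [Real.pi_lt_d2]) N
  have e3 : (N : ℝ) ^ (2 * -(N : ℝ) - 1 / 2) ≤ (1 / 100) ^ N := by
    calc _ ≤ (N : ℝ) ^ (2 * -(N : ℝ)) :=
          Real.rpow_le_rpow_of_exponent_le (by linarith) (by linarith)
      _ ≤ 10 ^ (2 * -(N : ℝ)) :=
          Real.rpow_le_rpow_of_nonpos (by norm_num) hN' (by linarith)
      _ = (1 / 100) ^ N := by
          rw [Real.rpow_mul (by norm_num), Real.rpow_neg (by norm_num), Real.rpow_natCast,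
            ← inv_pow]
          norm_num
  have e4 : Real.exp ((N : ℝ) / 12) ≤ 3 ^ N := by
    calc _ ≤ Real.exp (N * 1) := Real.exp_le_exp.2 (by linarith)
      _ = Real.exp 1 ^ N := Real.exp_nat_mul 1 N
      _ ≤ 3 ^ N := pow_le_pow_left₀ (Real.exp_pos 1).le (by linarith [Real.exp_one_lt_d9]) N
  have e5 : polyLog 0 (N : ℕ∞) (2 * z / N) ≤ N :=
    polyLog_zero_le N (by positivity) (by rw [div_le_one hN0]; linarith)
  have e6 : polyLog (1 / 2 - (N : ℝ) / 2 - 2 * -(N : ℝ)) (ENat.map (sQuot N) K)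
      (z ^ N / (N : ℝ) ^ N) ≤ 1 := by
    rw [ENat.map_natCast]
    refine polyLog_le_one (by linarith) _ (by positivity) ?_
    rw [← div_pow]
    have hzN' : z / N ≤ 1 / 2 := by rw [div_le_iff₀ hN0]; linarith
    calc (z / N) ^ N ≤ (1 / 2) ^ N := pow_le_pow_left₀ (by positivity) hzN' N
      _ ≤ (1 / 2) ^ 1 := pow_le_pow_of_le_one (by norm_num) (by norm_num) (by omega)
      _ = _ := by norm_num
  have p5 := polyLog_nonneg 0 (N : ℕ∞) (show 0 ≤ 2 * z / N by positivity)
  have p6 := polyLog_nonneg (1 / 2 - (N : ℝ) / 2 - 2 * -(N : ℝ)) (ENat.map (sQuot N) K)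
    (show 0 ≤ z ^ N / (N : ℝ) ^ N by positivity)
  unfold GFun
  -- The exponent `q = -2N` supplies `N^{-2N} ≤ 100^{-N}`, which outweighs the other exponential
  -- factors `4 · 7 · 3 = 84`.
  calc _ ≤ (N : ℝ) ^ 3 + 4 ^ N * 7 ^ N * (1 / 100) ^ N * 3 ^ N * N * 1 := by gcongr
    _ = (N : ℝ) ^ 3 + (84 / 100) ^ N * N := by
        rw [← mul_pow, ← mul_pow, ← mul_pow]; norm_num
    _ ≤ (N : ℝ) ^ 3 + 1 * N := by
        gcongr
        exact pow_le_one₀ (by norm_num) (by norm_num)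
    _ < _ := by nlinarith [sq_nonneg ((N : ℝ) - 1)]

/-- The single term with `k = ⌈X⌉` suffices. Rounding up costs at most `exp(e/X)` with `e = 2N +
1/2`, which the spare base `35/34 = (35/32)/(17/16)` absorbs. -/
theorem lt_RFun {N : ℕ} (hN : 1 ≤ N) {X w : ℝ} (hX : 0 < X) {K : ℕ} (hXK : X ≤ K)
    (hw : 35 / 32 ≤ w) (hbig : (2 * N + 1 / 2) / X < X * Real.log (35 / 34)) :
    1 / (2 * √Real.pi) * X ^ (2 * -(N : ℝ) - 1 / 2) * (17 / 16) ^ X < RFun (-(N : ℝ)) (K : ℕ∞) w := by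
  have hN' : (1 : ℝ) ≤ N := by exact_mod_cast hN
  unfold RFun
  rw [if_neg (by linarith), mul_assoc]
  refine mul_lt_mul_of_pos_left ?_ (by positivity)
  rw [polyLog_coe]
  set k := ⌈X⌉₊ with hk
  have hkX : X ≤ k := Nat.le_ceil X
  have hk1 : 1 ≤ k := Nat.one_le_iff_ne_zero.2 fun h => by
    rw [h, Nat.cast_zero] at hkX; linarith
  have hkK : k ≤ K := Nat.ceil_le.2 hXK
  have hk0 : (0 : ℝ) < k := by exact_mod_cast hk1
  have hkX1 : (k : ℝ) ≤ X + 1 := (Nat.ceil_lt_add_one hX.le).le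
  refine lt_of_lt_of_le ?_ (Finset.single_le_sum (f := fun k : ℕ => w ^ k / (k : ℝ) ^
    (1 / 2 - 2 * -(N : ℝ))) (fun i _ => by positivity) (Finset.mem_Icc.2 ⟨hk1, hkK⟩))
  set e : ℝ := 2 * N + 1 / 2 with he
  have he1 : 1 / 2 - 2 * -(N : ℝ) = e := by rw [he]; ring
  have he2 : 2 * -(N : ℝ) - 1 / 2 = -e := by rw [he]; ring
  have he0 : 0 ≤ e := by positivity
  have h1 : (k : ℝ) ^ e ≤ X ^ e * Real.exp (e / X) := by
    calc (k : ℝ) ^ e ≤ (X * Real.exp (1 / X)) ^ e := by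
          refine Real.rpow_le_rpow hk0.le (hkX1.trans ?_) he0
          calc X + 1 = X * (1 / X + 1) := by rw [mul_add, mul_one_div_cancel hX.ne']; ring
            _ ≤ _ := by gcongr; exact Real.add_one_le_exp _
      _ = X ^ e * Real.exp (e / X) := by
          rw [Real.mul_rpow hX.le (Real.exp_pos _).le, ← Real.exp_mul]
          congr 2; ring
  have h2 : (35 / 32 : ℝ) ^ X ≤ w ^ k := by
    calc (35 / 32 : ℝ) ^ X ≤ (35 / 32) ^ (k : ℝ) :=
          Real.rpow_le_rpow_of_exponent_le (by norm_num) hkX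
      _ = (35 / 32) ^ k := Real.rpow_natCast _ _
      _ ≤ w ^ k := by gcongr
  have h3 : (35 / 32 : ℝ) ^ X = (17 / 16) ^ X * (35 / 34) ^ X := by
    rw [← Real.mul_rpow (by norm_num) (by norm_num)]; norm_num
  have h4 : Real.exp (e / X) < (35 / 34) ^ X := by
    rw [Real.rpow_def_of_pos (by norm_num), mul_comm]
    exact Real.exp_lt_exp.2 hbig
  simp only [he1, he2]
  rw [lt_div_iff₀ (by positivity), Real.rpow_neg hX.le]
  have hXe : 0 < X ^ e := by positivity
  calc (X ^ e)⁻¹ * (17 / 16) ^ X * (k : ℝ) ^ e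
      ≤ (X ^ e)⁻¹ * (17 / 16) ^ X * (X ^ e * Real.exp (e / X)) := by gcongr
    _ = (17 / 16) ^ X * Real.exp (e / X) := by field_simp
    _ < (17 / 16) ^ X * (35 / 34) ^ X := by gcongr
    _ ≤ _ := by rw [← h3]; exact h2

/-- With `q_α = -N` the logarithm of the power of `ζN²` is of order `N log N`, negligible against
`N²`. -/
theorem dominates_neg {ζ CR : ℝ} (hζ : 0 < ζ) (hCR : 1 < CR) :
    Dominates ζ CR fun N => -(N : ℝ) := by
  have hL := Real.log_pos hCR
  have ht : Tendsto (fun N : ℕ => (N : ℝ)) atTop atTop := tendsto_natCast_atTop_atTop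
  have h1 : Tendsto (fun N : ℕ => (1 : ℝ) / N) atTop (𝓝 0) := tendsto_one_div_atTop_nhds_zero_nat
  have h2 : Tendsto (fun N : ℕ => Real.log N / N) atTop (𝓝 0) := by
    have := (Real.isLittleO_log_id_atTop.tendsto_div_nhds_zero).comp ht
    exact this
  have h3 : Tendsto (fun N : ℕ => 1 + 1 / (ζ * Real.log CR) *
      ((-Real.log (2 * √Real.pi) - 1 / 2 * Real.log ζ) * (1 / (N : ℝ) * (1 / N)) -
        2 * Real.log ζ * (1 / N) - 4 * (Real.log N / N) - Real.log N / N * (1 / N)))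
      atTop (𝓝 (1 + 1 / (ζ * Real.log CR) *
      ((-Real.log (2 * √Real.pi) - 1 / 2 * Real.log ζ) * (0 * 0) -
        2 * Real.log ζ * 0 - 4 * 0 - 0 * 0))) :=
    ((((((h1.mul h1).const_mul _).sub (h1.const_mul _)).sub (h2.const_mul _)).sub
      (h2.mul h1)).const_mul _).const_add _
  simp only [mul_zero, sub_zero, add_zero] at h3
  refine h3.congr' ?_
  filter_upwards [eventually_ge_atTop 1] with N hN
  have hN' : (0 : ℝ) < N := by exact_mod_cast hN
  rw [log_mainTerm hζ hCR hN, Real.log_rpow (by linarith), Real.log_mul hζ.ne' (by positivity),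
    Real.log_pow]
  push_cast
  field_simp
  ring

/-! ### An open set of admissible problems -/

section Family

variable {N K : ℕ}

instance finite_deg : Finite (Deg (K : ℕ∞)) :=
  Finite.of_injective
    (fun k => (⟨k.1, Nat.lt_succ_of_le (Nat.cast_le.1 k.2)⟩ : Fin (K + 1)))
    fun _ _ h => Subtype.ext (Fin.mk.inj_iff.1 h)

/-- Strict versions of the conditions on the coefficients and on the matrix. -/
def problemFamily (N K : ℕ) (γα γβ q : ℝ) :
    Set (Coeff N (K : ℕ∞) × Matrix (Fin N) (Fin N) ℝ) :=
  {x | ((∀ i j, 37 / 50 / (N : ℝ) < x.2 i j ∧ x.2 i j < 22 / 25 / (N : ℝ)) ∧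
      ∑ i, ∑ j, x.2 i j ^ 2 < 4 / 5) ∧ 0 < coeffZero x.1 ∧
    ∀ k : Deg (K : ℕ∞), 1 ≤ k.1 →
      ((k.1 : ℝ) ^ q * γα ^ k.1 / ((2 * k.1).factorial : ℝ) < ∑ I : MIdx N k.1, (x.1 k I : ℝ) ∧
      ∑ I : MIdx N k.1, (x.1 k I : ℝ) < (k.1 : ℝ) ^ q * γβ ^ k.1 / ((2 * k.1).factorial : ℝ)) ∧
      ∑ I : MIdx N k.1, (x.1 k I : ℝ) ^ 2 * multiFactorial I.1 <
        (k.1 : ℝ) ^ (2 * q) * γβ ^ (2 * k.1) / ((2 * k.1).factorial : ℝ) ^ 2 * mCoef N k.1}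

/-- For finite `K` these are finitely many strict inequalities between continuous functions. -/
theorem isOpen_problemFamily (γα γβ q : ℝ) : IsOpen (problemFamily N K γα γβ q) := by
  have h1 : ∀ (k : Deg (K : ℕ∞)) (I : MIdx N k.1), Continuous fun x : Coeff N (K : ℕ∞) ×
      Matrix (Fin N) (Fin N) ℝ => (x.1 k I : ℝ) := fun k I =>
    NNReal.continuous_coe.comp ((continuous_apply I).comp ((continuous_apply k).comp continuous_fst))
  have h2 : ∀ i j, Continuous fun x : Coeff N (K : ℕ∞) × Matrix (Fin N) (Fin N) ℝ => x.2 i j :=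
    fun i j => continuous_snd.matrix_elem i j
  unfold problemFamily
  simp only [Set.ofPred_and, Set.ofPred_forall]
  refine ((isOpen_iInter_of_finite fun i => isOpen_iInter_of_finite fun j =>
    (isOpen_lt continuous_const (h2 i j)).inter (isOpen_lt (h2 i j) continuous_const)).inter
    (isOpen_lt ?_ continuous_const)).inter ((isOpen_lt continuous_const (h1 _ _)).inter
      (isOpen_iInter_of_finite fun k => isOpen_iInter_of_finite fun _ =>
        ((isOpen_lt continuous_const ?_).inter (isOpen_lt ?_ continuous_const)).inter
          (isOpen_lt ?_ continuous_const)))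
  · exact continuous_finsetSum _ fun i _ => continuous_finsetSum _ fun j _ => (h2 i j).pow 2
  · exact continuous_finsetSum _ fun I _ => h1 k I
  · exact continuous_finsetSum _ fun I _ => h1 k I
  · exact continuous_finsetSum _ fun I _ => ((h1 k I).pow 2).mul continuous_const

theorem admissible_of_mem_problemFamily {ζ p : ℝ} (hN : 10 ≤ N) (hζ : 0 < ζ) (hp : 0 < p)
    (hK : ζ * (N : ℝ) ^ 2 ≤ K)
    (hbig : (2 * N + 1 / 2) / (ζ * (N : ℝ) ^ 2) < ζ * (N : ℝ) ^ 2 * Real.log (35 / 34))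
    {x : Coeff N (K : ℕ∞) × Matrix (Fin N) (Fin N) ℝ}
    (hx : x ∈ problemFamily N K ((N : ℝ) ^ 2 / 2) (9 / 16 * (N : ℝ) ^ 2) (-(N : ℝ)))
    (hxP : x ∈ problemSpace N (K : ℕ∞)) :
    Admissible ζ p ((N : ℝ) ^ 2 / 2) (9 / 16 * (N : ℝ) ^ 2) (-(N : ℝ)) (-(N : ℝ)) 3 3 (17 / 16)
      x := by
  obtain ⟨⟨hent, hsq⟩, ha0, ha⟩ := hx
  have hN0 : (0 : ℝ) < N := by exact_mod_cast (by omega : 0 < N)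
  have hN1 : (1 : ℝ) ≤ N := by exact_mod_cast (by omega : 1 ≤ N)
  have : NeZero N := ⟨by omega⟩
  have hb1 : bmax x.2 ≤ 22 / 25 / N :=
    bmax_le (fun i j => (hxP.1.1 i j).le) fun i j => (hent i j).2.le
  have hb2 : 37 / 50 / (N : ℝ) ≤ bmin x.2 := le_bmin fun i j => (hent i j).1.le
  refine ⟨hxP, ⟨hxP.1, fun h => absurd h (ENat.natCast_ne_top K), ?_, ?_, ?_⟩, ?_, ha0.ne'⟩
  -- The entry bound gives `γ_β b_max ≤ 99N/200 < N/2`.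
  · refine GFun_lt hN K (mul_nonneg (by positivity) (bmax_nonneg _)) ?_
    calc 9 / 16 * (N : ℝ) ^ 2 * bmax x.2 ≤ 9 / 16 * (N : ℝ) ^ 2 * (22 / 25 / (N : ℝ)) := by gcongr
      _ = 99 / 200 * (N : ℝ) := by field_simp; norm_num
      _ ≤ _ := by linarith
  -- The entry bound gives `4 γ_α b_min² ≥ 2 · 0.74² = 1.0952 > 35/32`, slightly above `C_R =
  -- 17/16`.
  · refine lt_RFun (by omega) (by positivity) hK ?_ hbig
    calc (35 / 32 : ℝ) ≤ 4 * ((N : ℝ) ^ 2 / 2) * (37 / 50 / (N : ℝ)) ^ 2 := by field_simp; norm_num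
      _ ≤ _ := by gcongr
  · refine (one_div_normConst_lt hxP.1 hsq).trans_le ?_
    have : (1 : ℝ) ≤ (N : ℝ) ^ p := Real.one_le_rpow hN1 hp.le
    linarith
  · intro k hk
    obtain ⟨⟨h1, h2⟩, h3⟩ := ha k hk
    exact ⟨h1.le, h2.le, h3.le⟩

/-- The coefficients `t_k`, placed at the balanced multi-indices. -/
def balancedCoeff (hN : 1 ≤ N) (t : ℕ → ℝ≥0) : Coeff N (K : ℕ∞) :=
  fun k I => if I = ⟨balanced N k.1, balanced_mem N k.1 hN⟩ then t k.1 else 0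

theorem sum_balancedCoeff (hN : 1 ≤ N) (t : ℕ → ℝ≥0) (k : Deg (K : ℕ∞)) :
    ∑ I : MIdx N k.1, (balancedCoeff hN t k I : ℝ) = t k.1 := by
  unfold balancedCoeff
  rw [Finset.sum_eq_single ⟨balanced N k.1, balanced_mem N k.1 hN⟩]
  · rw [if_pos rfl]
  · intro I _ hI
    rw [if_neg hI, NNReal.coe_zero]
  · simp

theorem sum_balancedCoeff_sq (hN : 1 ≤ N) (t : ℕ → ℝ≥0) (k : Deg (K : ℕ∞)) :
    ∑ I : MIdx N k.1, (balancedCoeff hN t k I : ℝ) ^ 2 * multiFactorial I.1 =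
      (t k.1 : ℝ) ^ 2 * mCoef N k.1 := by
  unfold balancedCoeff
  rw [Finset.sum_eq_single ⟨balanced N k.1, balanced_mem N k.1 hN⟩]
  · rw [if_pos rfl, multiFactorial_balanced N k.1 hN]
  · intro I _ hI
    rw [if_neg hI, NNReal.coe_zero]
    ring
  · simp

theorem coeffZero_balancedCoeff (hN : 1 ≤ N) (t : ℕ → ℝ≥0) :
    coeffZero (balancedCoeff (K := K) hN t) = t 0 := by
  have h := sum_balancedCoeff (K := K) hN t (Deg.zero (K : ℕ∞))
  exact (sum_MIdx_zero fun I => (balancedCoeff hN t (Deg.zero (K : ℕ∞)) I : ℝ)).symm.trans h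

theorem mem_coeffSpace {B : Matrix (Fin N) (Fin N) ℝ} {a : Coeff N (K : ℕ∞)}
    (ha : 0 < coeffZero a) : a ∈ coeffSpace (K : ℕ∞) B := by
  have hs : Summable fun k : Deg (K : ℕ∞) => ∑ I : MIdx N k.1, (a k I : ℝ) * haf B I.1 ^ 2 :=
    summable_of_hasFiniteSupport (Set.toFinite _)
  exact ⟨hs, (ha.trans_le (coeffZero_le_mu hs)).ne', summable_of_hasFiniteSupport (Set.toFinite _),
    summable_of_hasFiniteSupport (Set.toFinite _)⟩

theorem exists_mem_problemFamily (hN : 10 ≤ N) {a₀ : ℝ} (ha₀ : 0 < a₀) :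
    ∃ x ∈ problemFamily N K ((N : ℝ) ^ 2 / 2) (9 / 16 * (N : ℝ) ^ 2) (-(N : ℝ)) ∩
      problemSpace N (K : ℕ∞), coeffZero x.1 = a₀ := by
  have hN0 : (0 : ℝ) < N := by exact_mod_cast (by omega : 0 < N)
  have hN10 : (10 : ℝ) ≤ N := by exact_mod_cast hN
  have hN1 : 1 ≤ N := by omega
  -- The factor `17/32` lies strictly between the `1/2` of `γ_α` and the `9/16` of `γ_β`. The value
  -- at `k = 0` is free, so every `a_0` occurs.
  let t : ℕ → ℝ≥0 := fun k => if k = 0 then a₀.toNNReal else Real.toNNReal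
    ((k : ℝ) ^ (-(N : ℝ)) * (17 / 32 * (N : ℝ) ^ 2) ^ k / ((2 * k).factorial : ℝ))
  have ht0 : (t 0 : ℝ) = a₀ := by simp [t, ha₀.le]
  have ht : ∀ k, 1 ≤ k → (t k : ℝ) =
      (k : ℝ) ^ (-(N : ℝ)) * (17 / 32 * (N : ℝ) ^ 2) ^ k / ((2 * k).factorial : ℝ) := fun k hk => by
    simp only [t]
    rw [if_neg (by omega), Real.coe_toNNReal _ (by positivity)]
  have hz : coeffZero (balancedCoeff (K := K) hN1 t) = a₀ :=
    (coeffZero_balancedCoeff hN1 t).trans ht0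
  -- The entries are `7/(8N)` on and `3/(4N)` off the diagonal; the eigenvalues are at most `1/(8N)
  -- + 3/4`.
  have hB : scalarAddConst N (1 / 8 / N) (3 / 4 / N) ∈ matrixSpace N := by
    refine scalarAddConst_mem (by positivity) (by positivity) ?_
    rw [mul_div_cancel₀ _ hN0.ne']
    have : 1 / 8 / (N : ℝ) ≤ 1 / 8 := div_le_self (by norm_num) (by linarith)
    linarith
  refine ⟨(balancedCoeff hN1 t, scalarAddConst N (1 / 8 / N) (3 / 4 / N)),
    ⟨⟨⟨fun i j => ?_, ?_⟩, ?_, fun k hk => ?_⟩, hB, mem_coeffSpace (by rw [hz]; exact ha₀)⟩, hz⟩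
  · simp only [scalarAddConst, Matrix.of_apply]
    have h1 : 0 < 1 / (N : ℝ) := by positivity
    rw [div_eq_mul_one_div (37 / 50), div_eq_mul_one_div (22 / 25), div_eq_mul_one_div (1 / 8),
      div_eq_mul_one_div (3 / 4)]
    split_ifs <;> constructor <;> linarith
  · simp only
    rw [sum_scalarAddConst_sq, mul_div_cancel₀ _ hN0.ne']
    have h2 : (N : ℝ) * ((1 / 8 / N) ^ 2 + 2 * (1 / 8 / N) * (3 / 4 / N)) = 13 / 64 / N := by
      field_simp; norm_num
    have h3 : 13 / 64 / (N : ℝ) ≤ 13 / 64 / 10 := by gcongr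
    rw [h2]
    linarith
  · rw [hz]; exact ha₀
  · simp only
    rw [sum_balancedCoeff, sum_balancedCoeff_sq, ht k.1 hk]
    have hk0 : (0 : ℝ) < k.1 := by exact_mod_cast hk
    have hkp : 0 < (k.1 : ℝ) ^ (-(N : ℝ)) := by positivity
    have hfac : (0 : ℝ) < ((2 * k.1).factorial : ℝ) := by positivity
    have hm := mCoef_pos N k.1
    have hg1 : ((N : ℝ) ^ 2 / 2) ^ k.1 < (17 / 32 * (N : ℝ) ^ 2) ^ k.1 :=
      pow_lt_pow_left₀ (by nlinarith) (by positivity) (by omega)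
    have hg2 : (17 / 32 * (N : ℝ) ^ 2) ^ k.1 < (9 / 16 * (N : ℝ) ^ 2) ^ k.1 :=
      pow_lt_pow_left₀ (by nlinarith) (by positivity) (by omega)
    have hg3 : ((17 / 32 * (N : ℝ) ^ 2) ^ k.1) ^ 2 < ((9 / 16 * (N : ℝ) ^ 2) ^ k.1) ^ 2 :=
      pow_lt_pow_left₀ hg2 (by positivity) two_ne_zero
    have hsq : (k.1 : ℝ) ^ (2 * -(N : ℝ)) = ((k.1 : ℝ) ^ (-(N : ℝ))) ^ 2 := by
      rw [mul_comm, Real.rpow_mul hk0.le]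
      norm_cast
    refine ⟨⟨by gcongr, by gcongr⟩, ?_⟩
    rw [hsq, pow_mul', div_pow, mul_pow ((k.1 : ℝ) ^ (-(N : ℝ)))]
    gcongr

theorem exists_open_problems {ζ p : ℝ} (hζ : 0 < ζ) (hp : 0 < p) :
    ∃ (CG CD CR : ℝ) (γα γβ qα qβ : ℕ → ℝ) (N₀ : ℕ),
      0 < CG ∧ 0 < CD ∧ 1 < CR ∧ Dominates ζ CR qα ∧
      (∀ N, 0 < γα N ∧ 0 < γβ N) ∧
      ∀ N K : ℕ, N₀ ≤ N → ζ * (N : ℝ) ^ 2 ≤ (K : ℝ) →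
        ∃ U : Set (Coeff N (K : ℕ∞) × Matrix (Fin N) (Fin N) ℝ),
          U.Nonempty ∧
          (∃ V : Set (Coeff N (K : ℕ∞) × Matrix (Fin N) (Fin N) ℝ),
            IsOpen V ∧ U = V ∩ problemSpace N (K : ℕ∞)) ∧
          (∀ x ∈ U, Admissible ζ p (γα N) (γβ N) (qα N) (qβ N) CG CD CR x) ∧
          (∀ a₀ : ℝ, 0 < a₀ → ∃ x ∈ U, coeffZero x.1 = a₀) := by
  have hlog : 0 < Real.log (35 / 34) := Real.log_pos (by norm_num)
  obtain ⟨N₀, hN₀⟩ := eventually_atTop.1 ((tendsto_zeta_mul_sq hζ).eventually_ge_atTop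
    (3 / (ζ * Real.log (35 / 34))))
  -- The maximum with `1` only keeps `γ_α` and `γ_β` positive at `N = 0`.
  refine ⟨3, 3, 17 / 16, fun N => ((max N 1 : ℕ) : ℝ) ^ 2 / 2,
    fun N => 9 / 16 * ((max N 1 : ℕ) : ℝ) ^ 2, fun N => -(N : ℝ), fun N => -(N : ℝ), max 10 N₀,
    by norm_num, by norm_num, by norm_num, dominates_neg hζ (by norm_num), fun N => ?_,
    fun N K hN hK => ?_⟩
  · have : (0 : ℝ) < ((max N 1 : ℕ) : ℝ) := by
      exact_mod_cast lt_of_lt_of_le one_pos (le_max_right N 1)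
    constructor <;> positivity
  · have hN10 : 10 ≤ N := (le_max_left _ _).trans hN
    have hX := hN₀ N ((le_max_right _ _).trans hN)
    have hN0 : (1 : ℝ) ≤ N := by exact_mod_cast (by omega : 1 ≤ N)
    have hbig : (2 * N + 1 / 2) / (ζ * (N : ℝ) ^ 2) < ζ * (N : ℝ) ^ 2 * Real.log (35 / 34) := by
      rw [div_lt_iff₀ (by positivity)]
      rw [div_le_iff₀ (by positivity)] at hX
      calc (2 * N + 1 / 2 : ℝ) < 3 * (N : ℝ) ^ 2 := by nlinarith
        _ ≤ ζ * (N : ℝ) ^ 2 * (ζ * Real.log (35 / 34)) * (N : ℝ) ^ 2 := by gcongr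
        _ = _ := by ring
    simp only [max_eq_left (by omega : 1 ≤ N)]
    refine ⟨problemFamily N K ((N : ℝ) ^ 2 / 2) (9 / 16 * (N : ℝ) ^ 2) (-(N : ℝ)) ∩
      problemSpace N (K : ℕ∞), ?_, ⟨_, isOpen_problemFamily _ _ _, rfl⟩, fun x hx => ?_,
      fun a₀ ha₀ => exists_mem_problemFamily hN10 ha₀⟩
    · obtain ⟨x, hx, -⟩ := exists_mem_problemFamily (K := K) hN10 one_pos
      exact ⟨x, hx⟩
    · exact admissible_of_mem_problemFamily hN10 hζ hp hK hbig hx.1 hx.2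

end Family

end GBS

end

/-! ### The four claims together. -/

theorem mainTheorem3 :
    -- the polynomial upper bound, for every `N`
    (∀ (N : ℕ) (K : ℕ∞) (ζ p γα γβ qα qβ CG CD CR ε δ : ℝ),
      1 ≤ N → 0 < ζ → ENNReal.ofReal (ζ * (N : ℝ) ^ 2) ≤ (K : ℝ≥0∞) → 0 < p →
      0 < γα → 0 < γβ → 0 < CG → 0 < CD → 1 < CR → 0 < ε → ε < 1 → 0 < δ → δ < 1 →
      ∀ x : GBS.Coeff N K × Matrix (Fin N) (Fin N) ℝ,
        GBS.Admissible ζ p γα γβ qα qβ CG CD CR x →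
        GBS.nGBS x.2 x.1 ε δ < 1 / (ε ^ 2 * δ) *
          (CD * (N : ℝ) ^ p
            + CG * CD * (N : ℝ) ^ (3 + p) / (GBS.coeffZero x.1 ^ 2 * √Real.pi) - 1)) ∧
    -- the exponential lower bound, for all large `N`; the threshold depends only on `ζ`, `C_R`
    -- and the sequence `q_α`
    (∀ (ζ CR : ℝ) (qα : ℕ → ℝ), 0 < ζ → 1 < CR → GBS.Dominates ζ CR qα →
      ∃ N₁ : ℕ, ∀ (N : ℕ) (K : ℕ∞) (p γα γβ qβ CG CD ε δ : ℝ),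
        N₁ ≤ N → ENNReal.ofReal (ζ * (N : ℝ) ^ 2) ≤ (K : ℝ≥0∞) → 0 < p →
        0 < γα → 0 < γβ → 0 < CG → 0 < CD → 0 < ε → ε < 1 → 0 < δ → δ < 1 →
        ∀ x : GBS.Coeff N K × Matrix (Fin N) (Fin N) ℝ,
          GBS.Admissible ζ p γα γβ (qα N) qβ CG CD CR x →
          GBS.nMC x.2 x.1 ε δ > 1 / (ε ^ 2 * δ) *
            ((Real.exp (1 / 25 - 1 / 6) / (2 * √Real.pi) *
                (ζ * (N : ℝ) ^ 2) ^ (2 * qα N - 1 / 2) * CR ^ (ζ * (N : ℝ) ^ 2)) /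
              (CD * (N : ℝ) ^ p *
                (GBS.coeffZero x.1 ^ 2 + 1 / √Real.pi * CG * (N : ℝ) ^ 3)))) ∧
    -- the resulting rates in `N`, for `a_0` independent of `N`
    (∀ (ζ p CG CD CR a₀ C : ℝ) (qα : ℕ → ℝ),
      0 < ζ → 0 < p → 0 < CG → 0 < CD → 1 < CR → 0 < a₀ → GBS.Dominates ζ CR qα →
      1 < C → C < CR →
      ∃ (c₁ c₂ : ℝ) (N₁ : ℕ), 0 < c₁ ∧ 0 < c₂ ∧
        ∀ (N : ℕ) (K : ℕ∞) (γα γβ qβ ε δ : ℝ),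
          N₁ ≤ N → ENNReal.ofReal (ζ * (N : ℝ) ^ 2) ≤ (K : ℝ≥0∞) →
          0 < γα → 0 < γβ → 0 < ε → ε < 1 → 0 < δ → δ < 1 →
          ∀ x : GBS.Coeff N K × Matrix (Fin N) (Fin N) ℝ,
            GBS.Admissible ζ p γα γβ (qα N) qβ CG CD CR x → GBS.coeffZero x.1 = a₀ →
            GBS.nGBS x.2 x.1 ε δ ≤ 1 / (ε ^ 2 * δ) * (c₁ * (N : ℝ) ^ (3 + p)) ∧
            GBS.nMC x.2 x.1 ε δ ≥ 1 / (ε ^ 2 * δ) * (c₂ * C ^ (ζ * (N : ℝ) ^ 2))) ∧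
    -- such problems contain a non-empty open subset of the problem space
    (∀ ζ p : ℝ, 0 < ζ → 0 < p →
      ∃ (CG CD CR : ℝ) (γα γβ qα qβ : ℕ → ℝ) (N₀ : ℕ),
        0 < CG ∧ 0 < CD ∧ 1 < CR ∧ GBS.Dominates ζ CR qα ∧
        (∀ N, 0 < γα N ∧ 0 < γβ N) ∧
        ∀ N K : ℕ, N₀ ≤ N → ζ * (N : ℝ) ^ 2 ≤ (K : ℝ) →
          ∃ U : Set (GBS.Coeff N (K : ℕ∞) × Matrix (Fin N) (Fin N) ℝ),
            U.Nonempty ∧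
            (∃ V : Set (GBS.Coeff N (K : ℕ∞) × Matrix (Fin N) (Fin N) ℝ),
              IsOpen V ∧ U = V ∩ GBS.problemSpace N (K : ℕ∞)) ∧
            (∀ x ∈ U, GBS.Admissible ζ p (γα N) (γβ N) (qα N) (qβ N) CG CD CR x) ∧
            -- every positive `a_0` (chosen independently of `N`) occurs
            (∀ a₀ : ℝ, 0 < a₀ → ∃ x ∈ U, GBS.coeffZero x.1 = a₀)) := by
  refine ⟨fun N K ζ p γα γβ qα qβ CG CD CR ε δ hN _ _ _ _ hγβ _ _ _ hε _ hδ _ x hx =>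
      hx.nGBS_lt hN hγβ hε hδ, fun ζ CR qα hζ hCR h => ?_,
    fun ζ p CG CD CR a₀ C qα hζ _ hCG hCD hCR ha₀ h hC hCCR =>
      h.exists_rates hζ hCG hCD hCR ha₀ hC hCCR, fun ζ p hζ hp => GBS.exists_open_problems hζ hp⟩
  obtain ⟨N₁, hN₁⟩ := h.exists_nMC_gt hζ hCR
  exact ⟨N₁, fun N K p γα γβ qβ CG CD ε δ hN hK _ hγα hγβ _ _ hε _ hδ _ x hx =>
    hN₁ N K p γα γβ qβ CG CD ε δ hN hK hγα hγβ hε hδ x hx⟩
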